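/- **Setting.** Let $\nu$ be a centered, compactly supported probability measure on $\mathbb R$. For a probability measure $\mu$ on $\mathbb R$ let $m_\mu(z)=\int (v-z)^{-1}\,d\mu(v)$ be its Stieltjes transform, $m^{(k)}(\mu)=\int v^k\,d\mu$ and $\kappa^{(k)}(\mu)=\int (v-m^{(1)}(\mu))^k\,d\mu$ its raw and central moments, and $I_\mu$ the smallest interval containing $\operatorname{supp}\mu$. Fix $\lambda_0\ge 0$, $\beta\ge 0$, $0<\phi\le 1/2$, $\varpi>0$, $0<c_4\le C_4$, put $\lambda=\lambda_N=\lambda_0N^{-\beta}$, $q=q_N=N^{\phi}$, and let $s\in[c_4,C_4]$ (possibly depending on $N$). Assume $$\inf_{x\in I_\nu}\int\frac{d\nu(v)}{(v-x)^2}\ \ge\ (1+\varpi)\lambda^2\qquad\text{for all large }N$$ (such integrals are $+\infty$ when they diverge). For $V=\operatorname{diag}(V_1,\dots,V_N)$ let $\widehat\nu_N=\frac1N\sum_i\delta_{V_i}$. A *test domain* is a compact subset of $\{z\in\mathbb C:\operatorname{Im}z\ge 0\}$ disjoint from $\operatorname{supp}\nu$. Given $\mathfrak a>0$, $K$, and families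 of constants $B(D)$, $n_0(D)$ indexed by test domains, all independent of $N$, let $\Xi_N$ be the event that $\max_i|V_i|\le K$, that $\inf_{x\in I_{\widehat\nu_N}}\int (v-x)^{-2}d\widehat\nu_N(v)\ge(1+\varpi)\lambda^2$, and that $\sup_{z\in D}|m_{\widehat\nu_N}(z)-m_\nu(z)|\le B(D)N^{-\mathfrak a}$ for every test domain $D$ with $n_0(D)\le N$. The free additive convolution $\mu_1\boxplus\mu_2$ is the probability measure $\rho$ for which there are analytic $\omega_1,\omega_2:\mathbb C^+\to\mathbb C^+$ with $\omega_i(\mathrm iy)/(\mathrm iy)\to1$ as $y\to\infty$ and $m_\rho(z)=m_{\mu_1}(\omega_1(z))=m_{\mu_2}(\omega_2(z))$, $\omega_1(z)+\omega_2(z)=z-1/m_\rho(z)$ for all $z\in\mathbb C^+$. Let $\rho_{\mathrm{sc}}$ be the standard semicircle law. **Properties $\mathcal P(\mu;\varpi',C)$** of a probability measure $\mu$ (for given $\lambda,s,q$). Let $\mu'$ be the refined measure $$\mu'=\tfrac12\big(\text{law of }\lambda v+\tfrac{\sqrt s}{q}\big)+\tfrac12\big(\text{law of }\lambda v-\tfrac{\sqrt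 s}{q}\big),\qquad v\sim\mu .$$ 1. $\mu'$ is a probability measure, equal to the classical convolution of the law of $\lambda v$ with $\frac12(\delta_{\sqrt s/q}+\delta_{-\sqrt s/q})$. The interval $I_{\mu'}$ is compact and carries $\mu'$, and $$\inf_{x\in I_{\mu'}}\int\frac{d\mu'(v)}{(v-x)^2}\ge 1+\varpi'.$$ Moreover $$m^{(1)}(\mu')=\lambda m^{(1)}(\mu),\qquad m^{(2)}(\mu')=\lambda^2m^{(2)}(\mu)+\tfrac{s}{q^2},$$ $$m^{(3)}(\mu')=\lambda^3m^{(3)}(\mu)+\tfrac{3s\lambda}{q^2}m^{(1)}(\mu),\qquad m^{(4)}(\mu')=\lambda^4m^{(4)}(\mu)+\tfrac{6s\lambda^2}{q^2}m^{(2)}(\mu)+\tfrac{s^2}{q^4}.$$ In particular, if $\mu$ is centered, then $m^{(1)}(\mu')=0$ and $m^{(3)}(\mu')=\lambda^3m^{(3)}(\mu)$. 2. The free additive convolution $\rho=\rho_{\mathrm{sc}}\boxplus\mu'$ exists and is unique. Its Stieltjes transform $m=m_\rho$ maps $\mathbb C^+$ to $\mathbb C^+$, and for all $z\in\mathbb C^+$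 $$m(z)=\int\Big(\lambda v-z-m(z)-\frac{s}{q^2}\,\frac1{\lambda v-z-m(z)}\Big)^{-1}d\mu(v).$$ There are $L_-<L_+$ with $\operatorname{supp}\rho=[L_-,L_+]$. The measure $\rho$ is absolutely continuous with density $E\mapsto\lim_{\eta\downarrow0}\frac1\pi\operatorname{Im}m(E+\mathrm i\eta)$ (the limit exists for every $E\in\mathbb R$), which is strictly positive on $(L_-,L_+)$. 3. If $\lambda\ll1$ (that is, $\lambda_N\to0$), then $$L_+=2+m^{(1)}(\mu')+\kappa^{(2)}(\mu')+\kappa^{(3)}(\mu')+\Big(\kappa^{(4)}(\mu')-\tfrac94\kappa^{(2)}(\mu')^2\Big)+\mathcal E_+,$$ $$L_-=-2+m^{(1)}(\mu')-\kappa^{(2)}(\mu')+\kappa^{(3)}(\mu')-\Big(\kappa^{(4)}(\mu')-\tfrac94\kappa^{(2)}(\mu')^2\Big)+\mathcal E_-,$$ with $|\mathcal E_\pm|\le C\big(\lambda^5+q^{-6}+\lambda^3q^{-2}|\kappa^{(3)}(\mu)|\big)$. In particular, if $\mu$ is centered, the same holds with all $\kappa^{(k)}$ replaced by $m^{(k)}$.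 **Proposition 2.5.** * (On $\Xi_N$.) For all $\mathfrak a>0$, $K$, $B(\cdot)$, $n_0(\cdot)$ there are $\varpi'>0$, $C$ and $N_0$ such that for all $N\ge N_0$, all $s\in[c_4,C_4]$ and every realization of $V$ in $\Xi_N$, $\mathcal P(\widehat\nu_N;\varpi',C)$ holds. Here $\mu'=\widetilde\nu_N^\lambda$, $\rho=\widetilde\rho_{\mathrm{fc}}$, $L_\pm=\widetilde L_\pm$. * (Deterministic $V$.) Suppose that $V^{(N)}$ is deterministic with uniformly bounded entries, that for some $\mathfrak a_0>0$ we have $\sup_{z\in D}|m_{\widehat\nu_N}(z)-m_\nu(z)|=O(N^{-\mathfrak a_0})$ for every test domain $D$, and that $\inf_{x\in I_{\widehat\nu_N}}\int (v-x)^{-2}d\widehat\nu_N(v)\ge(1+\varpi)\lambda^2$ for all large $N$. Then there are $\varpi'>0$, $C$, $N_0$ such that $\mathcal P(\widehat\nu_N;\varpi',C)$ holds for all $N\ge N_0$ and $s\in[c_4,C_4]$. * (Random $V$.) Suppose that $V_1,\dots,V_N$ are i.i.d. with law $\nu$, and that for some $\mathfrak t>0$ we have $\inf_{x\in I_{\widehat\nu_N}}\int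 (v-x)^{-2}d\widehat\nu_N(v)\ge(1+\varpi)\lambda^2$ with probability at least $1-N^{-\mathfrak t}$ for all large $N$. Then there are $\varpi',\mathfrak t'>0$, $C$, $N_0$ such that for every $N\ge N_0$, with probability at least $1-N^{-\mathfrak t'}$, $\mathcal P(\widehat\nu_N;\varpi',C)$ holds simultaneously for all $s\in[c_4,C_4]$. * (Deterministic version.) There are $\varpi'>0$, $C$, $N_0$ such that $\mathcal P(\nu;\varpi',C)$ holds for all $N\ge N_0$ and $s\in[c_4,C_4]$. Here $\mu'=\breve\nu^\lambda$, $\rho=\breve\rho_{\mathrm{fc}}=\rho_{\mathrm{sc}}\boxplus\breve\nu^\lambda$, $L_\pm=\breve L_\pm$. -/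

import Mathlib

open MeasureTheory ProbabilityTheory Filter Set Topology
open scoped ENNReal

noncomputable section

namespace RefinedSC

/-- The Stieltjes transform `m_μ(z) = ∫ dμ(v) / (v - z)` of a measure on the line. -/
abbrev stieltjes (μ : Measure ℝ) (z : ℂ) : ℂ := resolventTransform μ z

/-- The open upper half-plane `ℂ⁺`. -/
abbrev upper : Set ℂ := {z : ℂ | 0 < z.im}

/-- The standard semicircle law, with density `√(4 - x²) / (2π)` on `[-2, 2]`
(`Real.sqrt` vanishes at negative arguments). -/
def semicircle : Measure ℝ :=
  volume.withDensity fun x => ENNReal.ofReal (Real.sqrt (4 - x ^ 2) / (2 * Real.pi))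

/-- `ρ` is the free additive convolution `μ₁ ⊞ μ₂`: the probability measure whose Stieltjes
transform solves, with analytic subordination functions `ω₁, ω₂ : ℂ⁺ → ℂ⁺` such that
`ωᵢ(iy) / (iy) → 1` as `y → ∞`, the system
`m_ρ(z) = m_{μ₁}(ω₁(z)) = m_{μ₂}(ω₂(z))`, `ω₁(z) + ω₂(z) = z - 1 / m_ρ(z)`. -/
structure IsFreeAdditiveConvolution (μ₁ μ₂ ρ : Measure ℝ) : Prop where
  isProbabilityMeasure : IsProbabilityMeasure ρ
  subordination : ∃ ω₁ ω₂ : ℂ → ℂ,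
    DifferentiableOn ℂ ω₁ upper ∧ DifferentiableOn ℂ ω₂ upper ∧
    MapsTo ω₁ upper upper ∧ MapsTo ω₂ upper upper ∧
    Tendsto (fun y : ℝ => ω₁ (Complex.I * y) / (Complex.I * y)) atTop (𝓝 1) ∧
    Tendsto (fun y : ℝ => ω₂ (Complex.I * y) / (Complex.I * y)) atTop (𝓝 1) ∧
    ∀ z ∈ upper, stieltjes ρ z = stieltjes μ₁ (ω₁ z) ∧ stieltjes ρ z = stieltjes μ₂ (ω₂ z) ∧
      ω₁ z + ω₂ z = z - 1 / stieltjes ρ z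

/-- The smallest interval `I_μ` containing the support of `μ`. -/
def hull (μ : Measure ℝ) : Set ℝ := convexHull ℝ μ.support

/-- `inf_{x ∈ I_μ} ∫ dμ(v) / (v - x)²` as an extended nonnegative number; the integrand is `∞`
at `v = x`. -/
def invSqInf (μ : Measure ℝ) : ℝ≥0∞ :=
  ⨅ x ∈ hull μ, ∫⁻ v, (ENNReal.ofReal ((v - x) ^ 2))⁻¹ ∂μ

/-- The empirical spectral distribution of `diag(v₁, …, v_N)`. -/
def empirical {N : ℕ} (v : Fin N → ℝ) : Measure ℝ :=
  (N : ℝ≥0∞)⁻¹ • ∑ i, Measure.dirac (v i)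

/-- The refined measure of a base measure `μ`: the equal-weight mixture of the law of `l v`
(with `v` distributed as `μ`) shifted by `√s / q` and by `-√s / q`. -/
def refined (μ : Measure ℝ) (l s q : ℝ) : Measure ℝ :=
  (2 : ℝ≥0∞)⁻¹ • (μ.map (fun v => l * v - Real.sqrt s / q)
    + μ.map (fun v => l * v + Real.sqrt s / q))

/-- The assertions about the refined measure `ν' = refined μ l s q` itself: it is the classical
convolution of the scaled base measure with a symmetric two-point law, it lives on a compact
interval, it satisfies the stability condition with constant `ϖ`, and its first four moments
are explicit (first in general, then for a centered base measure). -/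
structure RefinedMeasureProperties (μ : Measure ℝ) (l s q ϖ : ℝ) : Prop where
  isProbabilityMeasure : IsProbabilityMeasure (refined μ l s q)
  eq_conv : refined μ l s q =
    (μ.map (fun v => l * v)).conv ((2 : ℝ≥0∞)⁻¹ •
      (Measure.dirac (Real.sqrt s / q) + Measure.dirac (-(Real.sqrt s / q))))
  isCompact_hull : IsCompact (hull (refined μ l s q))
  null_compl_hull : refined μ l s q (hull (refined μ l s q))ᶜ = 0
  stable : ENNReal.ofReal (1 + ϖ) ≤ invSqInf (refined μ l s q)
  moment_one : moment id 1 (refined μ l s q) = l * moment id 1 μ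
  moment_two : moment id 2 (refined μ l s q) = l ^ 2 * moment id 2 μ + s / q ^ 2
  moment_three : moment id 3 (refined μ l s q) =
    l ^ 3 * moment id 3 μ + 3 * s * l / q ^ 2 * moment id 1 μ
  moment_four : moment id 4 (refined μ l s q) =
    l ^ 4 * moment id 4 μ + 6 * s * l ^ 2 / q ^ 2 * moment id 2 μ + s ^ 2 / q ^ 4
  moment_one_of_centered : moment id 1 μ = 0 → moment id 1 (refined μ l s q) = 0
  moment_three_of_centered : moment id 1 μ = 0 →
    moment id 3 (refined μ l s q) = l ^ 3 * moment id 3 μ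

/-- The assertions about `ρ`, the refined deformed semicircle law, with edges `Lm < Lp`:
it is the (unique) free additive convolution of the semicircle law and `refined μ l s q`, its
Stieltjes transform maps `ℂ⁺` to `ℂ⁺` and solves the functional equation, its support is
`[Lm, Lp]`, and it is absolutely continuous with the density given by Stieltjes inversion at
every point, strictly positive on `(Lm, Lp)`. -/
structure RefinedLawProperties (μ : Measure ℝ) (l s q : ℝ) (ρ : Measure ℝ) (Lm Lp : ℝ) :
    Prop where
  isFreeConv : IsFreeAdditiveConvolution semicircle (refined μ l s q) ρ
  unique : ∀ ρ' : Measure ℝ,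
    IsFreeAdditiveConvolution semicircle (refined μ l s q) ρ' → ρ' = ρ
  mapsTo : MapsTo (stieltjes ρ) upper upper
  functional_equation : ∀ z ∈ upper, stieltjes ρ z =
    ∫ v : ℝ, ((l : ℂ) * v - z - stieltjes ρ z
      - (s : ℂ) / (q : ℂ) ^ 2 * (1 / ((l : ℂ) * v - z - stieltjes ρ z)))⁻¹ ∂μ
  lt : Lm < Lp
  support_eq : ρ.support = Icc Lm Lp
  density : ∃ f : ℝ → ℝ,
    (∀ E : ℝ, Tendsto (fun η : ℝ => (stieltjes ρ ((E : ℂ) + Complex.I * η)).im / Real.pi)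
      (𝓝[>] 0) (𝓝 (f E))) ∧
    ρ = volume.withDensity (fun E => ENNReal.ofReal (f E)) ∧
    ∀ E ∈ Ioo Lm Lp, 0 < f E

/-- The error term `C (l⁵ + q⁻⁶ + l³ q⁻² |t|)` of the edge expansion, where `t` is the third
moment of the base measure. -/
def edgeError (l q C t : ℝ) : ℝ := C * (l ^ 5 + 1 / q ^ 6 + l ^ 3 / q ^ 2 * |t|)

/-- Expansions of the edges in the moments of `refined μ l s q`: for a centered base measure in
the raw moments, and without centering in the mean and the central moments. -/
structure EdgeExpansion (μ : Measure ℝ) (l s q C Lm Lp : ℝ) : Prop where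
  upper_of_centered : moment id 1 μ = 0 →
    |Lp - (2 + moment id 1 (refined μ l s q) + moment id 2 (refined μ l s q)
      + moment id 3 (refined μ l s q)
      + (moment id 4 (refined μ l s q) - 9 * moment id 2 (refined μ l s q) ^ 2 / 4))|
      ≤ edgeError l q C (moment id 3 μ)
  lower_of_centered : moment id 1 μ = 0 →
    |Lm - (-2 + moment id 1 (refined μ l s q) - moment id 2 (refined μ l s q)
      + moment id 3 (refined μ l s q)
      - (moment id 4 (refined μ l s q) - 9 * moment id 2 (refined μ l s q) ^ 2 / 4))|
      ≤ edgeError l q C (moment id 3 μ)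
  upper :
    |Lp - (2 + moment id 1 (refined μ l s q) + centralMoment id 2 (refined μ l s q)
      + centralMoment id 3 (refined μ l s q)
      + (centralMoment id 4 (refined μ l s q)
        - 9 * centralMoment id 2 (refined μ l s q) ^ 2 / 4))|
      ≤ edgeError l q C (centralMoment id 3 μ)
  lower :
    |Lm - (-2 + moment id 1 (refined μ l s q) - centralMoment id 2 (refined μ l s q)
      + centralMoment id 3 (refined μ l s q)
      - (centralMoment id 4 (refined μ l s q)
        - 9 * centralMoment id 2 (refined μ l s q) ^ 2 / 4))|
      ≤ edgeError l q C (centralMoment id 3 μ)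

/-- All the assertions for one base measure `μ` (either the empirical spectral distribution or
its deterministic limit) and one size. The edge expansion, with constant `C`, is asserted only
in the regime `small`, that is, `λ ≪ 1`. -/
def RefinedConclusion (μ : Measure ℝ) (l s q ϖ C : ℝ) (small : Prop) : Prop :=
  RefinedMeasureProperties μ l s q ϖ ∧
  ∃ (ρ : Measure ℝ) (Lm Lp : ℝ), RefinedLawProperties μ l s q ρ Lm Lp ∧
    (small → EdgeExpansion μ l s q C Lm Lp)

/-- The test domains `D` of the closeness condition: compact subsets of the closed upper
half-plane that do not meet the support of `ν`. -/
def IsTestDomain (ν : Measure ℝ) (D : Set ℂ) : Prop :=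
  IsCompact D ∧ (∀ z ∈ D, 0 ≤ z.im) ∧ ∀ x ∈ ν.support, (x : ℂ) ∉ D

/-- The typical event `Ξ_N(𝔞)` as a set of configurations `(V₁, …, V_N)` with entries in
`[-K, K]`: the empirical spectral distribution satisfies the stability condition, and on every
test domain `D` its Stieltjes transform is within `B(D) N^{-𝔞}` of that of `ν` once
`N ≥ n₀(D)`. -/
def typicalEvent (ν : Measure ℝ) (l ϖ a K : ℝ) (B : Set ℂ → ℝ) (n₀ : Set ℂ → ℕ) (N : ℕ) :
    Set (Fin N → ℝ) :=
  {v | (∀ i, |v i| ≤ K) ∧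
    ENNReal.ofReal ((1 + ϖ) * l ^ 2) ≤ invSqInf (empirical v) ∧
    ∀ D, IsTestDomain ν D → n₀ D ≤ N →
      ∀ z ∈ D, ‖stieltjes (empirical v) z - stieltjes ν z‖ ≤ B D * (N : ℝ) ^ (-a)}

/-- A deterministic potential: uniformly bounded entries, and for some `𝔞₀ > 0` the Stieltjes
transform of the empirical spectral distribution is `O(N^{-𝔞₀})`-close to that of `ν` on each
test domain. -/
def IsDeterministicPotential (ν : Measure ℝ) (V : (N : ℕ) → Fin N → ℝ) : Prop :=
  (∃ K : ℝ, ∀ N i, |V N i| ≤ K) ∧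
  ∃ a : ℝ, 0 < a ∧ ∀ D, IsTestDomain ν D → ∃ B : ℝ, ∀ᶠ N : ℕ in atTop,
    ∀ z ∈ D, ‖stieltjes (empirical (V N)) z - stieltjes ν z‖ ≤ B * (N : ℝ) ^ (-a)

end RefinedSC

end

/-! Write `μ` for the refined measure and `m` for its Stieltjes transform. Since the semicircle law
has R-transform equal to the identity, the subordination function of `ρ_sc ⊞ μ` should invert `w ↦ w
- m(w)`. The imaginary part of this map is `Im w (1 - ∫ |v - w|⁻² dμ)`, so the natural domain of
inversion is `dom μ`, the part of the closed upper half-plane where that integral is at most `1`.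
Stability keeps `dom μ` off the hull of the support. On `dom μ` the map is injective (`invSub_inj`,
the equality case of Cauchy–Schwarz) and moves points by at most `1`, so its image is closed;
connectedness of `ℂ⁺` makes the image contain the closed half-plane (`Stable.upper_subset_image`,
`Stable.mem_image`). The inverse `omega` is continuous up to the real line and holomorphic inside.

The law is then built from its density `Im omega / π`. Cauchy's theorem identifies its Stieltjes
transform as `omega z - z` (`Stable.stieltjes_law`), which gives the mass, the subordination system
and the functional equation. Uniqueness follows from the quadratic equation of the semicircle
transform, itself obtained by running the same construction on a point mass.

A real point of `dom μ` lies to the right or to the left of the support. On the right, `edgeFun` has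
its minimum where `∫ (x - v)⁻² dμ` crosses `1`, and this minimum is the upper edge; reflection gives
the lower one. The density vanishes exactly outside the two edges (`Stable.density_eq_zero_iff`).
For small `λ` the minimum is expanded around `mean + 1`; completing a square there produces the
coefficient `-9/4` (`inv_power_expansion`, `IsRightEdge.expansion`).

It remains to see that the refined measure is stable. If `λ → 0` its support shrinks and this is
automatic. Otherwise `λ` is a positive constant, and stability of `ν` survives regularization at a
small height `η` on a neighborhood of the hull (`exists_regularized`), hence also passage to any
measure with nearby support and nearby Stieltjes transform at height `η`. So
`exists_uniform_conclusion` covers all four cases once closeness is checked: from two test domains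
on the typical event and for deterministic potentials, from Chebyshev's inequality for independent
samples, and trivially for `ν` itself. -/

noncomputable section

namespace RefinedSC

/-! ### Resolvent integrals off the support, and injectivity of `w ↦ w - m(w)` -/

/-- The complement in `ℂ` of the support of a measure on the line. -/
abbrev offSupport (μ : Measure ℝ) : Set ℂ := (algebraMap ℝ ℂ '' μ.support)ᶜ

/-- The integral `∫ ‖v - w‖⁻² dμ(v)`. -/
def invSq (μ : Measure ℝ) (w : ℂ) : ℝ := ∫ v, (‖(v : ℂ) - w‖ ^ 2)⁻¹ ∂μ

/-- The map `w ↦ w - m_μ(w)`, inverse to the subordination function. -/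
def invSub (μ : Measure ℝ) (w : ℂ) : ℂ := w - stieltjes μ w

lemma resolvent_eq (w : ℂ) (v : ℝ) : resolvent w v = ((v : ℂ) - w)⁻¹ := by
  simp [resolvent, Ring.inverse_eq_inv']

lemma stieltjes_eq (μ : Measure ℝ) (w : ℂ) : stieltjes μ w = ∫ v, ((v : ℂ) - w)⁻¹ ∂μ := by
  simp only [stieltjes, resolventTransform_apply, resolvent_eq]

lemma mem_offSupport_of_im_ne {μ : Measure ℝ} {w : ℂ} (h : w.im ≠ 0) : w ∈ offSupport μ := by
  rintro ⟨v, -, rfl⟩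
  simp at h

lemma isOpen_offSupport (μ : Measure ℝ) : IsOpen (offSupport μ) := by
  refine isOpen_compl_iff.mpr ?_
  refine (Topology.IsClosedEmbedding.isClosed_iff_image_isClosed ?_).mp Measure.isClosed_support
  exact (algebraMap_isometry ℝ ℂ).isClosedEmbedding

lemma exists_gap {μ : Measure ℝ} {w : ℂ} (hw : w ∈ offSupport μ) :
    ∃ c > 0, ∀ v ∈ μ.support, c ≤ ‖(v : ℂ) - w‖ := by
  obtain ⟨c, hc, hb⟩ := Metric.isOpen_iff.mp (isOpen_offSupport μ) w hw
  refine ⟨c, hc, fun v hv => ?_⟩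
  by_contra! h
  exact hb (show (v : ℂ) ∈ Metric.ball w c by simpa [dist_eq_norm] using h) ⟨v, hv, by simp⟩

lemma sub_ne_zero_of_mem {μ : Measure ℝ} {w : ℂ} (hw : w ∈ offSupport μ) {v : ℝ}
    (hv : v ∈ μ.support) : (v : ℂ) - w ≠ 0 := by
  intro h
  exact hw ⟨v, hv, by simpa [sub_eq_zero] using h⟩

lemma bounded_inv {μ : Measure ℝ} {w : ℂ} (hw : w ∈ offSupport μ) : ∃ C, ∀ᵐ v : ℝ ∂μ, ‖((v : ℂ) - w)⁻¹‖ ≤ C := by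
  obtain ⟨c, hc, h⟩ := exists_gap hw
  refine ⟨c⁻¹, ?_⟩
  filter_upwards [Measure.support_mem_ae] with v hv
  rw [norm_inv]
  exact inv_anti₀ hc (h v hv)

section Kernel

variable {μ : Measure ℝ} [IsFiniteMeasure μ] {w w' : ℂ}

lemma integrable_inv (hw : w ∈ offSupport μ) : Integrable (fun v : ℝ => ((v : ℂ) - w)⁻¹) μ := by
  have h := integrable_resolvent (μ := μ) (a := w) hw
  refine h.congr (Eventually.of_forall fun v => ?_)
  simp [resolvent_eq]

lemma integrable_mul_inv (hw : w ∈ offSupport μ) (hw' : w' ∈ offSupport μ) :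
    Integrable (fun v : ℝ => ((v : ℂ) - w)⁻¹ * ((v : ℂ) - w')⁻¹) μ := by
  obtain ⟨C, hC⟩ := bounded_inv hw
  exact (integrable_inv hw').bdd_mul (integrable_inv hw).aestronglyMeasurable hC

lemma integrable_invSq (hw : w ∈ offSupport μ) :
    Integrable (fun v : ℝ => (‖(v : ℂ) - w‖ ^ 2)⁻¹) μ := by
  refine (integrable_mul_inv hw hw).norm.congr (Eventually.of_forall fun v => ?_)
  simp [pow_two]

lemma invSq_nonneg (μ : Measure ℝ) (w : ℂ) : 0 ≤ invSq μ w :=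
  integral_nonneg fun v => by positivity

lemma stieltjes_sub (hw : w ∈ offSupport μ) (hw' : w' ∈ offSupport μ) :
    stieltjes μ w - stieltjes μ w' =
      (w - w') * ∫ v, ((v : ℂ) - w)⁻¹ * ((v : ℂ) - w')⁻¹ ∂μ := by
  rw [stieltjes_eq, stieltjes_eq, ← integral_sub (integrable_inv hw) (integrable_inv hw'),
    ← integral_const_mul]
  refine integral_congr_ae ?_
  filter_upwards [Measure.support_mem_ae] with v hv
  have h1 := sub_ne_zero_of_mem hw hv
  have h2 := sub_ne_zero_of_mem hw' hv
  field_simp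
  ring

/-- Pointwise AM–GM. Taken at `w' = w`, it shows that the derivative of `invSub μ` cannot vanish
where `invSq μ w < 1`. -/
lemma norm_integral_mul_inv_le (hw : w ∈ offSupport μ) (hw' : w' ∈ offSupport μ) :
    ‖∫ v, ((v : ℂ) - w)⁻¹ * ((v : ℂ) - w')⁻¹ ∂μ‖ ≤ (invSq μ w + invSq μ w') / 2 := by
  refine (norm_integral_le_integral_norm _).trans ?_
  rw [invSq, invSq, ← integral_add (integrable_invSq hw) (integrable_invSq hw'),
    ← integral_div]
  refine integral_mono (integrable_mul_inv hw hw').norm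
    (((integrable_invSq hw).add (integrable_invSq hw')).div_const 2) fun v => ?_
  simp only [norm_mul, norm_inv, ← inv_pow]
  nlinarith [sq_nonneg (‖(v : ℂ) - w‖⁻¹ - ‖(v : ℂ) - w'‖⁻¹)]

lemma stieltjes_im (hw : w ∈ offSupport μ) : (stieltjes μ w).im = w.im * invSq μ w := by
  rw [stieltjes_eq, invSq, ← integral_const_mul]
  have := integral_im (integrable_inv hw)
  simp only [RCLike.im_to_complex] at this
  rw [← this]
  refine integral_congr_ae (Eventually.of_forall fun v => ?_)
  simp [Complex.inv_im, Complex.normSq_eq_norm_sq, div_eq_mul_inv]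

lemma hasDerivAt_stieltjes (hw : w ∈ offSupport μ) :
    HasDerivAt (stieltjes μ) (∫ v, ((v : ℂ) - w)⁻¹ * ((v : ℂ) - w)⁻¹ ∂μ) w := by
  have := hasDerivAt_resolventTransform (μ := μ) w hw
  simpa only [resolvent_eq, pow_two] using this

lemma hasDerivAt_invSub (hw : w ∈ offSupport μ) :
    HasDerivAt (invSub μ) (1 - ∫ v, ((v : ℂ) - w)⁻¹ * ((v : ℂ) - w)⁻¹ ∂μ) w :=
  (hasDerivAt_id w).sub (hasDerivAt_stieltjes hw)

lemma differentiableOn_stieltjes : DifferentiableOn ℂ (stieltjes μ) (offSupport μ) :=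
  fun _ hw => (hasDerivAt_stieltjes hw).differentiableAt.differentiableWithinAt

lemma continuousOn_stieltjes : ContinuousOn (stieltjes μ) (offSupport μ) :=
  differentiableOn_stieltjes.continuousOn

lemma invSub_sub (hw : w ∈ offSupport μ) (hw' : w' ∈ offSupport μ) :
    invSub μ w - invSub μ w' =
      (w - w') * (1 - ∫ v, ((v : ℂ) - w)⁻¹ * ((v : ℂ) - w')⁻¹ ∂μ) := by
  have := stieltjes_sub hw hw'
  simp only [invSub]
  linear_combination -this

/-- This factorization dictates the domain of inversion: a point of `ℂ⁺` is sent into `ℂ⁺` exactly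
when `invSq μ w < 1`. -/
lemma invSub_im (hw : w ∈ offSupport μ) : (invSub μ w).im = w.im * (1 - invSq μ w) := by
  rw [invSub, Complex.sub_im, stieltjes_im hw]
  ring

/-- Expand `|x - ȳ|² = |x|² + |y|² - 2 Re (xy)`. The identity measures the defect in the AM–GM bound
and so handles its equality case. -/
lemma integral_normSq_sub_conj (hw : w ∈ offSupport μ) (hw' : w' ∈ offSupport μ) :
    ∫ v : ℝ, ‖((v : ℂ) - w)⁻¹ - (starRingEnd ℂ) ((v : ℂ) - w')⁻¹‖ ^ 2 ∂μ =
      invSq μ w + invSq μ w' - 2 * (∫ v, ((v : ℂ) - w)⁻¹ * ((v : ℂ) - w')⁻¹ ∂μ).re := by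
  have := integral_re (integrable_mul_inv hw hw')
  simp only [RCLike.re_to_complex] at this
  rw [← this, invSq, invSq, ← integral_add (integrable_invSq hw) (integrable_invSq hw'),
    ← integral_const_mul, ← integral_sub]
  · refine integral_congr_ae (Eventually.of_forall fun v => ?_)
    simp only [← inv_pow, ← norm_inv]
    generalize ((v : ℂ) - w)⁻¹ = x
    generalize ((v : ℂ) - w')⁻¹ = y
    simp only [← Complex.normSq_eq_norm_sq, Complex.normSq_apply, Complex.sub_re, Complex.sub_im,
      Complex.conj_re, Complex.conj_im, Complex.mul_re]
    ring
  · exact (integrable_invSq hw).add (integrable_invSq hw')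
  · exact (integrable_mul_inv hw hw').re.const_mul 2

end Kernel

section Probability

variable {μ : Measure ℝ} [IsProbabilityMeasure μ] {w w' : ℂ}

/-- From `|x| ≤ (1 + |x|²) / 2`. The bound is `1` on `dom μ` and strict where `invSq μ w < 1`, which
is where the semicircle transform takes its values. -/
lemma norm_stieltjes_le (hw : w ∈ offSupport μ) : ‖stieltjes μ w‖ ≤ (1 + invSq μ w) / 2 := by
  rw [stieltjes_eq]
  refine (norm_integral_le_integral_norm _).trans ?_
  have : (1 + invSq μ w) / 2 = ∫ v, (1 + (‖(v : ℂ) - w‖ ^ 2)⁻¹) / 2 ∂μ := by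
    rw [integral_div, integral_add (integrable_const _) (integrable_invSq hw), invSq]
    simp
  rw [this]
  refine integral_mono (integrable_inv hw).norm
    (((integrable_const _).add (integrable_invSq hw)).div_const 2) fun v => ?_
  simp only [norm_inv, ← inv_pow]
  nlinarith [sq_nonneg (‖(v : ℂ) - w‖⁻¹ - 1)]

lemma support_nonempty (μ : Measure ℝ) [IsProbabilityMeasure μ] : μ.support.Nonempty :=
  Measure.nonempty_support (IsProbabilityMeasure.ne_zero μ)

lemma invSq_pos (hw : w ∈ offSupport μ) : 0 < invSq μ w := by
  rw [invSq, integral_pos_iff_support_of_nonneg (fun v => by positivity) (integrable_invSq hw)]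
  have : μ.support ⊆ Function.support fun v : ℝ => (‖(v : ℂ) - w‖ ^ 2)⁻¹ := by
    intro v hv
    have := sub_ne_zero_of_mem hw hv
    simp [this]
  refine lt_of_lt_of_le ?_ (measure_mono this)
  rw [(prob_compl_eq_zero_iff Measure.isClosed_support.measurableSet).mp
    Measure.measure_compl_support]
  exact one_pos

/-- The map `w ↦ w - m_μ(w)` is injective on the part of the closed upper half-plane where
`∫ ‖v - w‖⁻² dμ(v) ≤ 1`. -/
lemma invSub_inj (hw : w ∈ offSupport μ) (hw' : w' ∈ offSupport μ) (h0 : 0 ≤ w.im)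
    (h0' : 0 ≤ w'.im) (h1 : invSq μ w ≤ 1) (h1' : invSq μ w' ≤ 1)
    (h : invSub μ w = invSub μ w') : w = w' := by
  by_contra hne
  have h2 := invSub_sub hw hw'
  -- Equal images at distinct points force the mixed integral to be `1`, so the defect `invSq μ w +
  -- invSq μ w' - 2` is at most `0`.
  rw [h, sub_self, eq_comm, mul_eq_zero, or_iff_right (sub_ne_zero.mpr hne), sub_eq_zero] at h2
  have h3 := integral_normSq_sub_conj hw hw'
  rw [← h2, Complex.one_re] at h3
  have hint : Integrable (fun v : ℝ =>
      ‖((v : ℂ) - w)⁻¹ - (starRingEnd ℂ) ((v : ℂ) - w')⁻¹‖ ^ 2) μ := by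
    refine (((integrable_invSq hw).add (integrable_invSq hw')).const_mul 2).mono ?_
      (Eventually.of_forall fun v => ?_)
    · refine AEStronglyMeasurable.pow (AEStronglyMeasurable.norm ?_) 2
      exact (integrable_inv hw).aestronglyMeasurable.sub
        (Complex.continuous_conj.comp_aestronglyMeasurable
          (integrable_inv hw').aestronglyMeasurable)
    · have h4 := norm_sub_le ((v : ℂ) - w)⁻¹ ((starRingEnd ℂ) ((v : ℂ) - w')⁻¹)
      rw [Complex.norm_conj, norm_inv, norm_inv] at h4
      simp only [Pi.add_apply, Real.norm_eq_abs, abs_pow, abs_norm]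
      rw [← inv_pow, ← inv_pow, abs_of_nonneg (by positivity)]
      refine (pow_le_pow_left₀ (norm_nonneg _) h4 2).trans ?_
      nlinarith [sq_nonneg (‖(v : ℂ) - w‖⁻¹ - ‖(v : ℂ) - w'‖⁻¹)]
  have h5 : ∫ v : ℝ, ‖((v : ℂ) - w)⁻¹ - (starRingEnd ℂ) ((v : ℂ) - w')⁻¹‖ ^ 2 ∂μ = 0 :=
    le_antisymm (by rw [h3]; linarith) (integral_nonneg fun v => by positivity)
  rw [integral_eq_zero_iff_of_nonneg (fun v => by positivity) hint] at h5
  have h6 : ∃ v : ℝ, ((v : ℂ) - w)⁻¹ = (starRingEnd ℂ) ((v : ℂ) - w')⁻¹ := by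
    obtain ⟨v, hv⟩ := h5.exists
    exact ⟨v, by simpa [sub_eq_zero] using hv⟩
  obtain ⟨v, hv⟩ := h6
  rw [map_inv₀, inv_inj, map_sub, Complex.conj_ofReal, sub_right_inj] at hv
  have him := congrArg Complex.im hv
  have hre := congrArg Complex.re hv
  simp only [Complex.conj_im, Complex.conj_re] at him hre
  -- The points are conjugate to each other and neither is below the real axis, so both are real and
  -- equal.
  exact hne (Complex.ext hre (by linarith))

end Probability

/-! ### Stable measures and the subordination function -/

/-- A compactly supported measure for which `∫ (v - x)⁻² dμ(v) > 1` on the hull of the support. -/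
structure Stable (μ : Measure ℝ) : Prop where
  isCompact_support : IsCompact μ.support
  one_lt : ∀ x ∈ hull μ, 1 < ∫⁻ v, (ENNReal.ofReal ((v - x) ^ 2))⁻¹ ∂μ

/-- The part of the closed upper half-plane where `∫ ‖v - w‖⁻² dμ(v) ≤ 1`. -/
def dom (μ : Measure ℝ) : Set ℂ :=
  {w | 0 ≤ w.im ∧ ∫⁻ v, (ENNReal.ofReal (‖(v : ℂ) - w‖ ^ 2))⁻¹ ∂μ ≤ 1}

/-- The subordination function, inverse to `invSub μ` on `dom μ`. -/
def omega (μ : Measure ℝ) : ℂ → ℂ := Function.invFunOn (invSub μ) (dom μ)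

/-- Fatou's lemma. The extended-valued integral lets the limit point be arbitrary, even on the
support; a Bochner integral would return a spurious `0` when it diverges. -/
lemma isClosed_dom (μ : Measure ℝ) : IsClosed (dom μ) := by
  refine IsSeqClosed.isClosed fun u w hu hw => ⟨?_, ?_⟩
  · exact ge_of_tendsto' ((Complex.continuous_im.tendsto w).comp hw) fun n => (hu n).1
  · have h : ∀ v : ℝ, liminf (fun n => (ENNReal.ofReal (‖(v : ℂ) - u n‖ ^ 2))⁻¹) atTop =
        (ENNReal.ofReal (‖(v : ℂ) - w‖ ^ 2))⁻¹ := by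
      intro v
      refine Tendsto.liminf_eq ?_
      have hc : Continuous fun x : ℂ => (ENNReal.ofReal (‖(v : ℂ) - x‖ ^ 2))⁻¹ :=
        continuous_inv.comp (ENNReal.continuous_ofReal.comp (by fun_prop))
      exact (hc.tendsto w).comp hw
    simp only [← h]
    refine (lintegral_liminf_le fun n => ?_).trans ?_
    · fun_prop
    · refine (liminf_le_liminf (v := fun _ => (1 : ℝ≥0∞))
        (Eventually.of_forall fun n => (hu n).2)).trans ?_
      simp

lemma lintegral_eq_invSq {μ : Measure ℝ} [IsFiniteMeasure μ] {w : ℂ} (hw : w ∈ offSupport μ) :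
    ∫⁻ v, (ENNReal.ofReal (‖(v : ℂ) - w‖ ^ 2))⁻¹ ∂μ = ENNReal.ofReal (invSq μ w) := by
  rw [invSq, ofReal_integral_eq_lintegral_ofReal (integrable_invSq hw)
    (Eventually.of_forall fun v => by positivity)]
  refine lintegral_congr_ae ?_
  filter_upwards [Measure.support_mem_ae] with v hv
  have := sub_ne_zero_of_mem hw hv
  rw [ENNReal.ofReal_inv_of_pos (by positivity)]

lemma norm_sq_ofReal_sub (v x : ℝ) : ‖(v : ℂ) - (x : ℂ)‖ ^ 2 = (v - x) ^ 2 := by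
  rw [← Complex.ofReal_sub, Complex.norm_real, Real.norm_eq_abs, sq_abs]

lemma support_subset_hull (μ : Measure ℝ) : μ.support ⊆ hull μ := subset_convexHull ℝ _

section Stable

variable {μ : Measure ℝ} (hs : Stable μ)
include hs

lemma Stable.notMem_dom {x : ℝ} (hx : x ∈ hull μ) : (x : ℂ) ∉ dom μ := by
  rintro ⟨-, h⟩
  have := hs.one_lt x hx
  simp only [norm_sq_ofReal_sub] at h
  exact absurd h (not_le.mpr this)

lemma Stable.mem_offSupport {w : ℂ} (hw : w ∈ dom μ) : w ∈ offSupport μ := by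
  rintro ⟨v, hv, rfl⟩
  exact hs.notMem_dom (support_subset_hull μ hv) hw

variable [IsProbabilityMeasure μ]

lemma Stable.mem_dom_iff {w : ℂ} :
    w ∈ dom μ ↔ 0 ≤ w.im ∧ w ∈ offSupport μ ∧ invSq μ w ≤ 1 := by
  constructor
  · intro hw
    have h := hs.mem_offSupport hw
    refine ⟨hw.1, h, ?_⟩
    have h2 := hw.2
    rwa [lintegral_eq_invSq h, ENNReal.ofReal_le_one] at h2
  · rintro ⟨h0, h, h1⟩
    refine ⟨h0, ?_⟩
    rwa [lintegral_eq_invSq h, ENNReal.ofReal_le_one]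

lemma Stable.norm_stieltjes_le_one {w : ℂ} (hw : w ∈ dom μ) : ‖stieltjes μ w‖ ≤ 1 := by
  obtain ⟨-, h, h1⟩ := hs.mem_dom_iff.mp hw
  linarith [norm_stieltjes_le h]

lemma Stable.continuousOn_invSub : ContinuousOn (invSub μ) (dom μ) :=
  continuousOn_id.sub (continuousOn_stieltjes.mono fun _ => hs.mem_offSupport)

lemma Stable.injOn_invSub : InjOn (invSub μ) (dom μ) := by
  intro w hw w' hw' h
  obtain ⟨h0, h, h1⟩ := hs.mem_dom_iff.mp hw
  obtain ⟨h0', h', h1'⟩ := hs.mem_dom_iff.mp hw'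
  exact invSub_inj h h' h0 h0' h1 h1' ‹_›

/-- A sequence in `dom μ` with convergent image has a subsequence converging in `dom μ`. -/
lemma Stable.exists_subseq {u : ℕ → ℂ} (hu : ∀ n, u n ∈ dom μ) {z : ℂ}
    (hz : Tendsto (fun n => invSub μ (u n)) atTop (𝓝 z)) :
    ∃ w ∈ dom μ, invSub μ w = z ∧ ∃ φ : ℕ → ℕ, StrictMono φ ∧
      Tendsto (u ∘ φ) atTop (𝓝 w) := by
  obtain ⟨R, hR⟩ := (Metric.isBounded_range_of_tendsto _ hz).exists_norm_le
  -- `invSub μ` displaces points of `dom μ` by at most `1`, so preimages of a bounded sequence are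
  -- bounded.
  have hb : ∀ n, u n ∈ Metric.closedBall (0 : ℂ) (R + 1) := by
    intro n
    have h1 := hR _ (mem_range_self n)
    have h2 := hs.norm_stieltjes_le_one (hu n)
    have h3 : u n = invSub μ (u n) + stieltjes μ (u n) := by simp [invSub]
    rw [mem_closedBall_zero_iff, h3]
    exact (norm_add_le _ _).trans (add_le_add h1 h2)
  obtain ⟨w, -, φ, hφ, hw⟩ := tendsto_subseq_of_bounded Metric.isBounded_closedBall hb
  have hwd : w ∈ dom μ := (isClosed_dom μ).mem_of_tendsto hw (Eventually.of_forall fun n => hu _)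
  refine ⟨w, hwd, ?_, φ, hφ, hw⟩
  have h1 : Tendsto (fun n => invSub μ (u (φ n))) atTop (𝓝 (invSub μ w)) :=
    (hs.continuousOn_invSub w hwd).tendsto.comp
      (tendsto_nhdsWithin_iff.mpr ⟨hw, Eventually.of_forall fun n => hu _⟩)
  exact tendsto_nhds_unique h1 (hz.comp hφ.tendsto_atTop)

lemma Stable.isClosed_image : IsClosed (invSub μ '' dom μ) := by
  refine IsSeqClosed.isClosed fun z z0 hz hz0 => ?_
  choose u hu huz using hz
  obtain ⟨w, hw, hwz, -⟩ := hs.exists_subseq hu (z := z0) (by simpa only [huz] using hz0)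
  exact ⟨w, hw, hwz⟩

/-- A connectedness argument. The image of the open set `O` is open because the derivative does not
vanish there; the image of `dom μ` is closed; and inside `ℂ⁺` the two images coincide, since a point
of `dom μ` with image in `ℂ⁺` has positive imaginary part. Being nonempty, this common trace is all
of `ℂ⁺`. -/
lemma Stable.upper_subset_image : upper ⊆ invSub μ '' dom μ := by
  set O : Set ℂ := upper ∩ invSub μ ⁻¹' upper with hO
  have hU : IsOpen upper := isOpen_lt continuous_const Complex.continuous_im
  have hoff : ∀ w ∈ upper, w ∈ offSupport μ := fun w hw => mem_offSupport_of_im_ne (ne_of_gt hw)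
  have hcont : ContinuousOn (invSub μ) upper :=
    continuousOn_id.sub (continuousOn_stieltjes.mono hoff)
  have hOo : IsOpen O := hcont.isOpen_inter_preimage hU hU
  have hlt : ∀ w ∈ O, invSq μ w < 1 := by
    rintro w ⟨hw, hw'⟩
    have h : 0 < (invSub μ w).im := hw'
    rw [invSub_im (hoff w hw)] at h
    have := (pos_iff_pos_of_mul_pos h).mp hw
    linarith
  have hOd : O ⊆ dom μ := fun w hw =>
    hs.mem_dom_iff.mpr ⟨le_of_lt hw.1, hoff w hw.1, (hlt w hw).le⟩
  have himg : IsOpen (invSub μ '' O) := by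
    rw [isOpen_iff_mem_nhds]
    rintro _ ⟨w, hw, rfl⟩
    have hd : DifferentiableOn ℂ (invSub μ) upper := fun x hx =>
      (hasDerivAt_invSub (hoff x hx)).differentiableAt.differentiableWithinAt
    have han : AnalyticAt ℂ (invSub μ) w := hd.analyticAt (hU.mem_nhds hw.1)
    have hder := (hasDerivAt_invSub (hoff w hw.1)).deriv
    have hst := han.hasStrictDerivAt
    rw [← hst.map_nhds_eq ?_]
    · exact image_mem_map (hOo.mem_nhds hw)
    · rw [hder, sub_ne_zero]
      intro h
      have h1 := norm_integral_mul_inv_le (hoff w hw.1) (hoff w hw.1)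
      rw [← h, norm_one] at h1
      linarith [hlt w hw]
  have hconv : IsPreconnected upper := (convex_halfSpace_im_gt 0).isPreconnected
  refine (hconv.subset_left_of_subset_union himg hs.isClosed_image.isOpen_compl
    (disjoint_compl_right_iff_subset.mpr (image_mono hOd)) ?_ ?_).trans (image_mono hOd)
  · intro z hz
    by_cases h : z ∈ invSub μ '' dom μ
    · obtain ⟨w, hw, rfl⟩ := h
      refine Or.inl ⟨w, ⟨?_, hz⟩, rfl⟩
      have h1 : 0 < (invSub μ w).im := hz
      rw [invSub_im (hs.mem_offSupport hw)] at h1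
      refine lt_of_le_of_ne hw.1 fun h0 => ?_
      rw [← h0, zero_mul] at h1
      exact lt_irrefl _ h1
    · exact Or.inr h
  -- Nonemptiness: `2i` is at distance at least `2` from the real line, so `invSq` is at most `1/4`
  -- there.
  · have hw : (2 * Complex.I) ∈ upper := by simp [upper]
    have hq : invSq μ (2 * Complex.I) < 1 := by
      have : invSq μ (2 * Complex.I) ≤ ∫ _, (1 / 4 : ℝ) ∂μ := by
        refine integral_mono (integrable_invSq (hoff _ hw)) (integrable_const _) fun v => ?_
        have h2 : (4 : ℝ) ≤ ‖(v : ℂ) - 2 * Complex.I‖ ^ 2 := by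
          rw [← Complex.normSq_eq_norm_sq, Complex.normSq_apply]
          simp
          nlinarith
        simpa using inv_anti₀ (by norm_num) h2
      rw [integral_const] at this
      simp at this
      linarith
    refine ⟨invSub μ (2 * Complex.I), ?_, ⟨_, ⟨hw, ?_⟩, rfl⟩⟩ <;>
    · show 0 < (invSub μ (2 * Complex.I)).im
      rw [invSub_im (hoff _ hw)]
      exact mul_pos hw (by linarith)

lemma Stable.mem_image {z : ℂ} (hz : 0 ≤ z.im) : z ∈ invSub μ '' dom μ := by
  have h := closure_minimal hs.upper_subset_image hs.isClosed_image
  refine h ?_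
  rw [upper, Complex.closure_setOfPred_lt_im]
  exact hz

lemma Stable.omega_mem {z : ℂ} (hz : 0 ≤ z.im) : omega μ z ∈ dom μ :=
  Function.invFunOn_mem (hs.mem_image hz)

lemma Stable.invSub_omega {z : ℂ} (hz : 0 ≤ z.im) : invSub μ (omega μ z) = z :=
  Function.invFunOn_eq (hs.mem_image hz)

lemma Stable.omega_eq {z w : ℂ} (hw : w ∈ dom μ) (h : invSub μ w = z) : omega μ z = w := by
  have h1 : z ∈ invSub μ '' dom μ := ⟨w, hw, h⟩
  exact hs.injOn_invSub (Function.invFunOn_mem h1) hw ((Function.invFunOn_eq h1).trans h.symm)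

lemma Stable.omega_sub {z : ℂ} (hz : 0 ≤ z.im) : omega μ z - z = stieltjes μ (omega μ z) := by
  have := hs.invSub_omega hz
  rw [invSub] at this
  linear_combination this

/-- Compactness plus uniqueness of the preimage. The inverse function theorem would not reach the
real line, where the derivative of `invSub μ` can vanish. -/
lemma Stable.continuousOn_omega : ContinuousOn (omega μ) {z | 0 ≤ z.im} := by
  intro z hz
  refine tendsto_of_subseq_tendsto fun ns hns => ?_
  rw [tendsto_nhdsWithin_iff] at hns
  obtain ⟨N, hN⟩ := eventually_atTop.mp hns.2
  have hmem : ∀ n, 0 ≤ (ns (n + N)).im := fun n => hN _ (by omega)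
  have ht := hns.1.comp (tendsto_add_atTop_nat N)
  obtain ⟨w, hw, hwz, φ, hφ, hlim⟩ := hs.exists_subseq (u := fun n => omega μ (ns (n + N)))
    (fun n => hs.omega_mem (hmem n)) (z := z) (by
      refine ht.congr fun n => ?_
      rw [hs.invSub_omega (hmem n)]
      rfl)
  refine ⟨fun n => φ n + N, ?_⟩
  rw [hs.omega_eq hw hwz]
  exact hlim

lemma Stable.invSq_omega_lt {z : ℂ} (hz : z ∈ upper) :
    0 < (omega μ z).im ∧ invSq μ (omega μ z) < 1 := by
  have h0 : (0 : ℝ) ≤ z.im := le_of_lt hz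
  have hw := hs.omega_mem h0
  have h1 : 0 < (invSub μ (omega μ z)).im := by rw [hs.invSub_omega h0]; exact hz
  rw [invSub_im (hs.mem_offSupport hw)] at h1
  have h2 : 0 < (omega μ z).im := by
    refine lt_of_le_of_ne hw.1 fun h0 => ?_
    rw [← h0, zero_mul] at h1
    exact lt_irrefl _ h1
  exact ⟨h2, by linarith [(pos_iff_pos_of_mul_pos h1).mp h2]⟩

lemma Stable.differentiableOn_omega : DifferentiableOn ℂ (omega μ) upper := by
  intro z hz
  have hU : IsOpen upper := isOpen_lt continuous_const Complex.continuous_im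
  have hN : upper ∈ 𝓝 z := hU.mem_nhds hz
  have h0 : (0 : ℝ) ≤ z.im := le_of_lt hz
  have hoff := hs.mem_offSupport (hs.omega_mem h0)
  have hc : ContinuousAt (omega μ) z :=
    hs.continuousOn_omega.continuousAt (mem_of_superset hN fun x hx => le_of_lt (show 0 < x.im from hx))
  refine (HasDerivAt.of_local_left_inverse hc (hasDerivAt_invSub hoff) ?_
    ?_).differentiableAt.differentiableWithinAt
  · rw [sub_ne_zero]
    intro h
    have h1 := norm_integral_mul_inv_le hoff hoff
    rw [← h, norm_one] at h1
    linarith [(hs.invSq_omega_lt hz).2]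
  · filter_upwards [hN] with x hx using hs.invSub_omega (le_of_lt hx)

/-- Uniqueness of the solution `w ∈ ℂ⁺` of `w - m_μ(w) = z ∈ ℂ⁺`. -/
lemma Stable.eq_omega {z w : ℂ} (hz : z ∈ upper) (hw : w ∈ upper) (h : invSub μ w = z) :
    w = omega μ z := by
  refine (hs.omega_eq (hs.mem_dom_iff.mpr ⟨le_of_lt hw, ?_, ?_⟩) h).symm
  · exact mem_offSupport_of_im_ne (ne_of_gt hw)
  · have h1 : 0 < (invSub μ w).im := by rw [h]; exact hz
    rw [invSub_im (mem_offSupport_of_im_ne (ne_of_gt hw))] at h1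
    linarith [(pos_iff_pos_of_mul_pos h1).mp hw]

end Stable

/-! ### Cauchy integrals over the real line -/

/-- A continuous function on the line that is `O(x⁻²)` at infinity is integrable. -/
lemma integrable_of_decay {g : ℝ → ℂ} (hg : Continuous g) {C R : ℝ}
    (hd : ∀ x : ℝ, R ≤ |x| → ‖g x‖ ≤ C / x ^ 2) : Integrable g := by
  have hb : ∃ M, ∀ x ∈ Icc (-(max R 1)) (max R 1), ‖g x‖ ≤ M :=
    isCompact_Icc.exists_bound_of_continuousOn hg.continuousOn
  obtain ⟨M, hM⟩ := hb
  -- One crude majorant for both regimes: the `|M|` term covers the compact part, and `1 + x² ≤ 2x²`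
  -- beyond `1` accounts for `2|C|`.
  have hi : Integrable (fun x : ℝ => (2 * |C| + |M| * (1 + (max R 1) ^ 2)) * (1 + x ^ 2)⁻¹) :=
    integrable_inv_one_add_sq.const_mul _
  refine hi.mono hg.aestronglyMeasurable (Eventually.of_forall fun x => ?_)
  refine le_trans ?_ (le_abs_self _)
  rw [← div_eq_mul_inv, le_div_iff₀ (by positivity)]
  have h1 : (1 : ℝ) ≤ max R 1 := le_max_right _ _
  by_cases hx : |x| ≤ max R 1
  · have h2 := (hM x (abs_le.mp hx)).trans (le_abs_self M)
    have h3 : x ^ 2 ≤ (max R 1) ^ 2 := sq_le_sq' (by linarith [neg_abs_le x]) ((le_abs_self x).trans hx)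
    have : ‖g x‖ * (1 + x ^ 2) ≤ |M| * (1 + (max R 1) ^ 2) := by gcongr
    linarith [abs_nonneg C]
  · push Not at hx
    have h2 := hd x ((le_max_left _ _).trans hx.le)
    have h3 : 1 ≤ x ^ 2 := by rw [← sq_abs]; nlinarith
    rw [le_div_iff₀ (by positivity)] at h2
    have h4 : ‖g x‖ ≤ |C| := by nlinarith [norm_nonneg (g x), le_abs_self C]
    have h5 : (0 : ℝ) ≤ |M| * (1 + (max R 1) ^ 2) := by positivity
    nlinarith [le_abs_self C]

/-- **Cauchy's theorem for the upper half-plane.** -/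
lemma integral_real_eq_zero {F : ℂ → ℂ} (hc : ContinuousOn F {z | 0 ≤ z.im})
    (hd : DifferentiableOn ℂ F upper) {C R : ℝ}
    (hF : ∀ z : ℂ, 0 ≤ z.im → R ≤ ‖z‖ → ‖F z‖ ≤ C / ‖z‖ ^ 2) :
    ∫ x : ℝ, F x = 0 := by
  have hcr : Continuous fun x : ℝ => F x :=
    hc.comp_continuous Complex.continuous_ofReal fun x => by simp
  have hint : Integrable fun x : ℝ => F x :=
    integrable_of_decay hcr (C := C) (R := R) fun x hx => by
      have := hF x (by simp) (by simpa using hx)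
      simpa using this
  have hlim := intervalIntegral_tendsto_integral hint tendsto_neg_atTop_atBot tendsto_id
  refine tendsto_nhds_unique hlim ?_
  -- On the rectangle `[-T, T] × [0, T]` the three sides off the real axis have total length `4T`,
  -- and there `‖F‖ ≤ |C| / T²`.
  refine squeeze_zero_norm' (a := fun T : ℝ => 4 * |C| * T⁻¹) ?_ ?_
  · filter_upwards [eventually_ge_atTop (max R 1)] with T hT
    have hT1 : 1 ≤ T := (le_max_right _ _).trans hT
    have hTR : R ≤ T := (le_max_left _ _).trans hT
    have hbound : ∀ z : ℂ, 0 ≤ z.im → T ≤ ‖z‖ → ‖F z‖ ≤ |C| / T ^ 2 := by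
      intro z hz hTz
      refine (hF z hz (hTR.trans hTz)).trans ?_
      gcongr
      exact le_abs_self C
    have hrect := Complex.integral_boundary_rect_eq_zero_of_continuousOn_of_differentiableOn F
      (-T : ℝ) (T + T * Complex.I) ?_ ?_
    · have htop : ‖∫ x : ℝ in (-T)..T, F (x + T * Complex.I)‖ ≤ |C| / T ^ 2 * |T - -T| := by
        refine intervalIntegral.norm_integral_le_of_norm_le_const fun x _ => hbound _ ?_ ?_
        · simp; linarith
        · refine le_trans ?_ (Complex.abs_im_le_norm _)
          simp [le_abs_self]
      have hright : ‖∫ y : ℝ in (0)..T, F (T + y * Complex.I)‖ ≤ |C| / T ^ 2 * |T - 0| := by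
        refine intervalIntegral.norm_integral_le_of_norm_le_const fun y hy => hbound _ ?_ ?_
        · rw [uIoc_of_le (by linarith)] at hy
          simpa using hy.1.le
        · refine le_trans ?_ (Complex.abs_re_le_norm _)
          simp [le_abs_self]
      have hleft : ‖∫ y : ℝ in (0)..T, F (-T + y * Complex.I)‖ ≤ |C| / T ^ 2 * |T - 0| := by
        refine intervalIntegral.norm_integral_le_of_norm_le_const fun y hy => hbound _ ?_ ?_
        · rw [uIoc_of_le (by linarith)] at hy
          simpa using hy.1.le
        · refine le_trans ?_ (Complex.abs_re_le_norm _)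
          simp [le_abs_self]
      simp at hrect
      have hval : (∫ x : ℝ in (-T)..T, F x) = (∫ x : ℝ in (-T)..T, F (x + T * Complex.I)) -
          Complex.I * (∫ y : ℝ in (0)..T, F (T + y * Complex.I)) +
          Complex.I * (∫ y : ℝ in (0)..T, F (-T + y * Complex.I)) := by
        linear_combination hrect
      rw [id, hval]
      refine (norm_add_le _ _).trans ?_
      refine (add_le_add (norm_sub_le _ _) le_rfl).trans ?_
      rw [norm_mul, norm_mul, Complex.norm_I, one_mul, one_mul]
      refine (add_le_add (add_le_add htop hright) hleft).trans (le_of_eq ?_)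
      rw [sub_zero, sub_neg_eq_add, abs_of_pos (by linarith : 0 < T),
        abs_of_pos (by linarith : 0 < T + T)]
      field_simp
      ring
    · refine hc.mono fun z hz => ?_
      have := hz.2
      simp [uIcc_of_le (by linarith : (0 : ℝ) ≤ T)] at this
      exact this.1
    · refine hd.mono fun z hz => ?_
      have := hz.2
      simp [min_eq_left (by linarith : (0 : ℝ) ≤ T)] at this
      exact this.1
  · simpa using tendsto_inv_atTop_zero.const_mul (4 * |C|)

lemma ofReal_sub_ne_zero {z : ℂ} (hz : z.im ≠ 0) (x : ℝ) : (x : ℂ) - z ≠ 0 := by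
  intro h
  have := congrArg Complex.im h
  simp at this
  exact hz this

lemma integral_inv_sub_sq_add_sq {y : ℝ} (hy : 0 < y) (a : ℝ) :
    ∫ x : ℝ, ((x - a) ^ 2 + y ^ 2)⁻¹ = Real.pi / y := by
  have h1 : ∀ x : ℝ, ((x - a) ^ 2 + y ^ 2)⁻¹ = (y ^ 2)⁻¹ * (1 + (y⁻¹ * (x - a)) ^ 2)⁻¹ := by
    intro x
    rw [← mul_inv]
    congr 1
    field_simp
    ring
  simp only [h1]
  rw [integral_const_mul, integral_sub_right_eq_self (fun x => (1 + (y⁻¹ * x) ^ 2)⁻¹) a,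
    Measure.integral_comp_mul_left (fun x => (1 + x ^ 2)⁻¹) y⁻¹, integral_univ_inv_one_add_sq]
  simp [abs_of_pos hy]
  field_simp

/-- A holomorphic function on `ℂ⁺`, continuous up to the real line and `O(1/z)` at infinity, is
the Cauchy integral of its boundary imaginary part. -/
lemma cauchy_im_eq {m : ℂ → ℂ} (hc : ContinuousOn m {z | 0 ≤ z.im})
    (hd : DifferentiableOn ℂ m upper) {C R : ℝ} (hC : 0 ≤ C)
    (hm : ∀ z : ℂ, 0 ≤ z.im → R ≤ ‖z‖ → ‖m z‖ ≤ C / ‖z‖) {z : ℂ} (hz : z ∈ upper) :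
    ∫ x : ℝ, ((m x).im : ℂ) * ((x : ℂ) - z)⁻¹ = Real.pi * m z := by
  have hzi : 0 < z.im := hz
  set zb : ℂ := (starRingEnd ℂ) z with hzb
  have hzbi : zb.im = -z.im := Complex.conj_im z
  have hnz : ∀ ζ : ℂ, 0 ≤ ζ.im → ζ - zb ≠ 0 := by
    intro ζ hζ h
    have := congrArg Complex.im h
    rw [Complex.sub_im, hzbi, Complex.zero_im] at this
    linarith
  have hU : IsOpen upper := isOpen_lt continuous_const Complex.continuous_im
  have hmc : Continuous fun x : ℝ => m x :=
    hc.comp_continuous Complex.continuous_ofReal fun x => by simp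
  -- Beyond this radius `‖ζ - a‖ ≥ ‖ζ‖ / 2` for both poles `a = z` and `a = zb`.
  set R' : ℝ := max R (2 * ‖z‖ + 1) with hR'
  have hsub : ∀ a : ℂ, ‖a‖ = ‖z‖ → ∀ ζ : ℂ, R' ≤ ‖ζ‖ → ‖ζ‖ / 2 ≤ ‖ζ - a‖ := by
    intro a ha ζ hζ
    have h1 := norm_sub_norm_le ζ a
    have h2 : 2 * ‖z‖ + 1 ≤ ‖ζ‖ := (le_max_right _ _).trans hζ
    rw [ha] at h1
    linarith
  have hzbn : ‖zb‖ = ‖z‖ := Complex.norm_conj z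
  have hpos : ∀ ζ : ℂ, R' ≤ ‖ζ‖ → 0 < ‖ζ‖ := fun ζ hζ => by
    have h2 : 2 * ‖z‖ + 1 ≤ ‖ζ‖ := (le_max_right _ _).trans hζ
    linarith [norm_nonneg z]
  -- the pole at `zb` lies outside the closed half-plane
  have hI1 : ∫ x : ℝ, m x * ((x : ℂ) - zb)⁻¹ = 0 := by
    refine integral_real_eq_zero (F := fun ζ => m ζ * (ζ - zb)⁻¹) (C := 2 * C) (R := R') ?_ ?_ ?_
    · exact hc.mul (ContinuousOn.inv₀ (by fun_prop) hnz)
    · exact hd.mul (DifferentiableOn.inv (by fun_prop) fun ζ hζ => hnz ζ (le_of_lt hζ))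
    · intro ζ hζ hζR
      have h1 := hm ζ hζ ((le_max_left _ _).trans hζR)
      have h2 := hsub zb hzbn ζ hζR
      have h3 := hpos ζ hζR
      rw [norm_mul, norm_inv]
      calc ‖m ζ‖ * ‖ζ - zb‖⁻¹ ≤ C / ‖ζ‖ * (‖ζ‖ / 2)⁻¹ := by gcongr
        _ = 2 * C / ‖ζ‖ ^ 2 := by field_simp
  -- the pole at `z` is removed
  set h : ℂ → ℂ := fun ζ => m ζ * (ζ - zb) with hh
  have hhd : DifferentiableOn ℂ h upper := hd.mul (by fun_prop)
  -- The integrand is `m(ζ)/(ζ - z) - h(z)/((ζ - z)(ζ - zb))`. The factor `ζ - zb` built into `h`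
  -- makes the subtracted term decay quadratically; the bare difference quotient of `m` would only
  -- be guaranteed `O(1/ζ)`.
  have hI2 : ∫ x : ℝ, dslope h z x * ((x : ℂ) - zb)⁻¹ = 0 := by
    refine integral_real_eq_zero (F := fun ζ => dslope h z ζ * (ζ - zb)⁻¹)
      (C := 4 * (2 * C + ‖h z‖)) (R := max R' (‖z‖ + 1)) ?_ ?_ ?_
    · refine ContinuousOn.mul ?_ (ContinuousOn.inv₀ (by fun_prop) hnz)
      rw [continuousOn_dslope]
      · exact ⟨hc.mul (by fun_prop), hhd.differentiableAt (hU.mem_nhds hz)⟩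
      · exact mem_of_superset (hU.mem_nhds hz) fun x hx => le_of_lt (show 0 < x.im from hx)
    · refine DifferentiableOn.mul ?_ (DifferentiableOn.inv (by fun_prop)
        fun ζ hζ => hnz ζ (le_of_lt hζ))
      rwa [Complex.differentiableOn_dslope (hU.mem_nhds hz)]
    · intro ζ hζ hζR
      have hζR1 : R' ≤ ‖ζ‖ := (le_max_left _ _).trans hζR
      have h1 := hm ζ hζ ((le_max_left _ _).trans hζR1)
      have h2 := hsub zb hzbn ζ hζR1
      have h2' := hsub z rfl ζ hζR1
      have h3 := hpos ζ hζR1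
      have hne : ζ ≠ z := by
        rintro rfl
        have := (le_max_right R' (‖ζ‖ + 1)).trans hζR
        linarith
      have h4 : ‖ζ - zb‖ ≤ 2 * ‖ζ‖ := by
        refine (norm_sub_le _ _).trans ?_
        rw [hzbn]
        have : 2 * ‖z‖ + 1 ≤ ‖ζ‖ := (le_max_right _ _).trans hζR1
        linarith [norm_nonneg z]
      rw [dslope_of_ne _ hne, slope_def_field, norm_mul, norm_inv, norm_div]
      have h5 : ‖h ζ - h z‖ ≤ 2 * C + ‖h z‖ := by
        refine (norm_sub_le _ _).trans (add_le_add ?_ le_rfl)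
        rw [hh]
        simp only [norm_mul]
        calc ‖m ζ‖ * ‖ζ - zb‖ ≤ C / ‖ζ‖ * (2 * ‖ζ‖) := by gcongr
          _ = 2 * C := by field_simp
      calc ‖h ζ - h z‖ / ‖ζ - z‖ * ‖ζ - zb‖⁻¹
          ≤ (2 * C + ‖h z‖) / (‖ζ‖ / 2) * (‖ζ‖ / 2)⁻¹ := by gcongr
        _ = 4 * (2 * C + ‖h z‖) / ‖ζ‖ ^ 2 := by field_simp; ring
  have hreal : ∀ x : ℝ, (x : ℂ) - z ≠ 0 := ofReal_sub_ne_zero hzi.ne'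
  have hrealb : ∀ x : ℝ, (x : ℂ) - zb ≠ 0 := fun x => hnz x (by simp)
  have hintk : ∀ a : ℂ, ‖a‖ = ‖z‖ → (∀ x : ℝ, (x : ℂ) - a ≠ 0) →
      Integrable fun x : ℝ => m x * ((x : ℂ) - a)⁻¹ := by
    intro a ha hne
    refine integrable_of_decay (C := 2 * C) (R := R') ?_ fun x hx => ?_
    · exact hmc.mul (Continuous.inv₀ (by fun_prop) hne)
    · have hx' : R' ≤ ‖(x : ℂ)‖ := by simpa using hx
      have h1 := hm x (by simp) ((le_max_left _ _).trans hx')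
      have h2 := hsub a ha x hx'
      have h3 := hpos x hx'
      rw [norm_mul, norm_inv]
      calc ‖m x‖ * ‖(x : ℂ) - a‖⁻¹ ≤ C / ‖(x : ℂ)‖ * (‖(x : ℂ)‖ / 2)⁻¹ := by gcongr
        _ = 2 * C / ‖(x : ℂ)‖ ^ 2 := by field_simp
        _ = 2 * C / x ^ 2 := by simp
  have hintz := hintk z rfl hreal
  have hker : ∀ x : ℝ, (((x : ℂ) - z)⁻¹ * ((x : ℂ) - zb)⁻¹) =
      ((((x - z.re) ^ 2 + z.im ^ 2)⁻¹ : ℝ) : ℂ) := by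
    intro x
    have hconj : (x : ℂ) - zb = (starRingEnd ℂ) ((x : ℂ) - z) := by simp [hzb]
    rw [← mul_inv, Complex.ofReal_inv, hconj, Complex.mul_conj, Complex.normSq_apply]
    congr 2
    simp
    ring
  have hI3 : ∫ x : ℝ, m x * ((x : ℂ) - z)⁻¹ = 2 * Real.pi * Complex.I * m z := by
    have h1 : ∀ x : ℝ, dslope h z x * ((x : ℂ) - zb)⁻¹ =
        m x * ((x : ℂ) - z)⁻¹ - h z * ((((x - z.re) ^ 2 + z.im ^ 2)⁻¹ : ℝ) : ℂ) := by
      intro x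
      rw [← hker, dslope_of_ne _ (sub_ne_zero.mp (hreal x)), slope_def_field, hh]
      have := hreal x
      have := hrealb x
      field_simp
    have hik : Integrable fun x : ℝ => ((((x - z.re) ^ 2 + z.im ^ 2)⁻¹ : ℝ) : ℂ) := by
      have hne : ∫ x : ℝ, ((x - z.re) ^ 2 + z.im ^ 2)⁻¹ ≠ 0 := by
        rw [integral_inv_sub_sq_add_sq hzi]
        positivity
      exact (Integrable.of_integral_ne_zero hne).ofReal
    simp only [h1] at hI2
    rw [integral_sub hintz (hik.const_mul _), integral_const_mul, integral_complex_ofReal,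
      integral_inv_sub_sq_add_sq hzi, sub_eq_zero] at hI2
    rw [hI2, hh]
    have : z - zb = 2 * z.im * Complex.I := by
      apply Complex.ext <;> simp [hzb]
      ring
    simp only [this]
    push_cast
    have : (z.im : ℂ) ≠ 0 := by exact_mod_cast hzi.ne'
    field_simp
  -- On the real line, conjugating `hI1` moves the pole from `zb` to `z` and replaces `m` by its
  -- conjugate. Subtracting from `hI3` leaves the imaginary part.
  have hI4 : ∫ x : ℝ, (starRingEnd ℂ) (m x) * ((x : ℂ) - z)⁻¹ = 0 := by
    have := congrArg (starRingEnd ℂ) hI1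
    rw [← integral_conj, map_zero] at this
    rw [← this]
    refine integral_congr_ae (Eventually.of_forall fun x => ?_)
    simp [hzb]
  have hintc : Integrable fun x : ℝ => (starRingEnd ℂ) (m x) * ((x : ℂ) - z)⁻¹ := by
    refine hintz.mono ?_ (Eventually.of_forall fun x => by simp)
    refine Continuous.aestronglyMeasurable ?_
    exact (Complex.continuous_conj.comp hmc).mul (Continuous.inv₀ (by fun_prop) hreal)
  have h2 : ∀ x : ℝ, ((m x).im : ℂ) * ((x : ℂ) - z)⁻¹ = (2 * Complex.I)⁻¹ *
      (m x * ((x : ℂ) - z)⁻¹ - (starRingEnd ℂ) (m x) * ((x : ℂ) - z)⁻¹) := by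
    intro x
    rw [← sub_mul, Complex.sub_conj]
    push_cast
    field_simp
  simp only [h2]
  rw [integral_const_mul, integral_sub hintz hintc, hI3, hI4, sub_zero]
  field_simp

/-! ### Poisson kernel and Stieltjes inversion -/

section Inversion

/-- The Poisson kernel of the half-plane at height `ε`. -/
def poisson (ε x : ℝ) : ℝ := ε / Real.pi * (x ^ 2 + ε ^ 2)⁻¹

lemma continuous_poisson {ε : ℝ} (hε : 0 < ε) : Continuous (poisson ε) := by
  unfold poisson
  exact continuous_const.mul (Continuous.inv₀ (by fun_prop) fun x => by positivity)

lemma poisson_nonneg {ε : ℝ} (hε : 0 < ε) (x : ℝ) : 0 ≤ poisson ε x := by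
  unfold poisson
  positivity

lemma integral_poisson {ε : ℝ} (hε : 0 < ε) (v : ℝ) : ∫ x, poisson ε (x - v) = 1 := by
  simp only [poisson]
  rw [integral_const_mul, integral_inv_sub_sq_add_sq hε]
  field_simp

lemma integrable_poisson {ε : ℝ} (hε : 0 < ε) (v : ℝ) :
    Integrable fun x => poisson ε (x - v) :=
  Integrable.of_integral_ne_zero (by rw [integral_poisson hε]; norm_num)

lemma integral_poisson_eq {μ : Measure ℝ} [IsFiniteMeasure μ] {ε : ℝ} (hε : 0 < ε) (x : ℝ) :
    ∫ v, poisson ε (x - v) ∂μ = (stieltjes μ (x + ε * Complex.I)).im / Real.pi := by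
  rw [stieltjes_im (mem_offSupport_of_im_ne (by simp [hε.ne'])), invSq]
  simp only [poisson]
  rw [integral_const_mul]
  have : ∀ v : ℝ, ‖(v : ℂ) - (x + ε * Complex.I)‖ ^ 2 = (x - v) ^ 2 + ε ^ 2 := by
    intro v
    rw [← Complex.normSq_eq_norm_sq, Complex.normSq_apply]
    simp
    ring
  simp only [this]
  simp
  ring

/-- Fubini: smoothing by the Poisson kernel involves `μ` only through its Stieltjes transform at
height `ε`. -/
lemma integral_poisson_swap {μ : Measure ℝ} [IsFiniteMeasure μ] {ε : ℝ} (hε : 0 < ε)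
    (g : BoundedContinuousFunction ℝ ℝ) :
    ∫ v, (∫ x, g x * poisson ε (x - v)) ∂μ =
      ∫ x, g x * ((stieltjes μ (x + ε * Complex.I)).im / Real.pi) := by
  have hcont : Continuous fun p : ℝ × ℝ => g p.2 * poisson ε (p.2 - p.1) :=
    (g.continuous.comp continuous_snd).mul ((continuous_poisson hε).comp (by fun_prop))
  have hin : ∀ v, Integrable fun x => g x * poisson ε (x - v) := fun v =>
    (integrable_poisson hε v).bdd_mul g.continuous.aestronglyMeasurable
      (Eventually.of_forall g.norm_coe_le_norm)
  have hint : Integrable (Function.uncurry fun v x => g x * poisson ε (x - v))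
      (μ.prod volume) := by
    refine (integrable_prod_iff (f := Function.uncurry fun v x => g x * poisson ε (x - v))
      hcont.aestronglyMeasurable).mpr ⟨Eventually.of_forall hin, ?_⟩
    refine Integrable.of_bound (C := ‖g‖) ?_ (Eventually.of_forall fun v => ?_)
    · exact (hcont.norm.stronglyMeasurable.integral_prod_right
        (ν := (volume : Measure ℝ))).aestronglyMeasurable
    · rw [Real.norm_of_nonneg (integral_nonneg fun _ => norm_nonneg _)]
      calc ∫ x, ‖g x * poisson ε (x - v)‖ ≤ ∫ x, ‖g‖ * poisson ε (x - v) := by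
            refine integral_mono (hin v).norm ((integrable_poisson hε v).const_mul _) fun x => ?_
            simp only [norm_mul]
            rw [Real.norm_of_nonneg (poisson_nonneg hε _)]
            exact mul_le_mul_of_nonneg_right (g.norm_coe_le_norm x) (poisson_nonneg hε _)
        _ = ‖g‖ := by rw [integral_const_mul, integral_poisson hε, mul_one]
  rw [integral_integral_swap hint]
  refine integral_congr_ae (Eventually.of_forall fun x => ?_)
  simp only
  rw [integral_const_mul, integral_poisson_eq hε]

/-- Moves `ε` from the kernel to the test function, so that dominated convergence applies with the
fixed majorant `‖g‖ * poisson 1`. -/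
lemma integral_poisson_rescale {ε : ℝ} (hε : 0 < ε) (g : BoundedContinuousFunction ℝ ℝ)
    (v : ℝ) : ∫ x, g x * poisson ε (x - v) = ∫ t, g (v + ε * t) * poisson 1 t := by
  have h1 : ∀ t, g (v + ε * t) * poisson 1 t =
      ε * (fun u => g (v + u) * poisson ε u) (ε * t) := by
    intro t
    simp only [poisson]
    field_simp
  simp only [h1]
  rw [integral_const_mul, Measure.integral_comp_mul_left (fun u => g (v + u) * poisson ε u) ε,
    abs_of_pos (by positivity), smul_eq_mul, ← mul_assoc, mul_inv_cancel₀ hε.ne', one_mul,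
    ← integral_add_left_eq_self _ v]
  simp

lemma tendsto_integral_poisson {μ : Measure ℝ} [IsFiniteMeasure μ]
    (g : BoundedContinuousFunction ℝ ℝ) :
    Tendsto (fun n : ℕ => ∫ v, (∫ x, g x * poisson (1 / ((n : ℝ) + 1)) (x - v)) ∂μ) atTop
      (𝓝 (∫ v, g v ∂μ)) := by
  have hp : Integrable (poisson 1) := by simpa using integrable_poisson one_pos 0
  have hp1 : ∫ t, poisson 1 t = 1 := by simpa using integral_poisson one_pos 0
  have hε : ∀ n : ℕ, 0 < 1 / ((n : ℝ) + 1) := fun n => by positivity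
  simp only [fun n v => integral_poisson_rescale (hε n) g v]
  have hb : ∀ s t : ℝ, ‖g s * poisson 1 t‖ ≤ ‖g‖ * poisson 1 t := by
    intro s t
    rw [norm_mul, Real.norm_of_nonneg (poisson_nonneg one_pos _)]
    exact mul_le_mul_of_nonneg_right (g.norm_coe_le_norm s) (poisson_nonneg one_pos _)
  refine tendsto_integral_of_dominated_convergence (fun _ => ‖g‖) (fun n => ?_)
    (integrable_const _) (fun n => Eventually.of_forall fun v => ?_)
    (Eventually.of_forall fun v => ?_)
  · have hcont : Continuous fun p : ℝ × ℝ =>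
        g (p.1 + 1 / ((n : ℝ) + 1) * p.2) * poisson 1 p.2 :=
      (g.continuous.comp (by fun_prop)).mul ((continuous_poisson one_pos).comp continuous_snd)
    exact (hcont.stronglyMeasurable.integral_prod_right
      (ν := (volume : Measure ℝ))).aestronglyMeasurable
  · refine (norm_integral_le_of_norm_le (hp.const_mul ‖g‖)
      (Eventually.of_forall fun t => hb _ t)).trans ?_
    rw [integral_const_mul, hp1, mul_one]
  · have hlim : g v = ∫ t, g v * poisson 1 t := by rw [integral_const_mul, hp1, mul_one]
    rw [hlim]
    refine tendsto_integral_of_dominated_convergence (fun t => ‖g‖ * poisson 1 t) (fun n => ?_)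
      (hp.const_mul _) (fun n => Eventually.of_forall fun t => hb _ t)
      (Eventually.of_forall fun t => ?_)
    · exact ((g.continuous.comp (by fun_prop)).mul
        (continuous_poisson one_pos)).aestronglyMeasurable
    · refine Tendsto.mul_const _ ((g.continuous.tendsto v).comp ?_)
      have := (tendsto_one_div_add_atTop_nhds_zero_nat (𝕜 := ℝ)).mul_const t
      simpa using this.const_add v

/-- A finite measure on the line is determined by its Stieltjes transform on `ℂ⁺`. -/
lemma ext_of_stieltjes {μ ν : Measure ℝ} [IsFiniteMeasure μ] [IsFiniteMeasure ν]
    (h : ∀ z ∈ upper, stieltjes μ z = stieltjes ν z) : μ = ν := by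
  refine ext_of_forall_integral_eq_of_IsFiniteMeasure fun g => ?_
  refine tendsto_nhds_unique (tendsto_integral_poisson g) ?_
  refine (tendsto_integral_poisson g).congr fun n => ?_
  have hε : 0 < 1 / ((n : ℝ) + 1) := by positivity
  generalize 1 / ((n : ℝ) + 1) = ε at hε
  rw [integral_poisson_swap hε, integral_poisson_swap hε]
  refine integral_congr_ae (Eventually.of_forall fun x => ?_)
  simp only
  rw [h _ (by simpa [upper] using hε)]

end Inversion

/-- `z m(z) → - μ(ℝ)` along the imaginary axis. -/
lemma tendsto_mul_stieltjes (μ : Measure ℝ) [IsFiniteMeasure μ] :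
    Tendsto (fun y : ℝ => Complex.I * y * stieltjes μ (Complex.I * y)) atTop
      (𝓝 (-(μ.real univ : ℂ))) := by
  have h0 : -(μ.real univ : ℂ) = ∫ _, (-1 : ℂ) ∂μ := by simp
  rw [h0]
  have h1 : ∀ y : ℝ, Complex.I * y * stieltjes μ (Complex.I * y) =
      ∫ v : ℝ, Complex.I * y * ((v : ℂ) - Complex.I * y)⁻¹ ∂μ := by
    intro y
    rw [stieltjes_eq, integral_const_mul]
  simp only [h1]
  refine tendsto_integral_filter_of_dominated_convergence (fun _ => 1)
    (Eventually.of_forall fun y => by fun_prop) ?_ (integrable_const _)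
    (Eventually.of_forall fun v => ?_)
  · filter_upwards [eventually_gt_atTop 0] with y hy
    refine Eventually.of_forall fun v => ?_
    have hne : (v : ℂ) - Complex.I * y ≠ 0 := ofReal_sub_ne_zero (by simp [hy.ne']) v
    rw [norm_mul, norm_inv, ← div_eq_mul_inv, div_le_one (by positivity)]
    refine le_trans ?_ (Complex.abs_im_le_norm _)
    simp
  · have h2 : Tendsto (fun y : ℝ => ((v : ℂ) * (y : ℂ)⁻¹ - Complex.I)⁻¹ * Complex.I) atTop
        (𝓝 (((v : ℂ) * 0 - Complex.I)⁻¹ * Complex.I)) := by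
      refine Tendsto.mul_const _ (Tendsto.inv₀ ?_ (by simp))
      refine Tendsto.sub_const (Tendsto.const_mul _ ?_) _
      have := (Complex.continuous_ofReal.tendsto 0).comp tendsto_inv_atTop_zero
      simpa [Function.comp_def] using this
    have h3 : ((v : ℂ) * 0 - Complex.I)⁻¹ * Complex.I = -1 := by
      simp
    rw [h3] at h2
    refine h2.congr' ?_
    filter_upwards [eventually_gt_atTop 0] with y hy
    have hy' : (y : ℂ) ≠ 0 := by exact_mod_cast hy.ne'
    have hne : (v : ℂ) - Complex.I * y ≠ 0 := ofReal_sub_ne_zero (by simp [hy.ne']) v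
    have h4 : (v : ℂ) * (y : ℂ)⁻¹ - Complex.I = ((v : ℂ) - Complex.I * y) / y := by
      field_simp
    rw [h4, inv_div]
    field_simp

/-! ### The law with density `Im omega / π` -/

/-- The density of the free convolution of the semicircle law with `μ`. -/
def lawDensity (μ : Measure ℝ) (x : ℝ) : ℝ := (omega μ x).im / Real.pi

/-- The free convolution of the semicircle law with `μ`, given by its density. -/
def law (μ : Measure ℝ) : Measure ℝ := volume.withDensity fun x => ENNReal.ofReal (lawDensity μ x)

section Stable

variable {μ : Measure ℝ} (hs : Stable μ)
include hs

lemma Stable.exists_bound : ∃ K, 0 ≤ K ∧ ∀ v ∈ μ.support, |v| ≤ K := by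
  obtain ⟨K, hK⟩ := hs.isCompact_support.isBounded.exists_norm_le
  exact ⟨|K|, abs_nonneg K, fun v hv => (hK v hv).trans (le_abs_self K)⟩

variable [IsProbabilityMeasure μ]

lemma Stable.norm_sub_one_le {z : ℂ} (hz : 0 ≤ z.im) : ‖z‖ - 1 ≤ ‖omega μ z‖ := by
  have h1 := hs.norm_stieltjes_le_one (hs.omega_mem hz)
  rw [← hs.omega_sub hz] at h1
  have h2 := norm_sub_norm_le z (omega μ z)
  rw [norm_sub_rev] at h2
  linarith

omit hs in
lemma norm_mul_stieltjes_add_one_le {K : ℝ} (hK : ∀ v ∈ μ.support, |v| ≤ K) {w : ℂ}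
    (hw : K < ‖w‖) : ‖w * stieltjes μ w + 1‖ ≤ K / (‖w‖ - K) := by
  have hfar : ∀ v ∈ μ.support, ‖w‖ - K ≤ ‖(v : ℂ) - w‖ := by
    intro v hv
    have h1 := norm_sub_norm_le w v
    rw [norm_sub_rev, Complex.norm_real, Real.norm_eq_abs] at h1
    linarith [hK v hv]
  have hoff : w ∈ offSupport μ := by
    rintro ⟨v, hv, rfl⟩
    have := hfar v hv
    simp at this
    simp at hw
    linarith
  have hone : (1 : ℂ) = ∫ _, (1 : ℂ) ∂μ := by simp
  rw [stieltjes_eq, ← integral_const_mul, hone,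
    ← integral_add ((integrable_inv hoff).const_mul w) (integrable_const _)]
  have := norm_integral_le_of_norm_le_const (μ := μ) (C := K / (‖w‖ - K))
    (f := fun v : ℝ => w * ((v : ℂ) - w)⁻¹ + 1) ?_
  · simpa using this
  filter_upwards [Measure.support_mem_ae] with v hv
  have h1 := sub_ne_zero_of_mem hoff hv
  have h2 : w * ((v : ℂ) - w)⁻¹ + 1 = v / ((v : ℂ) - w) := by
    field_simp
    ring
  rw [h2, norm_div, Complex.norm_real, Real.norm_eq_abs]
  have h3 := hK v hv
  have h4 := hfar v hv
  have h5 := (abs_nonneg v).trans h3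
  exact div_le_div₀ h5 h3 (by linarith) h4

/-- Decay at infinity of the Stieltjes transform of the free convolution. -/
lemma Stable.exists_decay : ∃ R, ∀ z : ℂ, 0 ≤ z.im → R ≤ ‖z‖ → ‖omega μ z - z‖ ≤ 4 / ‖z‖ := by
  obtain ⟨K, hK0, hK⟩ := hs.exists_bound
  -- This radius gives `‖ω‖ ≥ 2K + 1`, hence `‖ω m(ω)‖ ≤ 2`, and also `‖z‖ ≤ 2‖ω‖`; together they
  -- yield the constant `4`.
  refine ⟨2 * K + 2, fun z hz hR => ?_⟩
  have h1 := hs.norm_sub_one_le hz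
  have h2 := norm_mul_stieltjes_add_one_le hK (w := omega μ z) (by linarith)
  have h3 : K / (‖omega μ z‖ - K) ≤ 1 := by
    rw [div_le_one (by linarith)]
    linarith
  have h4 : ‖omega μ z * stieltjes μ (omega μ z)‖ ≤ 2 := by
    have := norm_sub_le (omega μ z * stieltjes μ (omega μ z) + 1) 1
    rw [add_sub_cancel_right, norm_one] at this
    linarith
  rw [norm_mul] at h4
  rw [hs.omega_sub hz, le_div_iff₀ (by linarith)]
  have h5 : ‖z‖ ≤ 2 * ‖omega μ z‖ := by linarith
  nlinarith [norm_nonneg (stieltjes μ (omega μ z))]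

lemma Stable.continuous_density : Continuous (lawDensity μ) := by
  have h : Continuous fun x : ℝ => omega μ x :=
    hs.continuousOn_omega.comp_continuous Complex.continuous_ofReal fun x => by simp
  exact (Complex.continuous_im.comp h).div_const _

lemma Stable.density_nonneg (x : ℝ) : 0 ≤ lawDensity μ x :=
  div_nonneg (hs.omega_mem (z := (x : ℂ)) (by simp)).1 Real.pi_pos.le

/-- Far out, `omega μ x` is at distance at least `2` from the support, so `invSq ≤ 1/4`. Then `0 =
Im x = Im ω (1 - invSq)` forces `Im ω = 0`. -/
lemma Stable.exists_density_eq_zero : ∃ R, ∀ x : ℝ, R ≤ |x| → lawDensity μ x = 0 := by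
  obtain ⟨K, hK0, hK⟩ := hs.exists_bound
  refine ⟨K + 3, fun x hx => ?_⟩
  have hz : (0 : ℝ) ≤ (x : ℂ).im := by simp
  have h1 := hs.norm_sub_one_le hz
  rw [Complex.norm_real, Real.norm_eq_abs] at h1
  have hd := hs.omega_mem hz
  have hoff := hs.mem_offSupport hd
  have hq : invSq μ (omega μ x) ≤ 1 / 4 := by
    have h2 := norm_integral_le_of_norm_le_const (μ := μ) (C := 1 / 4)
      (f := fun v : ℝ => (‖(v : ℂ) - omega μ x‖ ^ 2)⁻¹) ?_
    · rw [← invSq, Real.norm_of_nonneg (invSq_nonneg _ _)] at h2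
      simpa using h2
    filter_upwards [Measure.support_mem_ae] with v hv
    have h3 := norm_sub_norm_le (omega μ x) v
    rw [norm_sub_rev, Complex.norm_real, Real.norm_eq_abs] at h3
    have h4 : 2 ≤ ‖(v : ℂ) - omega μ x‖ := by linarith [hK v hv]
    rw [Real.norm_of_nonneg (by positivity), one_div]
    exact inv_anti₀ (by norm_num) (by nlinarith)
  have h5 := invSub_im hoff
  rw [hs.invSub_omega hz, Complex.ofReal_im, eq_comm, mul_eq_zero] at h5
  rcases h5 with h5 | h5
  · simp [lawDensity, h5]
  · linarith

lemma Stable.integrable_density : Integrable (lawDensity μ) := by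
  obtain ⟨R, hR⟩ := hs.exists_density_eq_zero
  refine hs.continuous_density.integrable_of_hasCompactSupport
    (HasCompactSupport.intro (K := Icc (-R) R) isCompact_Icc fun x hx => hR x ?_)
  by_contra! h
  exact hx (abs_le.mp h.le)

lemma Stable.isFiniteMeasure_law : IsFiniteMeasure (law μ) :=
  isFiniteMeasure_withDensity_ofReal hs.integrable_density.2

/-- The Stieltjes transform of the free convolution. -/
lemma Stable.stieltjes_law {z : ℂ} (hz : z ∈ upper) : stieltjes (law μ) z = omega μ z - z := by
  obtain ⟨R, hR⟩ := hs.exists_decay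
  -- On the real line `z` does not contribute to the imaginary part, so the boundary data is `π`
  -- times the density.
  have h1 := cauchy_im_eq (m := fun z => omega μ z - z)
    (hs.continuousOn_omega.sub continuousOn_id) (hs.differentiableOn_omega.sub differentiableOn_id)
    (by norm_num) hR hz
  have hm : Measurable fun x => Real.toNNReal (lawDensity μ x) :=
    hs.continuous_density.measurable.real_toNNReal
  have h2 : stieltjes (law μ) z = ∫ x : ℝ, (lawDensity μ x : ℂ) * ((x : ℂ) - z)⁻¹ := by
    rw [stieltjes_eq, law]
    have := integral_withDensity_eq_integral_smul (μ := volume) hm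
      (fun x : ℝ => ((x : ℂ) - z)⁻¹)
    refine this.trans (integral_congr_ae (Eventually.of_forall fun x => ?_))
    simp [NNReal.smul_def, hs.density_nonneg x]
  have h3 : ∀ x : ℝ, (lawDensity μ x : ℂ) * ((x : ℂ) - z)⁻¹ =
      (Real.pi : ℂ)⁻¹ * ((((omega μ x - x).im : ℝ) : ℂ) * ((x : ℂ) - z)⁻¹) := by
    intro x
    simp [lawDensity]
    field_simp
  rw [h2]
  simp only [h3]
  rw [integral_const_mul, h1, ← mul_assoc, inv_mul_cancel₀ (by simp), one_mul]

omit hs in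
lemma tendsto_mul_stieltjes_cobounded {K : ℝ} (hK : ∀ v ∈ μ.support, |v| ≤ K) :
    Tendsto (fun w : ℂ => w * stieltjes μ w) (Bornology.cobounded ℂ) (𝓝 (-1)) := by
  have h1 : Tendsto (fun w : ℂ => w * stieltjes μ w + 1) (Bornology.cobounded ℂ) (𝓝 0) := by
    refine squeeze_zero_norm' (a := fun w : ℂ => K / (‖w‖ - K)) ?_ ?_
    · filter_upwards [tendsto_norm_cobounded_atTop.eventually_gt_atTop K] with w hw
      exact norm_mul_stieltjes_add_one_le hK hw
    · refine Tendsto.const_div_atTop ?_ K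
      exact tendsto_atTop_add_const_right _ _ tendsto_norm_cobounded_atTop
  simpa using h1.sub_const 1

lemma Stable.tendsto_omega :
    Tendsto (fun y : ℝ => omega μ (Complex.I * y)) atTop (Bornology.cobounded ℂ) := by
  rw [← tendsto_norm_atTop_iff_cobounded]
  refine tendsto_atTop_mono' atTop ?_ (tendsto_atTop_add_const_right atTop (-1 : ℝ) tendsto_id)
  filter_upwards [eventually_gt_atTop 0] with y hy
  have := hs.norm_sub_one_le (z := Complex.I * y) (by simp [hy.le])
  simp [abs_of_pos hy] at this
  simp
  linarith

lemma Stable.tendsto_sub :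
    Tendsto (fun y : ℝ => omega μ (Complex.I * y) - Complex.I * y) atTop (𝓝 0) := by
  obtain ⟨R, hR⟩ := hs.exists_decay
  refine squeeze_zero_norm' (a := fun y : ℝ => 4 / y) ?_ (tendsto_const_nhds.div_atTop tendsto_id)
  filter_upwards [eventually_gt_atTop 0, eventually_ge_atTop R] with y hy hyR
  have h1 : ‖Complex.I * (y : ℂ)‖ = y := by simp [abs_of_pos hy]
  have := hR (Complex.I * y) (by simp [hy.le]) (by rw [h1]; exact hyR)
  rwa [h1] at this

/-- Because `ω - iy = m(ω)`, the product equals `ω m(ω) - (ω - iy)²`; the first term tends to `-1`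
as `ω → ∞`, the second to `0`. -/
lemma Stable.tendsto_mul_sub :
    Tendsto (fun y : ℝ => Complex.I * y * (omega μ (Complex.I * y) - Complex.I * y)) atTop
      (𝓝 (-1)) := by
  obtain ⟨K, hK0, hK⟩ := hs.exists_bound
  have h1 := (tendsto_mul_stieltjes_cobounded hK).comp hs.tendsto_omega
  have h2 := hs.tendsto_sub.mul hs.tendsto_sub
  have h3 := h1.sub h2
  rw [mul_zero, sub_zero] at h3
  refine h3.congr' ?_
  filter_upwards [eventually_gt_atTop 0] with y hy
  have := hs.omega_sub (z := Complex.I * y) (by simp [hy.le])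
  simp only [Function.comp_apply]
  rw [← this]
  ring

/-- The total mass is minus the limit of `iy m(iy)`, computed in two ways. -/
lemma Stable.isProbabilityMeasure_law : IsProbabilityMeasure (law μ) := by
  have := hs.isFiniteMeasure_law
  have h1 := tendsto_mul_stieltjes (law μ)
  have h2 := hs.tendsto_mul_sub.congr' (f₂ := fun y : ℝ =>
    Complex.I * y * stieltjes (law μ) (Complex.I * y)) (by
      filter_upwards [eventually_gt_atTop 0] with y hy
      rw [hs.stieltjes_law (by simp [upper, hy])])
  have h3 := tendsto_nhds_unique h1 h2
  rw [neg_inj] at h3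
  have h4 : (law μ).real univ = 1 := by exact_mod_cast h3
  refine ⟨?_⟩
  rwa [measureReal_def, ENNReal.toReal_eq_one_iff] at h4

end Stable

/-! ### The semicircle law as the case of a point mass -/

lemma support_dirac_subset (a : ℝ) : (Measure.dirac a).support ⊆ {a} :=
  Measure.support_subset_of_isClosed isClosed_singleton (by simp)

lemma stable_dirac : Stable (Measure.dirac (0 : ℝ)) := by
  have h : (Measure.dirac (0 : ℝ)).support = {0} :=
    Subset.antisymm (support_dirac_subset 0)
      (singleton_subset_iff.mpr ((support_nonempty _).elim fun x hx => by
        have := support_dirac_subset 0 hx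
        rw [mem_singleton_iff] at this
        rwa [this] at hx))
  refine ⟨by rw [h]; exact isCompact_singleton, fun x hx => ?_⟩
  rw [hull, h, convexHull_singleton, mem_singleton_iff] at hx
  simp [hx]

lemma stieltjes_dirac_zero (w : ℂ) : stieltjes (Measure.dirac 0) w = -w⁻¹ := by
  rw [stieltjes_eq, integral_dirac, Complex.ofReal_zero, zero_sub, inv_neg]

lemma invSub_dirac_zero (w : ℂ) : invSub (Measure.dirac 0) w = w + w⁻¹ := by
  rw [invSub, stieltjes_dirac_zero, sub_neg_eq_add]

lemma mem_dom_dirac_zero {w : ℂ} (h0 : 0 ≤ w.im) (h1 : 1 ≤ ‖w‖) :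
    w ∈ dom (Measure.dirac 0) := by
  refine ⟨h0, ?_⟩
  rw [lintegral_dirac, ENNReal.inv_le_one, Complex.ofReal_zero, zero_sub, norm_neg,
    ENNReal.one_le_ofReal]
  nlinarith

/-- Solve `w + w⁻¹ = x` with `‖w‖ ≥ 1`: for `|x| ≤ 2` the root is on the upper unit semicircle, for
`|x| > 2` it is the real root outside the unit disc. -/
lemma omega_dirac_zero_im (x : ℝ) :
    (omega (Measure.dirac 0) x).im = Real.sqrt (4 - x ^ 2) / 2 := by
  by_cases hx : x ^ 2 ≤ 4
  · have hs : Real.sqrt (4 - x ^ 2) ^ 2 = 4 - x ^ 2 := Real.sq_sqrt (by linarith)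
    set r := Real.sqrt (4 - x ^ 2)
    have hr : 0 ≤ r := Real.sqrt_nonneg _
    set w : ℂ := ⟨x / 2, r / 2⟩ with hw
    have hn : Complex.normSq w = 1 := by
      rw [Complex.normSq_apply, hw]
      simp only
      nlinarith
    rw [stable_dirac.omega_eq (w := w)]
    · exact mem_dom_dirac_zero (show 0 ≤ r / 2 by linarith) (by
        rw [← Real.sqrt_one, ← hn, ← Complex.norm_def])
    · rw [invSub_dirac_zero, Complex.inv_def, hn]
      apply Complex.ext
      · simp [hw]
      · simp [hw]
  · push Not at hx
    rw [Real.sqrt_eq_zero_of_nonpos (by linarith)]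
    obtain ⟨w, hw, hwx⟩ : ∃ w : ℝ, 1 ≤ |w| ∧ w + w⁻¹ = x := by
      have hs : Real.sqrt (x ^ 2 - 4) ^ 2 = x ^ 2 - 4 := Real.sq_sqrt (by linarith)
      set r := Real.sqrt (x ^ 2 - 4)
      have hr : 0 ≤ r := Real.sqrt_nonneg _
      rcases le_total 0 x with h | h
      · have h2 : 2 ≤ x := by nlinarith
        refine ⟨(x + r) / 2, (by linarith : (1 : ℝ) ≤ (x + r) / 2).trans (le_abs_self _), ?_⟩
        have : x + r ≠ 0 := by linarith
        field_simp
        nlinarith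
      · have h2 : x ≤ -2 := by nlinarith
        refine ⟨(x - r) / 2, (by linarith : (1 : ℝ) ≤ -((x - r) / 2)).trans (neg_le_abs _), ?_⟩
        have : x - r ≠ 0 := by linarith
        field_simp
        nlinarith
    rw [stable_dirac.omega_eq (w := (w : ℂ))]
    · simp
    · exact mem_dom_dirac_zero (by simp) (by simpa using hw)
    · rw [invSub_dirac_zero, ← hwx]
      push_cast
      rfl

lemma semicircle_eq_law : semicircle = law (Measure.dirac 0) := by
  rw [semicircle, law]
  congr 1
  funext x
  rw [lawDensity, omega_dirac_zero_im, div_div]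

lemma stieltjes_semicircle {z : ℂ} (hz : z ∈ upper) :
    stieltjes semicircle z ≠ 0 ∧ stieltjes semicircle z + 1 / stieltjes semicircle z = -z := by
  have h0 : (0 : ℝ) ≤ z.im := le_of_lt hz
  have hi := (stable_dirac.invSq_omega_lt hz).1
  have h1 := stable_dirac.invSub_omega h0
  rw [invSub_dirac_zero] at h1
  have hne : omega (Measure.dirac 0) z ≠ 0 := by
    intro h
    simp [h] at hi
  rw [semicircle_eq_law, stable_dirac.stieltjes_law hz]
  set w := omega (Measure.dirac 0) z
  have h2 : w - z = -w⁻¹ := by linear_combination h1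
  rw [h2]
  refine ⟨by simpa using hne, ?_⟩
  rw [← h1]
  field_simp
  ring

lemma neg_sub_inv_mem_upper {u : ℂ} (hu : u ∈ upper) (h1 : ‖u‖ < 1) : -u - 1 / u ∈ upper := by
  have hne : u ≠ 0 := by
    rintro rfl
    simp [upper] at hu
  have hn : 0 < Complex.normSq u := Complex.normSq_pos.mpr hne
  have hn1 : Complex.normSq u < 1 := by
    rw [Complex.normSq_eq_norm_sq]
    nlinarith [norm_nonneg u]
  have hui : 0 < u.im := hu
  show 0 < (-u - 1 / u).im
  rw [one_div, Complex.sub_im, Complex.neg_im, Complex.inv_im]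
  have : u.im < u.im / Complex.normSq u := by
    rw [lt_div_iff₀ hn]
    nlinarith
  rw [neg_div]
  linarith

lemma neg_inv_mem_upper {u : ℂ} (hu : u ∈ upper) : -u⁻¹ ∈ upper := by
  have hne : u ≠ 0 := by
    rintro rfl
    simp [upper] at hu
  show 0 < (-u⁻¹).im
  have hui : 0 < u.im := hu
  rw [Complex.neg_im, Complex.inv_im, neg_div, neg_neg]
  exact div_pos hui (Complex.normSq_pos.mpr hne)

/-- At `z = -u - 1/u` the subordination point of the point mass is `-u⁻¹`. Thus the semicircle
transform is explicitly inverted on the upper half-disc, which supplies `ω₁`. -/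
lemma stieltjes_semicircle_eq {u : ℂ} (hu : u ∈ upper) (h1 : ‖u‖ < 1) :
    stieltjes semicircle (-u - 1 / u) = u := by
  have hz := neg_sub_inv_mem_upper hu h1
  have hne : u ≠ 0 := by
    rintro rfl
    simp [upper] at hu
  rw [semicircle_eq_law, stable_dirac.stieltjes_law hz,
    ← stable_dirac.eq_omega hz (neg_inv_mem_upper hu)]
  · field_simp
    ring
  · rw [invSub_dirac_zero]
    field_simp
    ring

/-! ### Existence and uniqueness of the free convolution -/

section Stable

variable {μ : Measure ℝ} [IsProbabilityMeasure μ] (hs : Stable μ)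
include hs

lemma Stable.sub_mem_upper {z : ℂ} (hz : z ∈ upper) :
    omega μ z - z ∈ upper ∧ ‖omega μ z - z‖ < 1 := by
  have h0 : (0 : ℝ) ≤ z.im := le_of_lt hz
  have hoff := hs.mem_offSupport (hs.omega_mem h0)
  obtain ⟨h1, h2⟩ := hs.invSq_omega_lt hz
  rw [hs.omega_sub h0]
  refine ⟨?_, by linarith [norm_stieltjes_le hoff]⟩
  show 0 < (stieltjes μ (omega μ z)).im
  rw [stieltjes_im hoff]
  exact mul_pos h1 (invSq_pos hoff)

/-- Existence of the free convolution with the semicircle law. -/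
lemma Stable.isFreeAdditiveConvolution : IsFreeAdditiveConvolution semicircle μ (law μ) := by
  -- With `ω₂ = omega μ = z + m`, the relation `ω₁ + ω₂ = z - 1/m` leaves no choice for `ω₁`.
  refine ⟨hs.isProbabilityMeasure_law, fun z => -(omega μ z - z) - 1 / (omega μ z - z),
    omega μ, ?_, hs.differentiableOn_omega, ?_, ?_, ?_, ?_, ?_⟩
  · have hd : DifferentiableOn ℂ (fun z => omega μ z - z) upper :=
      hs.differentiableOn_omega.sub differentiableOn_id
    refine hd.neg.sub ((differentiableOn_const 1).div hd fun z hz h => ?_)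
    have := (hs.sub_mem_upper hz).1
    rw [h] at this
    simp [upper] at this
  · intro z hz
    exact neg_sub_inv_mem_upper (hs.sub_mem_upper hz).1 (hs.sub_mem_upper hz).2
  · intro z hz
    exact (hs.invSq_omega_lt hz).1
  · have h1 := hs.tendsto_sub
    have h2 := hs.tendsto_mul_sub
    have h3 : Tendsto (fun y : ℝ => (Complex.I * (y : ℂ))⁻¹) atTop (𝓝 0) := by
      refine squeeze_zero_norm' (a := fun y : ℝ => y⁻¹) ?_ tendsto_inv_atTop_zero
      filter_upwards [eventually_gt_atTop 0] with y hy
      simp [abs_of_pos hy]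
    have h4 := (h1.mul h3).neg.sub (h2.inv₀ (by simp))
    have h5 : -((0 : ℂ) * 0) - (-1)⁻¹ = 1 := by norm_num
    rw [h5] at h4
    refine h4.congr fun y => ?_
    beta_reduce
    generalize omega μ (Complex.I * (y : ℂ)) - Complex.I * (y : ℂ) = A
    generalize Complex.I * (y : ℂ) = B
    rw [mul_inv]
    ring
  · have h1 := hs.tendsto_sub
    have h3 : Tendsto (fun y : ℝ => (Complex.I * (y : ℂ))⁻¹) atTop (𝓝 0) := by
      refine squeeze_zero_norm' (a := fun y : ℝ => y⁻¹) ?_ tendsto_inv_atTop_zero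
      filter_upwards [eventually_gt_atTop 0] with y hy
      simp [abs_of_pos hy]
    have h4 := (h1.mul h3).add_const 1
    rw [mul_zero, zero_add] at h4
    refine h4.congr' ?_
    filter_upwards [eventually_gt_atTop 0] with y hy
    have : Complex.I * (y : ℂ) ≠ 0 := by simp [hy.ne']
    generalize Complex.I * (y : ℂ) = B at this
    field_simp
    ring
  · intro z hz
    obtain ⟨h1, h2⟩ := hs.sub_mem_upper hz
    refine ⟨?_, ?_, ?_⟩
    · rw [hs.stieltjes_law hz, stieltjes_semicircle_eq h1 h2]
    · rw [hs.stieltjes_law hz, hs.omega_sub (le_of_lt hz)]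
    · rw [hs.stieltjes_law hz]
      ring

/-- Uniqueness of the free convolution with the semicircle law. -/
lemma Stable.eq_law {ρ : Measure ℝ} (h : IsFreeAdditiveConvolution semicircle μ ρ) :
    ρ = law μ := by
  have := h.isProbabilityMeasure
  have := hs.isProbabilityMeasure_law
  obtain ⟨ω₁, ω₂, -, -, hm₁, hm₂, -, -, heq⟩ := h.subordination
  refine ext_of_stieltjes fun z hz => ?_
  obtain ⟨h1, h2, h3⟩ := heq z hz
  have h4 := stieltjes_semicircle (hm₁ hz)
  rw [← h1] at h4
  -- The quadratic equation `m + 1/m = -ω₁` eliminates `ω₁`. What remains is `ω₂ - m_μ(ω₂) = z`,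
  -- which has only one solution in `ℂ⁺`.
  have h5 : ω₂ z = z + stieltjes ρ z := by linear_combination h3 - h4.2
  have h6 : ω₂ z = omega μ z := by
    refine hs.eq_omega hz (hm₂ hz) ?_
    rw [invSub, ← h2, h5]
    ring
  rw [hs.stieltjes_law hz, ← h6, h5]
  ring

end Stable

/-! ### Edges as extremal values on the real axis -/

/-- The restriction of `w ↦ w - m_μ(w)` to the real points outside the support. -/
def edgeFun (μ : Measure ℝ) (x : ℝ) : ℝ := x + ∫ v, (x - v)⁻¹ ∂μ

lemma invSub_ofReal (μ : Measure ℝ) (x : ℝ) : invSub μ x = edgeFun μ x := by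
  rw [invSub, stieltjes_eq, edgeFun, Complex.ofReal_add, sub_eq_add_neg, ← integral_neg,
    ← integral_complex_ofReal]
  congr 2
  funext v
  push_cast
  rw [← inv_neg, neg_sub]

lemma invSq_ofReal (μ : Measure ℝ) (x : ℝ) : invSq μ x = ∫ v, ((x - v) ^ 2)⁻¹ ∂μ := by
  rw [invSq]
  refine integral_congr_ae (Eventually.of_forall fun v => ?_)
  simp only [norm_sq_ofReal_sub]
  rw [← neg_sub, neg_sq]

/-- The largest point on the real boundary of `dom μ` to the right of the support. -/
structure IsRightEdge (μ : Measure ℝ) (w : ℝ) : Prop where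
  lt : ∀ v ∈ μ.support, v < w
  invSq_le : invSq μ w ≤ 1
  le : ∀ x : ℝ, (∀ v ∈ μ.support, v < x) → invSq μ x ≤ 1 → w ≤ x
  edgeFun_le : ∀ x : ℝ, (∀ v ∈ μ.support, v < x) → edgeFun μ w ≤ edgeFun μ x

section Right

variable {μ : Measure ℝ}

lemma ofReal_mem_offSupport {x : ℝ} (hx : ∀ v ∈ μ.support, v < x) : (x : ℂ) ∈ offSupport μ := by
  rintro ⟨v, hv, h⟩
  have : v = x := by simpa using h
  exact absurd (hx v hv) (by simp [this])

variable [IsProbabilityMeasure μ]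

lemma integrable_mul_inv_real {x y : ℝ} (hx : ∀ v ∈ μ.support, v < x)
    (hy : ∀ v ∈ μ.support, v < y) : Integrable (fun v => (x - v)⁻¹ * (y - v)⁻¹) μ := by
  have := (integrable_mul_inv (ofReal_mem_offSupport hx) (ofReal_mem_offSupport hy)).re
  refine this.congr (Eventually.of_forall fun v => ?_)
  have h : ((v : ℂ) - x)⁻¹ * ((v : ℂ) - y)⁻¹ = (((x - v)⁻¹ * (y - v)⁻¹ : ℝ) : ℂ) := by
    push_cast
    rw [← neg_sub, ← neg_sub (y : ℂ), inv_neg, inv_neg, neg_mul_neg]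
  simp only [h, RCLike.re_to_complex, Complex.ofReal_re]

lemma edgeFun_sub {x y : ℝ} (hx : ∀ v ∈ μ.support, v < x) (hy : ∀ v ∈ μ.support, v < y) :
    edgeFun μ x - edgeFun μ y = (x - y) * (1 - ∫ v, (x - v)⁻¹ * (y - v)⁻¹ ∂μ) := by
  have h := invSub_sub (ofReal_mem_offSupport hx) (ofReal_mem_offSupport hy)
  rw [invSub_ofReal, invSub_ofReal] at h
  have h2 : ∫ v : ℝ, ((v : ℂ) - x)⁻¹ * ((v : ℂ) - y)⁻¹ ∂μ =
      ((∫ v, (x - v)⁻¹ * (y - v)⁻¹ ∂μ : ℝ) : ℂ) := by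
    rw [← integral_complex_ofReal]
    refine integral_congr_ae (Eventually.of_forall fun v => ?_)
    push_cast
    rw [← neg_sub, ← neg_sub (y : ℂ), inv_neg, inv_neg, neg_mul_neg]
  rw [h2] at h
  exact_mod_cast h

/-- To the right of the support the kernel decreases, so the mixed integral lies between `invSq` at
the farther and at the nearer point. This bound and the next replace a sign study of the derivative
of `edgeFun`. -/
lemma invSq_le_integral {x y : ℝ} (hx : ∀ v ∈ μ.support, v < x) (hxy : x ≤ y) :
    invSq μ y ≤ ∫ v, (x - v)⁻¹ * (y - v)⁻¹ ∂μ := by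
  have hy : ∀ v ∈ μ.support, v < y := fun v hv => (hx v hv).trans_le hxy
  rw [invSq_ofReal]
  simp only [sq, mul_inv]
  refine integral_mono_ae (integrable_mul_inv_real hy hy) (integrable_mul_inv_real hx hy) ?_
  filter_upwards [Measure.support_mem_ae] with v hv
  have h1 := hx v hv
  have h2 := hy v hv
  have : (y - v)⁻¹ ≤ (x - v)⁻¹ := inv_anti₀ (by linarith) (by linarith)
  exact mul_le_mul_of_nonneg_right this (inv_nonneg.mpr (by linarith))

lemma integral_le_invSq {x y : ℝ} (hx : ∀ v ∈ μ.support, v < x) (hxy : x ≤ y) :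
    ∫ v, (x - v)⁻¹ * (y - v)⁻¹ ∂μ ≤ invSq μ x := by
  have hy : ∀ v ∈ μ.support, v < y := fun v hv => (hx v hv).trans_le hxy
  rw [invSq_ofReal]
  simp only [sq, mul_inv]
  refine integral_mono_ae (integrable_mul_inv_real hx hy) (integrable_mul_inv_real hx hx) ?_
  filter_upwards [Measure.support_mem_ae] with v hv
  have h1 := hx v hv
  have h2 := hy v hv
  have : (y - v)⁻¹ ≤ (x - v)⁻¹ := inv_anti₀ (by linarith) (by linarith)
  exact mul_le_mul_of_nonneg_left this (inv_nonneg.mpr (by linarith))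

lemma continuousAt_edgeFun {x : ℝ} (hx : ∀ v ∈ μ.support, v < x) :
    ContinuousAt (edgeFun μ) x := by
  have h1 : ContinuousAt (fun y : ℝ => (invSub μ y).re) x := by
    refine ContinuousAt.comp (g := Complex.re) Complex.continuous_re.continuousAt ?_
    exact ContinuousAt.comp (g := invSub μ) (hasDerivAt_invSub (ofReal_mem_offSupport hx)).continuousAt
      Complex.continuous_ofReal.continuousAt
  simpa [invSub_ofReal] using h1

variable (hs : Stable μ)
include hs

lemma Stable.ofReal_mem_dom_iff {x : ℝ} (hx : ∀ v ∈ μ.support, v < x) :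
    (x : ℂ) ∈ dom μ ↔ invSq μ x ≤ 1 := by
  rw [hs.mem_dom_iff]
  simp [ofReal_mem_offSupport hx]

/-- Take the least real point of `dom μ` to the right of the support; it exists because `dom μ` is
closed and stability excludes the endpoint `b`. Beyond it `edgeFun` stays above its value there
because `invSq μ w ≤ 1`; before it `edgeFun` decreases because `invSq > 1`. -/
lemma Stable.exists_isRightEdge : ∃ w, IsRightEdge μ w := by
  obtain ⟨b, hb⟩ := hs.isCompact_support.exists_isGreatest (support_nonempty μ)
  have hbd : (b : ℂ) ∉ dom μ := hs.notMem_dom (support_subset_hull μ hb.1)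
  set T : Set ℝ := {x | b ≤ x ∧ (x : ℂ) ∈ dom μ} with hT
  have hTlt : ∀ x ∈ T, ∀ v ∈ μ.support, v < x := by
    rintro x ⟨hbx, hx⟩ v hv
    refine (hb.2 hv).trans_lt (lt_of_le_of_ne hbx ?_)
    rintro rfl
    exact hbd hx
  have hmemT : ∀ x : ℝ, (∀ v ∈ μ.support, v < x) → invSq μ x ≤ 1 → x ∈ T := fun x hx h =>
    ⟨(hx b hb.1).le, (hs.ofReal_mem_dom_iff hx).mpr h⟩
  have hTc : IsClosed T :=
    isClosed_Ici.inter ((isClosed_dom μ).preimage Complex.continuous_ofReal)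
  have hTb : BddBelow T := ⟨b, fun x hx => hx.1⟩
  have hTn : T.Nonempty := by
    have hb1 : ∀ v ∈ μ.support, v < b + 1 := fun v hv => (hb.2 hv).trans_lt (by linarith)
    refine ⟨b + 1, hmemT _ hb1 ?_⟩
    have h2 : invSq μ ((b + 1 : ℝ) : ℂ) ≤ ∫ _, (1 : ℝ) ∂μ := by
      refine integral_mono_ae (integrable_invSq (ofReal_mem_offSupport hb1))
        (integrable_const _) ?_
      filter_upwards [Measure.support_mem_ae] with v hv
      rw [norm_sq_ofReal_sub]
      have := hb.2 hv
      exact inv_le_one_of_one_le₀ (by nlinarith)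
    simpa using h2
  have hw := hTc.csInf_mem hTn hTb
  set w := sInf T
  have hlt := hTlt w hw
  have hle : ∀ x : ℝ, (∀ v ∈ μ.support, v < x) → invSq μ x ≤ 1 → w ≤ x := fun x hx h =>
    csInf_le hTb (hmemT x hx h)
  have hw1 : invSq μ w ≤ 1 := (hs.ofReal_mem_dom_iff hlt).mp hw.2
  refine ⟨w, hlt, hw1, hle, fun x hx => ?_⟩
  rcases le_or_gt w x with h | h
  · have h1 := edgeFun_sub hlt hx
    have h2 := integral_le_invSq hlt h
    nlinarith
  -- Only `invSq μ w ≤ 1` is known at `w`, so `x` is compared with points `y < w`, where `invSq >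
  -- 1`, and then `y` tends to `w`.
  · refine le_of_tendsto ((continuousAt_edgeFun hlt).tendsto.mono_left
      (nhdsWithin_le_nhds (s := Iio w))) ?_
    filter_upwards [Ioo_mem_nhdsLT h] with y hy
    have hy' : ∀ v ∈ μ.support, v < y := fun v hv => (hx v hv).trans hy.1
    have h1 := edgeFun_sub hx hy'
    have h2 := invSq_le_integral hx hy.1.le
    have h3 : 1 < invSq μ y := by
      by_contra! h3
      exact absurd (hle y hy' h3) (not_le.mpr hy.2)
    nlinarith [hy.1]

omit hs in
lemma IsRightEdge.invSq_le_of_le {w x : ℝ} (hw : IsRightEdge μ w) (h : w ≤ x) :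
    invSq μ x ≤ 1 :=
  ((invSq_le_integral hw.lt h).trans (integral_le_invSq hw.lt h)).trans hw.invSq_le

lemma Stable.omega_im_eq_zero_of_le {w E : ℝ} (hw : IsRightEdge μ w) (hE : edgeFun μ w ≤ E) :
    ∃ x : ℝ, w ≤ x ∧ omega μ E = x := by
  -- `edgeFun` differs from the identity by at most `1` on `dom μ`, so it has reached `E` by this
  -- point and the intermediate value theorem applies.
  set y := max w (E + 1) with hy
  have hltx : ∀ x, w ≤ x → ∀ v ∈ μ.support, v < x := fun x hx v hv => (hw.lt v hv).trans_le hx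
  have hdom : ∀ x : ℝ, w ≤ x → (x : ℂ) ∈ dom μ := fun x hx =>
    (hs.ofReal_mem_dom_iff (hltx x hx)).mpr (hw.invSq_le_of_le hx)
  have hwy : w ≤ y := le_max_left _ _
  have hEy : E ≤ edgeFun μ y := by
    have h1 := hs.norm_stieltjes_le_one (hdom y hwy)
    have h2 : stieltjes μ y = y - edgeFun μ y := by
      rw [← invSub_ofReal, invSub]
      ring
    rw [h2, ← Complex.ofReal_sub, Complex.norm_real, Real.norm_eq_abs] at h1
    have h3 : E + 1 ≤ y := le_max_right _ _
    linarith [le_abs_self (y - edgeFun μ y)]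
  have hcont : ContinuousOn (edgeFun μ) (Icc w y) := fun x hx =>
    (continuousAt_edgeFun (hltx x hx.1)).continuousWithinAt
  obtain ⟨x, hx, hxE⟩ := intermediate_value_Icc hwy hcont ⟨hE, hEy⟩
  refine ⟨x, hx.1, hs.omega_eq (hdom x hx.1) ?_⟩
  rw [invSub_ofReal, hxE]

end Right

/-! ### Reflection, exchanging the two edges -/

section Reflection

variable {μ : Measure ℝ}

lemma map_neg_apply (U : Set ℝ) : (μ.map Neg.neg) U = μ (Neg.neg ⁻¹' U) :=
  (MeasurableEquiv.neg ℝ).map_apply U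

lemma integral_map_neg (f : ℝ → ℝ) : ∫ v, f v ∂(μ.map Neg.neg) = ∫ v, f (-v) ∂μ :=
  (MeasurableEquiv.neg ℝ).measurableEmbedding.integral_map f

lemma mem_support_map_neg {v : ℝ} : v ∈ (μ.map Neg.neg).support ↔ -v ∈ μ.support := by
  rw [Measure.mem_support_iff_forall, Measure.mem_support_iff_forall]
  constructor
  · intro h U hU
    have h1 := h (Neg.neg ⁻¹' U) (continuous_neg.continuousAt.preimage_mem_nhds hU)
    rw [map_neg_apply] at h1
    simpa [preimage_preimage] using h1
  · intro h U hU
    rw [map_neg_apply]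
    refine h _ ?_
    have : U ∈ 𝓝 (- -v) := by rwa [neg_neg]
    exact continuous_neg.continuousAt.preimage_mem_nhds this

lemma support_map_neg : (μ.map Neg.neg).support = -μ.support := by
  ext v
  rw [mem_support_map_neg, Set.mem_neg]

lemma hull_map_neg : hull (μ.map Neg.neg) = -hull μ := by
  rw [hull, support_map_neg, convexHull_neg, hull]

lemma Stable.map_neg (hs : Stable μ) : Stable (μ.map Neg.neg) := by
  refine ⟨by rw [support_map_neg]; exact hs.isCompact_support.neg, fun x hx => ?_⟩
  rw [hull_map_neg, Set.mem_neg] at hx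
  refine (hs.one_lt _ hx).trans_eq ?_
  rw [lintegral_map (by fun_prop) measurable_neg]
  refine lintegral_congr fun v => ?_
  congr 2
  ring

lemma edgeFun_map_neg (x : ℝ) : edgeFun (μ.map Neg.neg) x = -edgeFun μ (-x) := by
  rw [edgeFun, edgeFun, neg_add, neg_neg, ← integral_neg, integral_map_neg]
  congr 1
  refine integral_congr_ae (Eventually.of_forall fun v => ?_)
  simp only
  rw [← inv_neg]
  congr 1
  ring

lemma invSq_map_neg (x : ℝ) : invSq (μ.map Neg.neg) x = invSq μ (-x : ℝ) := by
  rw [invSq_ofReal, invSq_ofReal, integral_map_neg]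
  refine integral_congr_ae (Eventually.of_forall fun v => ?_)
  simp only
  congr 1
  ring

end Reflection

/-! ### Zero set of the density and support of the law -/

section Law

lemma Stable.right_or_left {μ : Measure ℝ} (hs : Stable μ) {x : ℝ} (hx : (x : ℂ) ∈ dom μ) :
    (∀ v ∈ μ.support, v < x) ∨ (∀ v ∈ μ.support, x < v) := by
  by_contra! h
  obtain ⟨⟨v, hv, hvx⟩, ⟨u, hu, hux⟩⟩ := h
  have hconv : (hull μ).OrdConnected := (convex_convexHull ℝ _).ordConnected
  exact hs.notMem_dom (hconv.out (support_subset_hull μ hu) (support_subset_hull μ hv)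
    ⟨hux, hvx⟩) hx

variable {μ : Measure ℝ} [IsProbabilityMeasure μ] (hs : Stable μ)
include hs

/-- The zero set of the density in terms of the edges. -/
lemma Stable.density_eq_zero_iff {w w' : ℝ} (hw : IsRightEdge μ w)
    (hw' : IsRightEdge (μ.map Neg.neg) w') (E : ℝ) :
    lawDensity μ E = 0 ↔ E ≤ -edgeFun (μ.map Neg.neg) w' ∨ edgeFun μ w ≤ E := by
  have hpm : IsProbabilityMeasure (μ.map Neg.neg) :=
    Measure.isProbabilityMeasure_map measurable_neg.aemeasurable
  have hE0 : (0 : ℝ) ≤ (E : ℂ).im := by simp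
  constructor
  · intro h
    have him : (omega μ E).im = 0 := by
      rw [lawDensity, div_eq_zero_iff] at h
      exact h.resolve_right Real.pi_ne_zero
    obtain ⟨x, hx⟩ : ∃ x : ℝ, omega μ E = x := ⟨(omega μ E).re, Complex.ext (by simp) (by simp [him])⟩
    have hd := hs.omega_mem hE0
    have hz := hs.invSub_omega hE0
    rw [hx] at hd hz
    rw [invSub_ofReal, Complex.ofReal_inj] at hz
    rw [← hz]
    rcases hs.right_or_left hd with h1 | h1
    · exact Or.inr (hw.edgeFun_le x h1)
    · left
      have h2 := hw'.edgeFun_le (-x) fun v hv => by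
        have := h1 _ (mem_support_map_neg.mp hv)
        linarith
      rw [edgeFun_map_neg (-x), neg_neg] at h2
      linarith
  · rintro (h | h)
    -- Solve for the reflected measure at `-E`: its subordination point is a real `x`, and `-x` is
    -- then the point for `μ` at `E`.
    · have h2 : edgeFun (μ.map Neg.neg) w' ≤ -E := by linarith
      obtain ⟨x, hx, hxE⟩ := hs.map_neg.omega_im_eq_zero_of_le hw' h2
      have h3 := hs.map_neg.invSub_omega (z := ((-E : ℝ) : ℂ)) (by simp)
      rw [hxE, invSub_ofReal, Complex.ofReal_inj, edgeFun_map_neg, neg_inj] at h3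
      have h4 := hs.map_neg.omega_mem (z := ((-E : ℝ) : ℂ)) (by simp)
      have hltx : ∀ v ∈ (μ.map Neg.neg).support, v < x := fun v hv =>
        (hw'.lt v hv).trans_le hx
      rw [hxE, hs.map_neg.ofReal_mem_dom_iff hltx, invSq_map_neg] at h4
      have h5 : ((-x : ℝ) : ℂ) ∈ dom μ := by
        rw [hs.mem_dom_iff]
        refine ⟨by simp, ?_, h4⟩
        rintro ⟨v, hv, hvx⟩
        have hvx' : v = -x := by simpa using congrArg Complex.re hvx
        have := hltx (-v) (mem_support_map_neg.mpr (by rwa [neg_neg]))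
        linarith
      rw [lawDensity, hs.omega_eq (z := (E : ℂ)) h5 (by rw [invSub_ofReal, h3])]
      simp
    · obtain ⟨x, -, hxE⟩ := hs.omega_im_eq_zero_of_le hw h
      simp [lawDensity, hxE]

/-- If the edges met or crossed, the density would vanish everywhere, contradicting total mass one.
-/
lemma Stable.left_lt_right {w w' : ℝ} (hw : IsRightEdge μ w)
    (hw' : IsRightEdge (μ.map Neg.neg) w') :
    -edgeFun (μ.map Neg.neg) w' < edgeFun μ w := by
  by_contra! h
  have hz : lawDensity μ = 0 := by
    funext E
    refine (hs.density_eq_zero_iff hw hw' E).mpr ?_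
    rcases le_total E (edgeFun μ w) with h1 | h1
    · exact Or.inl (h1.trans h)
    · exact Or.inr h1
  have := hs.isProbabilityMeasure_law
  have h1 : law μ = 0 := by
    rw [law, hz]
    simp
  exact IsProbabilityMeasure.ne_zero (law μ) h1

lemma Stable.support_law {a b : ℝ} (hab : a < b)
    (h : ∀ E, lawDensity μ E = 0 ↔ E ≤ a ∨ b ≤ E) : (law μ).support = Icc a b := by
  have hm : Measurable fun x => ENNReal.ofReal (lawDensity μ x) :=
    hs.continuous_density.measurable.ennreal_ofReal
  have hpos : ∀ E, ENNReal.ofReal (lawDensity μ E) ≠ 0 ↔ E ∈ Ioo a b := by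
    intro E
    rw [Ne, ENNReal.ofReal_eq_zero]
    have h1 := h E
    have h2 := hs.density_nonneg E
    constructor
    · intro h3
      by_contra h4
      refine h3 (le_of_eq (h1.mpr ?_))
      by_contra! h5
      exact h4 h5
    · intro h3 h4
      have := h1.mp (le_antisymm h4 h2)
      rcases this with h5 | h5
      · exact absurd h3.1 (not_lt.mpr h5)
      · exact absurd h3.2 (not_lt.mpr h5)
  refine Subset.antisymm (Measure.support_subset_of_isClosed isClosed_Icc ?_) ?_
  · rw [mem_ae_iff, law, withDensity_apply_eq_zero hm]
    convert measure_empty (μ := (volume : Measure ℝ))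
    ext E
    simp only [mem_inter_iff, mem_ofPred_eq, hpos, mem_compl_iff, mem_empty_iff_false, iff_false,
      not_and, not_not]
    exact fun h => Ioo_subset_Icc_self h
  · rw [← closure_Ioo hab.ne]
    refine closure_minimal (fun E hE => ?_) Measure.isClosed_support
    rw [Measure.mem_support_iff_forall]
    intro U hU
    rw [pos_iff_ne_zero, law, Ne, withDensity_apply_eq_zero hm]
    have : {x | ENNReal.ofReal (lawDensity μ x) ≠ 0} = Ioo a b := by
      ext E
      simp only [mem_ofPred_eq, hpos]
    rw [this]
    exact (Measure.measure_pos_of_mem_nhds volume (inter_mem (isOpen_Ioo.mem_nhds hE) hU)).ne'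

end Law

/-! ### Expansion of an edge in central moments -/

lemma geom_remainder {D u : ℝ} (hD : D ≠ 0) (hu : D - u ≠ 0) :
    (D - u)⁻¹ - ∑ j ∈ Finset.range 6, D⁻¹ ^ (j + 1) * u ^ j = D⁻¹ ^ 6 * (D - u)⁻¹ * u ^ 6 := by
  have he : D⁻¹ * D = 1 := inv_mul_cancel₀ hD
  have hf : (D - u)⁻¹ * (D - u) = 1 := inv_mul_cancel₀ hu
  generalize D⁻¹ = e at he
  generalize (D - u)⁻¹ = f at hf
  simp only [Finset.sum_range_succ, Finset.sum_range_zero]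
  linear_combination (e + e ^ 2 * u + e ^ 3 * u ^ 2 + e ^ 4 * u ^ 3 + e ^ 5 * u ^ 4
    + e ^ 6 * u ^ 5) * hf - f * (1 + e * u + e ^ 2 * u ^ 2 + e ^ 3 * u ^ 3 + e ^ 4 * u ^ 4
    + e ^ 5 * u ^ 5) * he

/-- Here `e = (1 + x)⁻¹`. To leading order `1 + x + e` is `2 + x²` and `e³ k2` is `k2 - 3 x k2`;
completing the square, `x² - 3 x k2 = (x - 3/2 k2)² - 9/4 k2²`. The square is kept in the main term
because it has a sign. -/
lemma inv_power_expansion {x e : ℝ} (he : e * (1 + x) = 1) (hx : |x| ≤ 1 / 4)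
    {k2 k3 k4 k5 : ℝ} (hk2 : 0 ≤ k2) (hk4 : 0 ≤ k4) :
    |(1 + x + e + e ^ 3 * k2 + e ^ 4 * k3 + e ^ 5 * k4 + e ^ 6 * k5)
        - (2 + k2 + k3 + k4 - 9 / 4 * k2 ^ 2 + (x - 3 / 2 * k2) ^ 2)| ≤
      2 * |x| ^ 3 + 30 * k2 * x ^ 2 + 20 * |k3| * |x| + 30 * k4 * |x| + 6 * |k5| := by
  obtain ⟨hx1, hx2⟩ := abs_le.mp hx
  have he0 : 0 < e := by
    by_contra! h
    nlinarith
  have he1 : e ≤ 4 / 3 := by nlinarith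
  have h1 : 1 - e = x * e := by linear_combination -he
  have b1 : |x ^ 3 * e| ≤ 2 * |x| ^ 3 := by
    rw [abs_mul, abs_pow, abs_of_pos he0]
    nlinarith [pow_nonneg (abs_nonneg x) 3]
  have e2 : e ^ 2 ≤ 16 / 9 := by nlinarith
  have e3 : e ^ 3 ≤ 64 / 27 := by
    have := pow_le_pow_left₀ he0.le he1 3
    linarith
  have e4 : e ^ 4 ≤ 256 / 81 := by
    have := pow_le_pow_left₀ he0.le he1 4
    linarith
  have e6 : e ^ 6 ≤ 6 := by
    have := pow_le_pow_left₀ he0.le he1 6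
    linarith
  have b2 : |k2 * (x ^ 2 * (e * (3 + 2 * e + e ^ 2)))| ≤ 30 * k2 * x ^ 2 := by
    rw [abs_of_nonneg (by positivity)]
    have : e * (3 + 2 * e + e ^ 2) ≤ 30 := by nlinarith
    have h0 : 0 ≤ k2 * x ^ 2 := by positivity
    nlinarith
  have b3 : |k3 * (x * (e * (1 + e + e ^ 2 + e ^ 3)))| ≤ 20 * |k3| * |x| := by
    rw [abs_mul, abs_mul, abs_of_nonneg (by positivity : 0 ≤ e * (1 + e + e ^ 2 + e ^ 3))]
    have : e * (1 + e + e ^ 2 + e ^ 3) ≤ 20 := by nlinarith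
    have h0 : 0 ≤ |k3| * |x| := by positivity
    nlinarith
  have b4 : |k4 * (x * (e * (1 + e + e ^ 2 + e ^ 3 + e ^ 4)))| ≤ 30 * k4 * |x| := by
    rw [abs_mul, abs_mul, abs_of_nonneg hk4,
      abs_of_nonneg (by positivity : 0 ≤ e * (1 + e + e ^ 2 + e ^ 3 + e ^ 4))]
    have : e * (1 + e + e ^ 2 + e ^ 3 + e ^ 4) ≤ 30 := by nlinarith
    have h0 : 0 ≤ k4 * |x| := by positivity
    nlinarith
  have b5 : |k5 * e ^ 6| ≤ 6 * |k5| := by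
    rw [abs_mul, abs_of_nonneg (by positivity : 0 ≤ e ^ 6)]
    nlinarith [abs_nonneg k5]
  -- Every error is explicit through `1 - eʲ = x e (1 + ⋯ + eʲ⁻¹)`.
  have key : (1 + x + e + e ^ 3 * k2 + e ^ 4 * k3 + e ^ 5 * k4 + e ^ 6 * k5)
        - (2 + k2 + k3 + k4 - 9 / 4 * k2 ^ 2 + (x - 3 / 2 * k2) ^ 2) =
      -(x ^ 3 * e) + k2 * (x ^ 2 * (e * (3 + 2 * e + e ^ 2)))
        - k3 * (x * (e * (1 + e + e ^ 2 + e ^ 3)))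
        - k4 * (x * (e * (1 + e + e ^ 2 + e ^ 3 + e ^ 4))) + k5 * e ^ 6 := by
    have h2 : 1 - e ^ 2 = x * e * (1 + e) := by linear_combination (1 + e) * h1
    have h3 : 1 - e ^ 3 = x * e * (1 + e + e ^ 2) := by linear_combination (1 + e + e ^ 2) * h1
    have h4 : 1 - e ^ 4 = x * e * (1 + e + e ^ 2 + e ^ 3) := by
      linear_combination (1 + e + e ^ 2 + e ^ 3) * h1
    have h5 : 1 - e ^ 5 = x * e * (1 + e + e ^ 2 + e ^ 3 + e ^ 4) := by
      linear_combination (1 + e + e ^ 2 + e ^ 3 + e ^ 4) * h1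
    linear_combination (-1 + x - x ^ 2) * h1 + k2 * x * (h1 + h2 + h3) - k2 * h3 - k3 * h4 - k4 * h5
  rw [key]
  refine (abs_add_le _ _).trans (add_le_add ?_ b5)
  refine (abs_sub _ _).trans (add_le_add ?_ b4)
  refine (abs_sub _ _).trans (add_le_add ?_ b3)
  refine (abs_add_le _ _).trans (add_le_add ?_ b2)
  rwa [abs_neg]

/-- The error at the trial point `x = 3/2 k2`, where the square vanishes; `x` is then of order `r²`,
so all terms are small enough. -/
lemma expansion_error_upper {r k2 k3 k4 k5 : ℝ}
    (hk2 : 0 ≤ k2) (hk2r : k2 ≤ r ^ 2) (hk4 : 0 ≤ k4) (hk4r : k4 ≤ r ^ 4) (hk5 : 0 ≤ k5) :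
    2 * |3 / 2 * k2| ^ 3 + 30 * k2 * (3 / 2 * k2) ^ 2 + 20 * |k3| * |3 / 2 * k2|
      + 30 * k4 * |3 / 2 * k2| + 6 * k5 + 256 * r ^ 6 ≤
      3000 * (5 * r ^ 6 + k2 * |k3| + k5) := by
  have hk23 : k2 ^ 3 ≤ r ^ 6 := by
    calc k2 ^ 3 ≤ (r ^ 2) ^ 3 := by gcongr
      _ = r ^ 6 := by ring
  have hk24 : k2 * k4 ≤ r ^ 6 := by
    calc k2 * k4 ≤ r ^ 2 * r ^ 4 := by gcongr
      _ = r ^ 6 := by ring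
  have hk230 : 0 ≤ k2 * |k3| := by positivity
  rw [abs_of_nonneg (by positivity : 0 ≤ 3 / 2 * k2)]
  have hr6 : 0 ≤ r ^ 6 := by positivity
  linarith

/-- At the true minimizer only `|x| ≤ r` is known, and a term such as `k3 x` could be of size `r⁴`.
The negative square absorbs the excess: substitute `|x| ≤ |x - 3/2 k2| + 3/2 k2` and apply Young's
inequality. -/
lemma expansion_error_lower {r x k2 k3 k4 k5 : ℝ} (hr0 : 0 ≤ r) (hr : r ≤ 1 / 64)
    (hx : |x| ≤ r) (hk2 : 0 ≤ k2) (hk2r : k2 ≤ r ^ 2) (hk3r : |k3| ≤ r ^ 3) (hk4 : 0 ≤ k4)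
    (hk4r : k4 ≤ r ^ 4) (hk5 : 0 ≤ k5) :
    2 * |x| ^ 3 + 30 * k2 * x ^ 2 + 20 * |k3| * |x| + 30 * k4 * |x| + 6 * k5 + 256 * r ^ 6
      - (x - 3 / 2 * k2) ^ 2 ≤ 3000 * (5 * r ^ 6 + k2 * |k3| + k5) := by
  have hr6 : 0 ≤ r ^ 6 := by positivity
  have hr2 : r ^ 2 ≤ 1 / 4096 := by nlinarith
  have hk23 : k2 ^ 3 ≤ r ^ 6 := by
    calc k2 ^ 3 ≤ (r ^ 2) ^ 3 := by gcongr
      _ = r ^ 6 := by ring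
  have hk24 : k2 * k4 ≤ r ^ 6 := by
    calc k2 * k4 ≤ r ^ 2 * r ^ 4 := by gcongr
      _ = r ^ 6 := by ring
  have hk33 : |k3| ^ 2 ≤ r ^ 6 := by
    calc |k3| ^ 2 ≤ (r ^ 3) ^ 2 := by gcongr
      _ = r ^ 6 := by ring
  have hk44 : k4 ^ 2 ≤ r ^ 6 := by
    calc k4 ^ 2 ≤ (r ^ 4) ^ 2 := by gcongr
      _ = r ^ 2 * r ^ 6 := by ring
      _ ≤ 1 * r ^ 6 := by gcongr; linarith
      _ = r ^ 6 := one_mul _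
  have hb : 0 ≤ 3 / 2 * k2 := by positivity
  set y := x - 3 / 2 * k2 with hy
  have hxy : |x| ≤ |y| + 3 / 2 * k2 := by
    have : x = y + 3 / 2 * k2 := by rw [hy]; ring
    calc |x| = |y + 3 / 2 * k2| := by rw [← this]
      _ ≤ |y| + |3 / 2 * k2| := abs_add_le _ _
      _ = |y| + 3 / 2 * k2 := by rw [abs_of_nonneg hb]
  have hyr : |y| ≤ 2 * r := by
    have h1 : |y| ≤ |x| + |3 / 2 * k2| := abs_sub _ _
    rw [abs_of_nonneg hb] at h1
    nlinarith
  have hY : 0 ≤ |y| := abs_nonneg y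
  have hX : 0 ≤ |x| := abs_nonneg x
  have hκ : 0 ≤ |k3| := abs_nonneg k3
  rw [← sq_abs y, ← sq_abs x]
  clear hy
  clear_value y
  generalize |y| = Y at *
  generalize |x| = X at *
  generalize |k3| = κ at *
  -- The four bounds spend `1/4 + 1/4 + 1/8 + 1/8 = 3/4` of the available `Y²`.
  have a1 : 2 * X ^ 3 ≤ Y ^ 2 / 4 + 27 * k2 ^ 3 := by
    have h2 : X ^ 3 ≤ (Y + 3 / 2 * k2) ^ 3 := by gcongr
    have h3 : (Y + 3 / 2 * k2) ^ 3 ≤ 4 * (Y ^ 3 + (3 / 2 * k2) ^ 3) := by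
      generalize 3 / 2 * k2 = b at hb
      nlinarith [mul_nonneg (add_nonneg hY hb) (sq_nonneg (Y - b))]
    have h4 : Y ^ 3 ≤ Y ^ 2 * (1 / 32) := by
      rw [pow_succ]
      gcongr
      linarith
    linarith
  have a2 : 30 * k2 * X ^ 2 ≤ Y ^ 2 / 4 + 135 * k2 ^ 3 := by
    have h3 : X ^ 2 ≤ 2 * (Y ^ 2 + (3 / 2 * k2) ^ 2) := by
      have : X ^ 2 ≤ (Y + 3 / 2 * k2) ^ 2 := by gcongr
      linarith [sq_nonneg (Y - 3 / 2 * k2)]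
    have h4 : k2 * X ^ 2 ≤ k2 * (2 * (Y ^ 2 + (3 / 2 * k2) ^ 2)) := by gcongr
    have h5 : k2 * Y ^ 2 ≤ 1 / 4096 * Y ^ 2 := by gcongr; linarith
    linarith [sq_nonneg Y]
  have a3 : 20 * κ * X ≤ Y ^ 2 / 8 + 800 * κ ^ 2 + 30 * (k2 * κ) := by
    have : 20 * κ * X ≤ 20 * κ * (Y + 3 / 2 * k2) := by gcongr
    linarith [sq_nonneg (Y - 80 * κ)]
  have a4 : 30 * k4 * X ≤ Y ^ 2 / 8 + 1800 * k4 ^ 2 + 45 * (k2 * k4) := by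
    have : 30 * k4 * X ≤ 30 * k4 * (Y + 3 / 2 * k2) := by gcongr
    linarith [sq_nonneg (Y - 120 * k4)]
  have h230 : 0 ≤ k2 * κ := by positivity
  linarith [sq_nonneg Y]

section Expansion

variable {μ : Measure ℝ} [IsProbabilityMeasure μ] {m r : ℝ}

lemma integrable_pow_sub (h : ∀ v ∈ μ.support, |v - m| ≤ r) (j : ℕ) :
    Integrable (fun v => (v - m) ^ j) μ := by
  refine Integrable.of_bound (C := r ^ j) (by fun_prop) ?_
  filter_upwards [Measure.support_mem_ae] with v hv
  rw [Real.norm_eq_abs, abs_pow]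
  exact pow_le_pow_left₀ (abs_nonneg _) (h v hv) j

lemma abs_integral_pow_sub_le (h : ∀ v ∈ μ.support, |v - m| ≤ r) (j : ℕ) :
    |∫ v, (v - m) ^ j ∂μ| ≤ r ^ j := by
  have := norm_integral_le_of_norm_le_const (μ := μ) (C := r ^ j) (f := fun v => (v - m) ^ j) ?_
  · simpa using this
  filter_upwards [Measure.support_mem_ae] with v hv
  rw [Real.norm_eq_abs, abs_pow]
  exact pow_le_pow_left₀ (abs_nonneg _) (h v hv) j

lemma edgeFun_expansion (hm : ∫ v, v ∂μ = m) (hr : r ≤ 1 / 64)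
    (h : ∀ v ∈ μ.support, |v - m| ≤ r) {x : ℝ} (hx : |x| ≤ 1 / 4) :
    |edgeFun μ (m + 1 + x) - (m + (2 + (∫ v, (v - m) ^ 2 ∂μ) + (∫ v, (v - m) ^ 3 ∂μ)
        + (∫ v, (v - m) ^ 4 ∂μ) - 9 / 4 * (∫ v, (v - m) ^ 2 ∂μ) ^ 2
        + (x - 3 / 2 * ∫ v, (v - m) ^ 2 ∂μ) ^ 2))| ≤
      2 * |x| ^ 3 + 30 * (∫ v, (v - m) ^ 2 ∂μ) * x ^ 2 + 20 * |∫ v, (v - m) ^ 3 ∂μ| * |x|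
        + 30 * (∫ v, (v - m) ^ 4 ∂μ) * |x| + 6 * |∫ v, (v - m) ^ 5 ∂μ| + 256 * r ^ 6 := by
  obtain ⟨hx1, hx2⟩ := abs_le.mp hx
  set D := 1 + x with hD
  have hD0 : 3 / 4 ≤ D := by linarith
  have hDinv : D⁻¹ ≤ 4 / 3 := by
    rw [inv_le_comm₀ (by linarith) (by norm_num)]
    linarith
  have hDp : 0 < D := by linarith
  have hgap : ∀ v ∈ μ.support, 1 / 2 ≤ D - (v - m) := fun v hv => by
    have := (abs_le.mp (h v hv)).2
    linarith
  have hsub : ∀ v, m + 1 + x - v = D - (v - m) := fun v => by rw [hD]; ring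
  have hint : Integrable (fun v => (D - (v - m))⁻¹) μ := by
    refine Integrable.of_bound (C := 2) (by fun_prop) ?_
    filter_upwards [Measure.support_mem_ae] with v hv
    have := hgap v hv
    rw [Real.norm_of_nonneg (inv_nonneg.mpr (by linarith)), inv_le_comm₀ (by linarith) (by norm_num)]
    linarith
  have hintp : ∀ j ∈ Finset.range 6, Integrable (fun v => D⁻¹ ^ (j + 1) * (v - m) ^ j) μ :=
    fun j _ => (integrable_pow_sub h j).const_mul _
  have h1 : |(∫ v, (D - (v - m))⁻¹ ∂μ) -
      ∑ j ∈ Finset.range 6, D⁻¹ ^ (j + 1) * ∫ v, (v - m) ^ j ∂μ| ≤ 256 * r ^ 6 := by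
    simp only [← integral_const_mul]
    rw [← integral_finsetSum _ hintp, ← integral_sub hint (integrable_finsetSum _ hintp)]
    have := norm_integral_le_of_norm_le_const (μ := μ) (C := 256 * r ^ 6)
      (f := fun v => (D - (v - m))⁻¹ - ∑ j ∈ Finset.range 6, D⁻¹ ^ (j + 1) * (v - m) ^ j) ?_
    · simpa using this
    filter_upwards [Measure.support_mem_ae] with v hv
    have h2 := hgap v hv
    have h3 : |v - m| ^ 6 ≤ r ^ 6 := pow_le_pow_left₀ (abs_nonneg _) (h v hv) 6
    have h5 : (D - (v - m))⁻¹ ≤ 2 := by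
      rw [inv_le_comm₀ (by linarith) (by norm_num)]
      linarith
    have h6 : D⁻¹ ^ 6 ≤ 128 := by
      have := pow_le_pow_left₀ (inv_nonneg.mpr hDp.le) hDinv 6
      linarith
    have h7 : 0 ≤ (D - (v - m))⁻¹ := inv_nonneg.mpr (by linarith)
    rw [geom_remainder hDp.ne' (by linarith), Real.norm_eq_abs, abs_mul, abs_pow,
      abs_of_nonneg (by positivity)]
    have h8 : D⁻¹ ^ 6 * (D - (v - m))⁻¹ ≤ 128 * 2 := by gcongr
    calc D⁻¹ ^ 6 * (D - (v - m))⁻¹ * |v - m| ^ 6 ≤ (128 * 2) * r ^ 6 := by gcongr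
      _ = 256 * r ^ 6 := by ring
  have hk1 : ∫ v, (v - m) ^ 1 ∂μ = 0 := by
    have hid : Integrable (fun v : ℝ => v) μ := by
      have := (integrable_pow_sub h 1).add (integrable_const m)
      refine this.congr (Eventually.of_forall fun v => ?_)
      simp
    simp only [pow_one]
    rw [integral_sub hid (integrable_const _), hm]
    simp
  have h2 := inv_power_expansion (e := D⁻¹) (x := x) (inv_mul_cancel₀ hDp.ne') hx
    (k2 := ∫ v, (v - m) ^ 2 ∂μ) (k3 := ∫ v, (v - m) ^ 3 ∂μ) (k4 := ∫ v, (v - m) ^ 4 ∂μ)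
    (k5 := ∫ v, (v - m) ^ 5 ∂μ) (integral_nonneg fun v => by positivity)
    (integral_nonneg fun v => by positivity)
  simp only [Finset.sum_range_succ, Finset.sum_range_zero, hk1, pow_zero, integral_const,
    probReal_univ, smul_eq_mul, mul_zero, mul_one, zero_add, add_zero] at h1
  rw [edgeFun]
  simp only [hsub]
  refine le_trans (le_of_eq ?_) ((abs_add_le _ _).trans ((add_le_add h2 h1).trans (le_of_eq ?_)))
  · congr 1
    ring
  · ring

/-- Expansion of the right edge in the central moments. -/
lemma IsRightEdge.expansion (hm : ∫ v, v ∂μ = m) (hr : r ≤ 1 / 64)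
    (h : ∀ v ∈ μ.support, |v - m| ≤ r) {w : ℝ} (hw : IsRightEdge μ w) :
    |edgeFun μ w - (2 + m + (∫ v, (v - m) ^ 2 ∂μ) + (∫ v, (v - m) ^ 3 ∂μ)
        + ((∫ v, (v - m) ^ 4 ∂μ) - 9 * (∫ v, (v - m) ^ 2 ∂μ) ^ 2 / 4))| ≤
      3000 * (5 * r ^ 6 + (∫ v, (v - m) ^ 2 ∂μ) * |∫ v, (v - m) ^ 3 ∂μ|
        + |∫ v, (v - m) ^ 5 ∂μ|) := by
  have hr0 : 0 ≤ r := by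
    obtain ⟨v, hv⟩ := support_nonempty μ
    exact (abs_nonneg _).trans (h v hv)
  have hexp := fun {x : ℝ} hx => edgeFun_expansion (x := x) hm hr h hx
  have hk2 : 0 ≤ ∫ v, (v - m) ^ 2 ∂μ := integral_nonneg fun v => by positivity
  have hk4 : 0 ≤ ∫ v, (v - m) ^ 4 ∂μ := integral_nonneg fun v => by positivity
  have hk2r := (le_abs_self _).trans (abs_integral_pow_sub_le h 2)
  have hk3r := abs_integral_pow_sub_le h 3
  have hk4r := (le_abs_self _).trans (abs_integral_pow_sub_le h 4)
  -- location of the critical point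
  have hup : w ≤ m + 1 + r := by
    have hlt : ∀ v ∈ μ.support, v < m + 1 + r := fun v hv => by
      have := (abs_le.mp (h v hv)).2
      linarith
    refine hw.le _ hlt ?_
    have h2 : invSq μ ((m + 1 + r : ℝ) : ℂ) ≤ ∫ _, (1 : ℝ) ∂μ := by
      refine integral_mono_ae (integrable_invSq (ofReal_mem_offSupport hlt))
        (integrable_const _) ?_
      filter_upwards [Measure.support_mem_ae] with v hv
      rw [norm_sq_ofReal_sub]
      have := (abs_le.mp (h v hv)).2
      exact inv_le_one_of_one_le₀ (by nlinarith)
    simpa using h2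
  -- Otherwise every `w - v` would be at most `c < 1`, making `invSq μ w` exceed `1`.
  have hlow : m + 1 - r ≤ w := by
    by_contra! hlt
    set c := w - m + r with hc
    have hc1 : c < 1 := by linarith
    have hcv : ∀ v ∈ μ.support, w - v ≤ c := fun v hv => by
      have := (abs_le.mp (h v hv)).1
      linarith
    have hc0 : 0 < c := by
      obtain ⟨v, hv⟩ := support_nonempty μ
      linarith [hcv v hv, hw.lt v hv]
    have h2 : ∫ _, (c ^ 2)⁻¹ ∂μ ≤ invSq μ w := by
      refine integral_mono_ae (integrable_const _)
        (integrable_invSq (ofReal_mem_offSupport hw.lt)) ?_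
      filter_upwards [Measure.support_mem_ae] with v hv
      rw [norm_sq_ofReal_sub]
      have h3 := hcv v hv
      have h4 := hw.lt v hv
      exact inv_anti₀ (by nlinarith) (by nlinarith)
    rw [integral_const, probReal_univ, one_smul] at h2
    have h3 : 1 < (c ^ 2)⁻¹ := (one_lt_inv₀ (by positivity)).mpr (by nlinarith)
    linarith [hw.invSq_le]
  -- Minimality against the trial point bounds the edge from above; the expansion at `w` itself
  -- bounds it from below. No location of `w` finer than `|x| ≤ r` is needed.
  have hup2 := hw.edgeFun_le (m + 1 + 3 / 2 * ∫ v, (v - m) ^ 2 ∂μ) fun v hv => by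
    have := (abs_le.mp (h v hv)).2
    linarith
  have hr2 : r ^ 2 ≤ 1 / 4096 := by nlinarith
  have e1 := (abs_le.mp (hexp (x := 3 / 2 * ∫ v, (v - m) ^ 2 ∂μ)
    (by rw [abs_of_nonneg (by positivity)]; linarith))).2
  obtain ⟨x, hx⟩ : ∃ x, w = m + 1 + x := ⟨w - m - 1, by ring⟩
  have hxr : |x| ≤ r := abs_le.mpr ⟨by linarith, by linarith⟩
  have e2 := (abs_le.mp (hexp (x := x) (by linarith))).1
  rw [← hx] at e2
  have hk5 := abs_nonneg (∫ v, (v - m) ^ 5 ∂μ)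
  have b1 := expansion_error_upper hk2 hk2r hk4 hk4r hk5 (k3 := ∫ v, (v - m) ^ 3 ∂μ)
  have b2 := expansion_error_lower hr0 hr hxr hk2 hk2r hk3r hk4 hk4r hk5
  rw [sub_self] at e1
  rw [abs_le]
  constructor <;> linarith

end Expansion

/-! ### Moments, support and convolution form of the refined measure -/

lemma moment_id (k : ℕ) (μ : Measure ℝ) : moment id k μ = ∫ v, v ^ k ∂μ := rfl

lemma centralMoment_id (k : ℕ) (μ : Measure ℝ) :
    centralMoment id k μ = ∫ v, (v - ∫ u, u ∂μ) ^ k ∂μ := rfl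

lemma hull_eq_Icc {μ : Measure ℝ} {a b : ℝ} (ha : IsLeast μ.support a)
    (hb : IsGreatest μ.support b) : hull μ = Icc a b := by
  refine Subset.antisymm (convexHull_min (fun v hv => ⟨ha.2 hv, hb.2 hv⟩) (convex_Icc a b)) ?_
  have hconv : (hull μ).OrdConnected := (convex_convexHull ℝ _).ordConnected
  exact hconv.out (support_subset_hull μ ha.1) (support_subset_hull μ hb.1)

lemma isCompact_hull {μ : Measure ℝ} [IsProbabilityMeasure μ] (h : IsCompact μ.support) :
    IsCompact (hull μ) := by
  obtain ⟨a, ha⟩ := h.exists_isLeast (support_nonempty μ)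
  obtain ⟨b, hb⟩ := h.exists_isGreatest (support_nonempty μ)
  rw [hull_eq_Icc ha hb]
  exact isCompact_Icc

section Refined

variable {μ : Measure ℝ} {l s q : ℝ}

lemma lintegral_refined {f : ℝ → ℝ≥0∞} (hf : Measurable f) :
    ∫⁻ v, f v ∂(refined μ l s q) = 2⁻¹ * (∫⁻ v, f (l * v - Real.sqrt s / q) ∂μ
      + ∫⁻ v, f (l * v + Real.sqrt s / q) ∂μ) := by
  rw [refined, lintegral_smul_measure, lintegral_add_measure, lintegral_map hf (by fun_prop),
    lintegral_map hf (by fun_prop), smul_eq_mul]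

lemma integral_refined {E : Type*} [NormedAddCommGroup E] [NormedSpace ℝ E] {f : ℝ → E}
    (hf : StronglyMeasurable f)
    (h1 : Integrable (fun v => f (l * v - Real.sqrt s / q)) μ)
    (h2 : Integrable (fun v => f (l * v + Real.sqrt s / q)) μ) :
    ∫ v, f v ∂(refined μ l s q) = (2 : ℝ)⁻¹ • ∫ v, (f (l * v - Real.sqrt s / q)
      + f (l * v + Real.sqrt s / q)) ∂μ := by
  rw [refined, integral_smul_measure, integral_add_measure, integral_map (by fun_prop)
    hf.aestronglyMeasurable, integral_map (by fun_prop) hf.aestronglyMeasurable,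
    integral_add h1 h2]
  · simp
  · exact (integrable_map_measure hf.aestronglyMeasurable (by fun_prop)).mpr h1
  · exact (integrable_map_measure hf.aestronglyMeasurable (by fun_prop)).mpr h2

lemma isProbabilityMeasure_refined [IsProbabilityMeasure μ] :
    IsProbabilityMeasure (refined μ l s q) := by
  refine ⟨?_⟩
  have := lintegral_refined (μ := μ) (l := l) (s := s) (q := q) (f := fun _ => 1) measurable_const
  simp only [lintegral_const, measure_univ, one_mul] at this
  rw [this, one_add_one_eq_two]
  exact ENNReal.inv_mul_cancel (by norm_num) (by norm_num)

lemma refined_eq_conv [IsProbabilityMeasure μ] : refined μ l s q =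
    (μ.map (fun v => l * v)).conv ((2 : ℝ≥0∞)⁻¹ •
      (Measure.dirac (Real.sqrt s / q) + Measure.dirac (-(Real.sqrt s / q)))) := by
  refine Measure.ext_of_lintegral _ fun f hf => ?_
  have hsf : SFinite ((2 : ℝ≥0∞)⁻¹ •
      (Measure.dirac (Real.sqrt s / q) + Measure.dirac (-(Real.sqrt s / q)))) := inferInstance
  rw [lintegral_refined hf, Measure.lintegral_conv hf]
  have h1 : ∀ x : ℝ, ∫⁻ y, f (x + y) ∂((2 : ℝ≥0∞)⁻¹ •
      (Measure.dirac (Real.sqrt s / q) + Measure.dirac (-(Real.sqrt s / q)))) =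
      2⁻¹ * (f (x - Real.sqrt s / q) + f (x + Real.sqrt s / q)) := by
    intro x
    rw [lintegral_smul_measure, lintegral_add_measure, lintegral_dirac, lintegral_dirac,
      smul_eq_mul, add_comm, ← sub_eq_add_neg]
  simp only [h1]
  rw [lintegral_map (by fun_prop) (by fun_prop), lintegral_const_mul _ (by fun_prop),
    lintegral_add_left (by fun_prop)]

lemma support_refined_subset {A B : ℝ} (hl : 0 ≤ l) (hd : 0 ≤ Real.sqrt s / q)
    (h : μ.support ⊆ Icc A B) :
    (refined μ l s q).support ⊆ Icc (l * A - Real.sqrt s / q) (l * B + Real.sqrt s / q) := by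
  refine Measure.support_subset_of_isClosed isClosed_Icc ?_
  have hae : ∀ᵐ v ∂μ, v ∈ Icc A B := mem_of_superset Measure.support_mem_ae h
  rw [mem_ae_iff, refined, Measure.smul_apply, Measure.add_apply,
    Measure.map_apply (by fun_prop) measurableSet_Icc.compl,
    Measure.map_apply (by fun_prop) measurableSet_Icc.compl]
  have h1 : ∀ f : ℝ → ℝ, (∀ v ∈ Icc A B, f v ∈
      Icc (l * A - Real.sqrt s / q) (l * B + Real.sqrt s / q)) →
      μ (f ⁻¹' (Icc (l * A - Real.sqrt s / q) (l * B + Real.sqrt s / q))ᶜ) = 0 := by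
    intro f hf
    rw [preimage_compl]
    refine mem_ae_iff.mp (mem_of_superset hae fun v hv => hf v hv)
  rw [h1, h1]
  · simp
  · rintro v ⟨hv1, hv2⟩
    have := mul_le_mul_of_nonneg_left hv1 hl
    have := mul_le_mul_of_nonneg_left hv2 hl
    constructor <;> linarith
  · rintro v ⟨hv1, hv2⟩
    have := mul_le_mul_of_nonneg_left hv1 hl
    have := mul_le_mul_of_nonneg_left hv2 hl
    constructor <;> linarith

lemma hull_refined_subset {A B : ℝ} (hl : 0 ≤ l) (hd : 0 ≤ Real.sqrt s / q)
    (h : μ.support ⊆ Icc A B) :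
    hull (refined μ l s q) ⊆ Icc (l * A - Real.sqrt s / q) (l * B + Real.sqrt s / q) :=
  convexHull_min (support_refined_subset hl hd h) (convex_Icc _ _)

lemma isCompact_support_refined {A B : ℝ} (hl : 0 ≤ l) (hd : 0 ≤ Real.sqrt s / q)
    (h : μ.support ⊆ Icc A B) : IsCompact (refined μ l s q).support :=
  isCompact_Icc.of_isClosed_subset Measure.isClosed_support (support_refined_subset hl hd h)

variable [IsProbabilityMeasure μ] {K : ℝ}

lemma integrable_pow_center (h : ∀ v ∈ μ.support, |v| ≤ K) (m : ℝ) (j : ℕ) :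
    Integrable (fun v => (v - m) ^ j) μ :=
  integrable_pow_sub (r := K + |m|) (fun v hv => (abs_sub _ _).trans
    (add_le_add (h v hv) le_rfl)) j

lemma integral_pow_refined (h : ∀ v ∈ μ.support, |v| ≤ K) (m : ℝ) (k : ℕ) :
    ∫ v, (v - l * m) ^ k ∂(refined μ l s q) =
      2⁻¹ * ∫ v, ((l * (v - m) - Real.sqrt s / q) ^ k + (l * (v - m) + Real.sqrt s / q) ^ k) ∂μ := by
  have hi : ∀ c : ℝ, Integrable (fun v => (l * v + c - l * m) ^ k) μ := by
    intro c
    refine Integrable.of_bound (C := (|l| * K + |c| + |l * m|) ^ k) (by fun_prop) ?_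
    filter_upwards [Measure.support_mem_ae] with v hv
    rw [Real.norm_eq_abs, abs_pow]
    refine pow_le_pow_left₀ (abs_nonneg _) ?_ k
    refine (abs_sub _ _).trans (add_le_add ((abs_add_le _ _).trans (add_le_add ?_ le_rfl)) le_rfl)
    rw [abs_mul]
    exact mul_le_mul_of_nonneg_left (h v hv) (abs_nonneg _)
  rw [integral_refined (f := fun v => (v - l * m) ^ k)
    (Continuous.stronglyMeasurable (by fun_prop)) (by simpa [sub_eq_add_neg] using hi (-(Real.sqrt s / q)))
    (hi _), smul_eq_mul]
  congr 1
  refine integral_congr_ae (Eventually.of_forall fun v => ?_)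
  simp only
  congr 2 <;> ring

lemma integral_refined_one (h : ∀ v ∈ μ.support, |v| ≤ K) (m : ℝ) :
    ∫ v, (v - l * m) ^ 1 ∂(refined μ l s q) = l * ∫ v, (v - m) ^ 1 ∂μ := by
  rw [integral_pow_refined h, ← integral_const_mul, ← integral_const_mul]
  refine integral_congr_ae (Eventually.of_forall fun v => ?_)
  simp only
  ring

lemma integral_refined_two (hs : 0 ≤ s) (h : ∀ v ∈ μ.support, |v| ≤ K) (m : ℝ) :
    ∫ v, (v - l * m) ^ 2 ∂(refined μ l s q) = l ^ 2 * ∫ v, (v - m) ^ 2 ∂μ + s / q ^ 2 := by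
  have hi := integrable_pow_center h m
  have hd : (Real.sqrt s / q) ^ 2 = s / q ^ 2 := by rw [div_pow, Real.sq_sqrt hs]
  rw [integral_pow_refined h, ← hd]
  generalize Real.sqrt s / q = d
  have h1 : ∀ v, (l * (v - m) - d) ^ 2 + (l * (v - m) + d) ^ 2 =
      2 * l ^ 2 * (v - m) ^ 2 + 2 * d ^ 2 := fun v => by ring
  simp only [h1]
  rw [integral_add ((hi 2).const_mul _) (integrable_const _), integral_const_mul, integral_const,
    probReal_univ, one_smul]
  ring

lemma integral_refined_three (hs : 0 ≤ s) (h : ∀ v ∈ μ.support, |v| ≤ K) (m : ℝ) :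
    ∫ v, (v - l * m) ^ 3 ∂(refined μ l s q) =
      l ^ 3 * ∫ v, (v - m) ^ 3 ∂μ + 3 * s * l / q ^ 2 * ∫ v, (v - m) ^ 1 ∂μ := by
  have hi := integrable_pow_center h m
  have hd : (Real.sqrt s / q) ^ 2 = s / q ^ 2 := by rw [div_pow, Real.sq_sqrt hs]
  have hd' : 3 * s * l / q ^ 2 = 3 * l * (Real.sqrt s / q) ^ 2 := by rw [hd]; ring
  rw [integral_pow_refined h, hd']
  generalize Real.sqrt s / q = d
  have h1 : ∀ v, (l * (v - m) - d) ^ 3 + (l * (v - m) + d) ^ 3 =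
      2 * l ^ 3 * (v - m) ^ 3 + 6 * l * d ^ 2 * (v - m) ^ 1 := fun v => by ring
  simp only [h1]
  rw [integral_add ((hi 3).const_mul _) ((hi 1).const_mul _), integral_const_mul,
    integral_const_mul]
  ring

lemma integral_refined_four (hs : 0 ≤ s) (h : ∀ v ∈ μ.support, |v| ≤ K) (m : ℝ) :
    ∫ v, (v - l * m) ^ 4 ∂(refined μ l s q) =
      l ^ 4 * ∫ v, (v - m) ^ 4 ∂μ + 6 * s * l ^ 2 / q ^ 2 * ∫ v, (v - m) ^ 2 ∂μ
        + s ^ 2 / q ^ 4 := by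
  have hi := integrable_pow_center h m
  have hd : (Real.sqrt s / q) ^ 2 = s / q ^ 2 := by rw [div_pow, Real.sq_sqrt hs]
  have hd' : 6 * s * l ^ 2 / q ^ 2 = 6 * l ^ 2 * (Real.sqrt s / q) ^ 2 := by rw [hd]; ring
  have hd4 : s ^ 2 / q ^ 4 = (Real.sqrt s / q) ^ 4 := by
    rw [show 4 = 2 * 2 from rfl, pow_mul (Real.sqrt s / q), hd, div_pow, ← pow_mul]
  rw [integral_pow_refined h, hd', hd4]
  generalize Real.sqrt s / q = d
  have h1 : ∀ v, (l * (v - m) - d) ^ 4 + (l * (v - m) + d) ^ 4 =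
      2 * l ^ 4 * (v - m) ^ 4 + 12 * l ^ 2 * d ^ 2 * (v - m) ^ 2 + 2 * d ^ 4 := fun v => by ring
  simp only [h1]
  have h2 : Integrable (fun v => 2 * l ^ 4 * (v - m) ^ 4 + 12 * l ^ 2 * d ^ 2 * (v - m) ^ 2) μ :=
    ((hi 4).const_mul _).add ((hi 2).const_mul _)
  rw [integral_add h2 (integrable_const _),
    integral_add ((hi 4).const_mul _) ((hi 2).const_mul _), integral_const_mul,
    integral_const_mul, integral_const, probReal_univ, one_smul]
  ring

/-- Needed only in the error. When `m` is the mean the last term drops, leaving `λ⁵` and `λ³ q⁻²`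
times the third central moment: the shape of `edgeError`. -/
lemma integral_refined_five (hs : 0 ≤ s) (h : ∀ v ∈ μ.support, |v| ≤ K) (m : ℝ) :
    ∫ v, (v - l * m) ^ 5 ∂(refined μ l s q) =
      l ^ 5 * ∫ v, (v - m) ^ 5 ∂μ + 10 * l ^ 3 * (s / q ^ 2) * ∫ v, (v - m) ^ 3 ∂μ
        + 5 * l * (s / q ^ 2) ^ 2 * ∫ v, (v - m) ^ 1 ∂μ := by
  have hi := integrable_pow_center h m
  have hd : (Real.sqrt s / q) ^ 2 = s / q ^ 2 := by rw [div_pow, Real.sq_sqrt hs]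
  rw [integral_pow_refined h, ← hd]
  generalize Real.sqrt s / q = d
  have h1 : ∀ v, (l * (v - m) - d) ^ 5 + (l * (v - m) + d) ^ 5 =
      2 * l ^ 5 * (v - m) ^ 5 + 20 * l ^ 3 * d ^ 2 * (v - m) ^ 3
        + 10 * l * d ^ 4 * (v - m) ^ 1 := fun v => by ring
  simp only [h1]
  have h2 : Integrable (fun v => 2 * l ^ 5 * (v - m) ^ 5 + 20 * l ^ 3 * d ^ 2 * (v - m) ^ 3) μ :=
    ((hi 5).const_mul _).add ((hi 3).const_mul _)
  rw [integral_add h2 ((hi 1).const_mul _),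
    integral_add ((hi 5).const_mul _) ((hi 3).const_mul _), integral_const_mul,
    integral_const_mul, integral_const_mul]
  ring

lemma integral_id_refined (h : ∀ v ∈ μ.support, |v| ≤ K) :
    ∫ v, v ∂(refined μ l s q) = l * ∫ v, v ∂μ := by
  simpa using integral_refined_one (l := l) (s := s) (q := q) h 0

lemma refinedMeasureProperties {A B ϖ : ℝ} (hl : 0 ≤ l) (hs : 0 ≤ s) (hq : 0 < q)
    (h : μ.support ⊆ Icc A B) (hst : ENNReal.ofReal (1 + ϖ) ≤ invSqInf (refined μ l s q)) :
    RefinedMeasureProperties μ l s q ϖ := by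
  have hd : 0 ≤ Real.sqrt s / q := by positivity
  have hK : ∀ v ∈ μ.support, |v| ≤ max |A| |B| := fun v hv =>
    abs_le_max_abs_abs (h hv).1 (h hv).2
  have hprob := isProbabilityMeasure_refined (μ := μ) (l := l) (s := s) (q := q)
  have m1 : moment id 1 (refined μ l s q) = l * moment id 1 μ := by
    simpa only [moment_id, mul_zero, sub_zero] using
      integral_refined_one (l := l) (s := s) (q := q) hK 0
  have m3 : moment id 3 (refined μ l s q) =
      l ^ 3 * moment id 3 μ + 3 * s * l / q ^ 2 * moment id 1 μ := by
    simpa only [moment_id, mul_zero, sub_zero] using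
      integral_refined_three (l := l) (s := s) (q := q) hs hK 0
  refine ⟨hprob, refined_eq_conv, isCompact_hull (isCompact_support_refined hl hd h), ?_, hst, m1, ?_,
    m3, ?_, fun h0 => by rw [m1, h0, mul_zero], fun h0 => by rw [m3, h0, mul_zero, add_zero]⟩
  · exact measure_mono_null (compl_subset_compl.mpr (support_subset_hull _))
      Measure.measure_compl_support
  · simpa only [moment_id, mul_zero, sub_zero] using
      integral_refined_two (l := l) (s := s) (q := q) hs hK 0
  · simpa only [moment_id, mul_zero, sub_zero] using
      integral_refined_four (l := l) (s := s) (q := q) hs hK 0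

end Refined

lemma stable_refined {μ : Measure ℝ} {l s q A B ϖ : ℝ} (hl : 0 ≤ l) (hd : 0 ≤ Real.sqrt s / q)
    (h : μ.support ⊆ Icc A B) (hϖ : 0 < ϖ)
    (hst : ENNReal.ofReal (1 + ϖ) ≤ invSqInf (refined μ l s q)) : Stable (refined μ l s q) := by
  refine ⟨isCompact_support_refined hl hd h, fun x hx => ?_⟩
  refine lt_of_lt_of_le ?_ (hst.trans (iInf₂_le x hx))
  rw [ENNReal.one_lt_ofReal]
  linarith

/-! ### The conclusion for one base measure, given stability -/

section Law

variable {μ : Measure ℝ} [IsProbabilityMeasure μ] {l s q : ℝ}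

lemma integrable_refined_kernel {w : ℂ} (hw : 0 < w.im) (c : ℝ) :
    Integrable (fun v : ℝ => (((l * v + c : ℝ) : ℂ) - w)⁻¹) μ := by
  refine Integrable.of_bound (C := w.im⁻¹) (by fun_prop) (Eventually.of_forall fun v => ?_)
  rw [norm_inv]
  refine inv_anti₀ hw ?_
  refine le_trans ?_ (Complex.abs_im_le_norm _)
  simp [abs_of_pos hw]

/-- The Stieltjes transform of the refined measure. -/
lemma stieltjes_refined (hs : 0 ≤ s) {w : ℂ} (hw : 0 < w.im) :
    stieltjes (refined μ l s q) w = ∫ v : ℝ, ((l : ℂ) * v - w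
      - (s : ℂ) / (q : ℂ) ^ 2 * (1 / ((l : ℂ) * v - w)))⁻¹ ∂μ := by
  have hd : (s : ℂ) / (q : ℂ) ^ 2 = ((Real.sqrt s / q : ℝ) : ℂ) ^ 2 := by
    have : (Real.sqrt s / q) ^ 2 = s / q ^ 2 := by rw [div_pow, Real.sq_sqrt hs]
    exact_mod_cast congrArg Complex.ofReal this.symm
  rw [hd, stieltjes_eq, integral_refined (f := fun v : ℝ => ((v : ℂ) - w)⁻¹)
    (Measurable.stronglyMeasurable (by fun_prop))
    (by simpa only [sub_eq_add_neg] using integrable_refined_kernel hw (-(Real.sqrt s / q)))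
    (integrable_refined_kernel hw _), ← integral_smul]
  generalize Real.sqrt s / q = d
  refine integral_congr_ae (Eventually.of_forall fun v => ?_)
  have hne : ∀ c : ℝ, (l : ℂ) * v + c - w ≠ 0 := by
    intro c h
    have := congrArg Complex.im h
    simp at this
    linarith
  have h0 : (l : ℂ) * v - w ≠ 0 := by simpa using hne 0
  have h1 : (l : ℂ) * v - w + d ≠ 0 := by
    have := hne d
    rwa [add_sub_right_comm] at this
  have h2 : (l : ℂ) * v - w - d ≠ 0 := by
    have := hne (-d)
    rwa [Complex.ofReal_neg, add_sub_right_comm, ← sub_eq_add_neg] at this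
  simp only [Complex.real_smul]
  push_cast
  -- With `u = l v - w` and `d = √s / q`, the average of `(u - d)⁻¹` and `(u + d)⁻¹` is `u / (u² -
  -- d²) = (u - d²/u)⁻¹`.
  rw [sub_right_comm, add_sub_right_comm]
  generalize (l : ℂ) * v - w = u at *
  have h3 : u ^ 2 - (d : ℂ) ^ 2 ≠ 0 := by
    have : u ^ 2 - (d : ℂ) ^ 2 = (u + d) * (u - d) := by ring
    rw [this]
    exact mul_ne_zero h1 h2
  have h4 : u - (d : ℂ) ^ 2 * (1 / u) = (u ^ 2 - d ^ 2) / u := by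
    field_simp
  rw [h4, inv_div]
  field_simp
  ring

lemma refinedLawProperties (hs : 0 ≤ s) (hst : Stable (refined μ l s q)) {w w' : ℝ}
    (hw : IsRightEdge (refined μ l s q) w)
    (hw' : IsRightEdge ((refined μ l s q).map Neg.neg) w') :
    RefinedLawProperties μ l s q (law (refined μ l s q))
      (-edgeFun ((refined μ l s q).map Neg.neg) w') (edgeFun (refined μ l s q) w) := by
  have hprob := isProbabilityMeasure_refined (μ := μ) (l := l) (s := s) (q := q)
  have hlt := hst.left_lt_right hw hw'
  have hzero := hst.density_eq_zero_iff hw hw'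
  refine ⟨hst.isFreeAdditiveConvolution, fun ρ' h => hst.eq_law h, ?_, ?_, hlt,
    hst.support_law hlt hzero, lawDensity (refined μ l s q), ?_, rfl, ?_⟩
  · intro z hz
    rw [hst.stieltjes_law hz]
    exact (hst.sub_mem_upper hz).1
  · intro z hz
    have h1 := hst.stieltjes_law hz
    have h2 := hst.omega_sub (le_of_lt hz)
    have h3 := (hst.invSq_omega_lt hz).1
    have h4 : omega (refined μ l s q) z = z + stieltjes (law (refined μ l s q)) z := by
      rw [h1]
      ring
    simp only [sub_sub _ z, ← h4]
    rw [h1, h2, stieltjes_refined hs h3]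
  · intro E
    have hc : ContinuousWithinAt (fun z : ℂ => (omega (refined μ l s q) z - z).im / Real.pi)
        {z | 0 ≤ z.im} (E : ℂ) := by
      have h1 : ContinuousOn (fun z : ℂ => omega (refined μ l s q) z - z) {z | 0 ≤ z.im} :=
        hst.continuousOn_omega.sub continuousOn_id
      exact ((Complex.continuous_im.comp_continuousOn h1).div_const Real.pi) E (by simp)
    have hlim : Tendsto (fun η : ℝ => (E : ℂ) + Complex.I * η) (𝓝[>] 0)
        (𝓝[{z | 0 ≤ z.im}] (E : ℂ)) := by
      rw [tendsto_nhdsWithin_iff]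
      constructor
      · have : Continuous fun η : ℝ => (E : ℂ) + Complex.I * η := by fun_prop
        have h1 := this.tendsto 0
        simp only [Complex.ofReal_zero, mul_zero, add_zero] at h1
        exact h1.mono_left nhdsWithin_le_nhds
      · filter_upwards [self_mem_nhdsWithin] with η hη
        simpa using le_of_lt (show (0 : ℝ) < η from hη)
    have h2 := hc.tendsto.comp hlim
    simp only [Complex.sub_im, Complex.ofReal_im, sub_zero] at h2
    refine h2.congr' ?_
    filter_upwards [self_mem_nhdsWithin] with η hη
    rw [hst.stieltjes_law (by simpa [upper] using hη)]
    simp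
  · intro E hE
    refine lt_of_le_of_ne (hst.density_nonneg E) fun h => ?_
    rcases (hzero E).mp h.symm with h1 | h1
    · exact absurd hE.1 (not_lt.mpr h1)
    · exact absurd hE.2 (not_lt.mpr h1)

/-- The constant of the edge expansion. -/
def edgeConst (K S : ℝ) : ℝ :=
  3000 * (10240 * (K ^ 6 + S ^ 3) + 2 * (2 * K) ^ 5 + 11 * S)

/-- The sixth power of the radius costs `λ⁶ ≤ λ⁵` and `q⁻⁶`. In `k2 |k3|` and `|k5|`, the parts
without `s / q²` are `O(λ⁵)`, and the others carry the factor `λ³ q⁻² |t|`, with total coefficient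
`S + 10 S`. -/
lemma edge_error_le {K S t a2 a5 k2 k3 k5 : ℝ} (hl : 0 ≤ l) (hl1 : l ≤ 1) (hs : 0 ≤ s)
    (hS : s ≤ S) (hK : 0 ≤ K) (ha2 : a2 ≤ (2 * K) ^ 2)
    (ha3 : |t| ≤ (2 * K) ^ 3) (ha5 : |a5| ≤ (2 * K) ^ 5)
    (hk2 : k2 = l ^ 2 * a2 + s / q ^ 2) (hk3 : k3 = l ^ 3 * t)
    (hk5 : k5 = l ^ 5 * a5 + 10 * l ^ 3 * (s / q ^ 2) * t) (hq : 0 < q) :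
    3000 * (5 * (2 * (l * K + Real.sqrt s / q)) ^ 6 + k2 * |k3| + |k5|) ≤
      edgeError l q (edgeConst K S) t := by
  have hd2 : (Real.sqrt s / q) ^ 2 = s / q ^ 2 := by rw [div_pow, Real.sq_sqrt hs]
  have hd0 : 0 ≤ Real.sqrt s / q := by positivity
  have hSq : s / q ^ 2 ≤ S * (1 / q ^ 2) := by
    rw [mul_one_div]
    gcongr
  have hS0 : 0 ≤ S := hs.trans hS
  have hd6 : (Real.sqrt s / q) ^ 6 ≤ S ^ 3 * (1 / q ^ 6) := by
    calc (Real.sqrt s / q) ^ 6 = (s / q ^ 2) ^ 3 := by rw [← hd2]; ring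
      _ ≤ (S * (1 / q ^ 2)) ^ 3 := by gcongr
      _ = S ^ 3 * (1 / q ^ 6) := by rw [mul_pow]; field_simp
  have hl56 : l ^ 6 ≤ l ^ 5 := pow_le_pow_of_le_one hl hl1 (by norm_num)
  -- `2⁶` from the factor `2`, and `2⁵` from `(a + b)⁶ ≤ 2⁵ (a⁶ + b⁶)`.
  have hr6 : (2 * (l * K + Real.sqrt s / q)) ^ 6 ≤ 2048 * (K ^ 6 * l ^ 5 + S ^ 3 * (1 / q ^ 6)) := by
    have h1 := add_pow_le (mul_nonneg hl hK) hd0 6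
    have h2 : (l * K) ^ 6 ≤ K ^ 6 * l ^ 5 := by
      rw [mul_pow, mul_comm]
      gcongr
    rw [mul_pow]
    norm_num at h1 ⊢
    norm_num at hd6
    linarith
  set Q := 1 / q ^ 2 with hQ
  have hQ0 : 0 ≤ Q := by positivity
  have h3 : k2 * |k3| ≤ (2 * K) ^ 5 * l ^ 5 + S * (l ^ 3 * Q * |t|) := by
    rw [hk2, hk3, abs_mul, abs_of_nonneg (by positivity : 0 ≤ l ^ 3)]
    have h4 : l ^ 2 * a2 * (l ^ 3 * |t|) ≤ (2 * K) ^ 5 * l ^ 5 := by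
      calc l ^ 2 * a2 * (l ^ 3 * |t|) ≤ l ^ 2 * (2 * K) ^ 2 * (l ^ 3 * (2 * K) ^ 3) := by gcongr
        _ = (2 * K) ^ 5 * l ^ 5 := by ring
    have h5 : s / q ^ 2 * (l ^ 3 * |t|) ≤ S * Q * (l ^ 3 * |t|) := by gcongr
    linarith
  have h6 : |k5| ≤ (2 * K) ^ 5 * l ^ 5 + 10 * S * (l ^ 3 * Q * |t|) := by
    rw [hk5]
    refine (abs_add_le _ _).trans (add_le_add ?_ ?_)
    · rw [abs_mul, abs_of_nonneg (by positivity : 0 ≤ l ^ 5), mul_comm]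
      gcongr
    · rw [abs_mul, abs_of_nonneg (by positivity : 0 ≤ 10 * l ^ 3 * (s / q ^ 2))]
      calc 10 * l ^ 3 * (s / q ^ 2) * |t| ≤ 10 * l ^ 3 * (S * Q) * |t| := by gcongr
        _ = 10 * S * (l ^ 3 * Q * |t|) := by ring
  have hX : l ^ 3 / q ^ 2 * |t| = l ^ 3 * Q * |t| := by rw [hQ, mul_one_div]
  rw [edgeError, edgeConst, hX]
  have hX0 : 0 ≤ l ^ 3 * Q * |t| := by positivity
  have hY0 : 0 ≤ 1 / q ^ 6 := by positivity
  have hZ0 : 0 ≤ l ^ 5 := by positivity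
  generalize l ^ 3 * Q * |t| = X at *
  generalize 1 / q ^ 6 = Y at *
  generalize l ^ 5 = Z at *
  have hK6 : 0 ≤ K ^ 6 := by positivity
  have hS3 : 0 ≤ S ^ 3 := by positivity
  have hK5 : 0 ≤ (2 * K) ^ 5 := by positivity
  generalize K ^ 6 = K6 at *
  generalize S ^ 3 = S3 at *
  generalize (2 * K) ^ 5 = K5 at *
  have e1 := mul_nonneg hK6 hX0
  have e2 := mul_nonneg hK6 hY0
  have e3 := mul_nonneg hS3 hX0
  have e4 := mul_nonneg hS3 hZ0
  have e5 := mul_nonneg hK5 hX0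
  have e6 := mul_nonneg hK5 hY0
  have e7 := mul_nonneg hS0 hY0
  have e8 := mul_nonneg hS0 hZ0
  have e9 := mul_nonneg hS0 hX0
  linarith

lemma edgeExpansion {K S : ℝ} (hl : 0 ≤ l) (hl1 : l ≤ 1) (hs : 0 ≤ s) (hS : s ≤ S)
    (hq : 0 < q) (hr : 2 * (l * K + Real.sqrt s / q) ≤ 1 / 64) (hK : ∀ v ∈ μ.support, |v| ≤ K)
    {w w' : ℝ} (hw : IsRightEdge (refined μ l s q) w)
    (hw' : IsRightEdge ((refined μ l s q).map Neg.neg) w') :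
    EdgeExpansion μ l s q (edgeConst K S) (-edgeFun ((refined μ l s q).map Neg.neg) w')
      (edgeFun (refined μ l s q) w) := by
  have hprob := isProbabilityMeasure_refined (μ := μ) (l := l) (s := s) (q := q)
  have hpm : IsProbabilityMeasure ((refined μ l s q).map Neg.neg) :=
    Measure.isProbabilityMeasure_map measurable_neg.aemeasurable
  have hd0 : 0 ≤ Real.sqrt s / q := by positivity
  have hK0 : 0 ≤ K := by
    obtain ⟨v, hv⟩ := support_nonempty μ
    exact (abs_nonneg v).trans (hK v hv)
  set m := ∫ v, v ∂μ with hm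
  have hmM : ∫ v, v ∂(refined μ l s q) = l * m := integral_id_refined hK
  have hmK : |m| ≤ K := by
    have := abs_integral_pow_sub_le (μ := μ) (m := 0) (r := K) (by simpa using hK) 1
    simpa using this
  have hbase : ∀ v ∈ μ.support, |v - m| ≤ 2 * K := fun v hv => by
    refine (abs_sub _ _).trans ?_
    linarith [hK v hv]
  have hsub := support_refined_subset (A := -K) (B := K) hl hd0 fun v hv => abs_le.mp (hK v hv)
  have hrb : ∀ v ∈ (refined μ l s q).support, |v - l * m| ≤ 2 * (l * K + Real.sqrt s / q) := by
    intro v hv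
    obtain ⟨h1, h2⟩ := hsub hv
    obtain ⟨h3, h4⟩ := abs_le.mp hmK
    have h5 := mul_le_mul_of_nonneg_left h3 hl
    have h6 := mul_le_mul_of_nonneg_left h4 hl
    rw [abs_le]
    constructor <;> linarith
  have hrb' : ∀ v ∈ ((refined μ l s q).map Neg.neg).support,
      |v - -(l * m)| ≤ 2 * (l * K + Real.sqrt s / q) := by
    intro v hv
    have := hrb _ (mem_support_map_neg.mp hv)
    rwa [← abs_neg, neg_sub, sub_neg_eq_add, add_comm, ← sub_neg_eq_add] at this
  have hc1 : ∫ v, (v - m) ^ 1 ∂μ = 0 := by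
    have hid : Integrable (fun v : ℝ => v) μ := by
      simpa using integrable_pow_center hK 0 1
    simp only [pow_one]
    rw [integral_sub hid (integrable_const _), ← hm]
    simp
  have h2 := integral_refined_two (l := l) (q := q) hs hK m
  have h3 := integral_refined_three (l := l) (q := q) hs hK m
  have h5 := integral_refined_five (l := l) (q := q) hs hK m
  rw [hc1, mul_zero, add_zero] at h3 h5
  have herr := edge_error_le (K := K) (S := S) hl hl1 hs hS hK0
    ((le_abs_self _).trans (abs_integral_pow_sub_le hbase 2))
    (abs_integral_pow_sub_le hbase 3)
    (abs_integral_pow_sub_le hbase 5) h2 h3 h5 hq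
  have hup := (hw.expansion hmM hr hrb).trans herr
  -- For the lower edge the reflected measure is expanded: the mean and the odd central moments
  -- change sign, the error does not.
  have hneg : ∀ j : ℕ, ∫ v, (v - -(l * m)) ^ j ∂((refined μ l s q).map Neg.neg) =
      (-1) ^ j * ∫ v, (v - l * m) ^ j ∂(refined μ l s q) := by
    intro j
    have h1 : ∀ v : ℝ, (-v - -(l * m)) ^ j = (-1) ^ j * (v - l * m) ^ j := fun v => by
      rw [← mul_pow]
      congr 1
      ring
    rw [integral_map_neg fun v => (v - -(l * m)) ^ j, ← integral_const_mul ((-1 : ℝ) ^ j)]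
    simp only [h1]
  have hlow := hw'.expansion (m := -(l * m))
    ((integral_map_neg fun v => v).trans (by rw [integral_neg, hmM])) hr hrb'
  have hneg3 : |(-1 : ℝ) ^ 3 * ∫ v, (v - l * m) ^ 3 ∂(refined μ l s q)| =
      |∫ v, (v - l * m) ^ 3 ∂(refined μ l s q)| := by
    rw [abs_mul]
    norm_num
  have hneg5 : |(-1 : ℝ) ^ 5 * ∫ v, (v - l * m) ^ 5 ∂(refined μ l s q)| =
      |∫ v, (v - l * m) ^ 5 ∂(refined μ l s q)| := by
    rw [abs_mul]
    norm_num
  rw [hneg 2, hneg 3, hneg 4, hneg 5, hneg3, hneg5, neg_one_sq, one_mul,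
    Even.neg_one_pow (by decide : Even 4), one_mul] at hlow
  replace hlow := hlow.trans herr
  have hmom : moment id 1 (refined μ l s q) = l * m := by
    rw [moment_id]
    simpa using hmM
  have hupper : |edgeFun (refined μ l s q) w - (2 + moment id 1 (refined μ l s q)
      + centralMoment id 2 (refined μ l s q) + centralMoment id 3 (refined μ l s q)
      + (centralMoment id 4 (refined μ l s q)
        - 9 * centralMoment id 2 (refined μ l s q) ^ 2 / 4))|
      ≤ edgeError l q (edgeConst K S) (centralMoment id 3 μ) := by
    simp only [hmom, centralMoment_id, hmM]
    exact hup
  have hlower : |-edgeFun ((refined μ l s q).map Neg.neg) w' -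
      (-2 + moment id 1 (refined μ l s q)
      - centralMoment id 2 (refined μ l s q) + centralMoment id 3 (refined μ l s q)
      - (centralMoment id 4 (refined μ l s q)
        - 9 * centralMoment id 2 (refined μ l s q) ^ 2 / 4))|
      ≤ edgeError l q (edgeConst K S) (centralMoment id 3 μ) := by
    simp only [hmom, centralMoment_id, hmM]
    rw [← abs_neg]
    refine le_trans (le_of_eq ?_) hlow
    congr 1
    ring
  have hcent : moment id 1 μ = 0 → (∀ k, centralMoment id k (refined μ l s q) =
      moment id k (refined μ l s q)) ∧ centralMoment id 3 μ = moment id 3 μ := by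
    intro h0
    have hm0 : m = 0 := by
      rw [moment_id] at h0
      simpa [hm] using h0
    constructor
    · intro k
      rw [centralMoment_id, moment_id, hmM, hm0]
      simp
    · rw [centralMoment_id, moment_id, ← hm, hm0]
      simp
  refine ⟨fun h0 => ?_, fun h0 => ?_, hupper, hlower⟩
  · obtain ⟨hc, hc'⟩ := hcent h0
    rw [hc, hc, hc, hc'] at hupper
    exact hupper
  · obtain ⟨hc, hc'⟩ := hcent h0
    rw [hc, hc, hc, hc'] at hlower
    exact hlower

/-- All assertions for one base measure, from stability of its refined measure. -/
lemma refinedConclusion {A B ϖ K S : ℝ} {small : Prop} (hl : 0 ≤ l) (hs : 0 ≤ s) (hS : s ≤ S)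
    (hq : 0 < q) (hϖ : 0 < ϖ) (h : μ.support ⊆ Icc A B) (hK : ∀ v ∈ μ.support, |v| ≤ K)
    (hst : ENNReal.ofReal (1 + ϖ) ≤ invSqInf (refined μ l s q))
    (hsmall : small → l ≤ 1 ∧ 2 * (l * K + Real.sqrt s / q) ≤ 1 / 64) :
    RefinedConclusion μ l s q ϖ (edgeConst K S) small := by
  have hprob := isProbabilityMeasure_refined (μ := μ) (l := l) (s := s) (q := q)
  have hpm : IsProbabilityMeasure ((refined μ l s q).map Neg.neg) :=
    Measure.isProbabilityMeasure_map measurable_neg.aemeasurable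
  have hstab := stable_refined hl (by positivity) h hϖ hst
  obtain ⟨w, hw⟩ := hstab.exists_isRightEdge
  obtain ⟨w', hw'⟩ := hstab.map_neg.exists_isRightEdge
  exact ⟨refinedMeasureProperties hl hs hq h hst, _, _, _,
    refinedLawProperties hs hstab hw hw', fun hsm =>
      edgeExpansion hl (hsmall hsm).1 hs hS hq (hsmall hsm).2 hK hw hw'⟩

end Law

/-! ### Stability of the refined measure and its transfer between base measures -/

lemma invSq_add_mul_I (μ : Measure ℝ) (y η : ℝ) :
    invSq μ (y + η * Complex.I) = ∫ v, ((v - y) ^ 2 + η ^ 2)⁻¹ ∂μ := by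
  rw [invSq]
  refine integral_congr_ae (Eventually.of_forall fun v => ?_)
  simp only
  congr 1
  rw [← Complex.normSq_eq_norm_sq, Complex.normSq_apply]
  simp
  ring

lemma stieltjes_im_add_mul_I {μ : Measure ℝ} [IsFiniteMeasure μ] {η : ℝ} (hη : 0 < η) (y : ℝ) :
    (stieltjes μ (y + η * Complex.I)).im = η * ∫ v, ((v - y) ^ 2 + η ^ 2)⁻¹ ∂μ := by
  rw [stieltjes_im (mem_offSupport_of_im_ne (by simp [hη.ne'])), invSq_add_mul_I]
  simp

lemma integrable_inv_sq_add_sq {μ : Measure ℝ} [IsFiniteMeasure μ] {η : ℝ} (hη : 0 < η) (y : ℝ) :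
    Integrable (fun v => ((v - y) ^ 2 + η ^ 2)⁻¹) μ := by
  refine Integrable.of_bound (C := (η ^ 2)⁻¹) (by fun_prop) (Eventually.of_forall fun v => ?_)
  rw [Real.norm_of_nonneg (by positivity)]
  exact inv_anti₀ (by positivity) (by nlinarith [sq_nonneg (v - y)])

lemma measurable_inv_sq (x : ℝ) : Measurable fun v : ℝ => (ENNReal.ofReal ((v - x) ^ 2))⁻¹ := by
  fun_prop

section Refined

variable {μ : Measure ℝ} [IsProbabilityMeasure μ] {l s q : ℝ}

/-- Stability of the refined measure when its support is small. -/
lemma le_invSqInf_refined_of_small {A B : ℝ} (hl : 0 ≤ l) (hd : 0 ≤ Real.sqrt s / q)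
    (h : μ.support ⊆ Icc A B)
    (hsmall : (l * B + Real.sqrt s / q) - (l * A - Real.sqrt s / q) ≤ 1 / 2) :
    ENNReal.ofReal (1 + 1) ≤ invSqInf (refined μ l s q) := by
  have hprob := isProbabilityMeasure_refined (μ := μ) (l := l) (s := s) (q := q)
  refine le_iInf₂ fun x hx => ?_
  have hx' := hull_refined_subset hl hd h hx
  have hsub := support_refined_subset hl hd h
  have h1 : ∫⁻ _, ENNReal.ofReal (1 + 1) ∂(refined μ l s q) ≤
      ∫⁻ v, (ENNReal.ofReal ((v - x) ^ 2))⁻¹ ∂(refined μ l s q) := by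
    refine lintegral_mono_ae ?_
    filter_upwards [Measure.support_mem_ae] with v hv
    obtain ⟨h2, h3⟩ := hsub hv
    obtain ⟨h4, h5⟩ := hx'
    have h6 : (v - x) ^ 2 ≤ 2⁻¹ := by nlinarith
    have h7 : ENNReal.ofReal (1 + 1) = (ENNReal.ofReal 2⁻¹)⁻¹ := by
      rw [ENNReal.ofReal_inv_of_pos (by norm_num), inv_inv]
      norm_num
    rw [h7]
    exact ENNReal.inv_le_inv.mpr (ENNReal.ofReal_le_ofReal h6)
  simpa using h1

/-- Stability of the refined measure from a regularized stability of the base measure. -/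
lemma le_invSqInf_refined {A B ε η c : ℝ} (hl : 0 < l) (hd : 0 ≤ Real.sqrt s / q)
    (h : μ.support ⊆ Icc A B) (hε : 2 * (Real.sqrt s / q) ≤ ε * l) (hη : 0 < η)
    (hc : ∀ y ∈ Icc (A - ε) (B + ε), c * l ^ 2 ≤ ∫ v, ((v - y) ^ 2 + η ^ 2)⁻¹ ∂μ) :
    ENNReal.ofReal c ≤ invSqInf (refined μ l s q) := by
  refine le_iInf₂ fun x hx => ?_
  have hx' := hull_refined_subset hl.le hd h hx
  rw [lintegral_refined (measurable_inv_sq x)]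
  -- Each shift is treated alone by scaling out `l`. The point `x` may leave the scaled interval by
  -- `√s / q` and the shift `e` adds as much again, whence `2 √s / q ≤ ε l`. Removing `η²` from the
  -- denominator only increases the integral.
  have key : ∀ e : ℝ, |e| ≤ Real.sqrt s / q →
      ENNReal.ofReal c ≤ ∫⁻ v, (ENNReal.ofReal ((l * v + e - x) ^ 2))⁻¹ ∂μ := by
    intro e he
    obtain ⟨he1, he2⟩ := abs_le.mp he
    have hy : (x - e) / l ∈ Icc (A - ε) (B + ε) := by
      obtain ⟨h4, h5⟩ := hx'
      constructor
      · rw [le_div_iff₀ hl]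
        linarith
      · rw [div_le_iff₀ hl]
        linarith
    have h1 := hc _ hy
    set y := (x - e) / l with hy'
    have hxy : ∀ v, l * v + e - x = l * (v - y) := fun v => by
      rw [hy']
      field_simp
      ring
    have h2 : ENNReal.ofReal c ≤ ENNReal.ofReal (∫ v, (l ^ 2)⁻¹ * ((v - y) ^ 2 + η ^ 2)⁻¹ ∂μ) := by
      refine ENNReal.ofReal_le_ofReal ?_
      rw [integral_const_mul, inv_mul_eq_div, le_div_iff₀ (by positivity)]
      exact h1
    refine h2.trans ?_
    rw [ofReal_integral_eq_lintegral_ofReal ((integrable_inv_sq_add_sq hη y).const_mul _)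
      (Eventually.of_forall fun v => by positivity)]
    refine lintegral_mono fun v => ?_
    rw [hxy, ← mul_inv, ENNReal.ofReal_inv_of_pos (by positivity)]
    refine ENNReal.inv_le_inv.mpr (ENNReal.ofReal_le_ofReal ?_)
    rw [mul_pow]
    gcongr
    nlinarith
  have h1 := key (-(Real.sqrt s / q)) (by rw [abs_neg, abs_of_nonneg hd])
  have h2 := key (Real.sqrt s / q) (by rw [abs_of_nonneg hd])
  simp only [← sub_eq_add_neg] at h1
  calc ENNReal.ofReal c = 2⁻¹ * (ENNReal.ofReal c + ENNReal.ofReal c) := by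
        rw [← two_mul, ← mul_assoc, ENNReal.inv_mul_cancel (by norm_num) (by norm_num), one_mul]
    _ ≤ _ := by gcongr

end Refined

/-- Stability on the hull implies regularized stability on a neighborhood of the hull. -/
lemma exists_regularized {ν : Measure ℝ} [IsProbabilityMeasure ν] {A B c c' : ℝ} (hcc : c' < c)
    (hc0 : 0 < c) (h : ∀ y ∈ Icc A B, ENNReal.ofReal c ≤ ∫⁻ v, (ENNReal.ofReal ((v - y) ^ 2))⁻¹ ∂ν) :
    ∃ ε > 0, ∃ η > 0, ∀ y ∈ Icc (A - 3 * ε) (B + 3 * ε),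
      c' ≤ ∫ v, ((v - y) ^ 2 + η ^ 2)⁻¹ ∂ν := by
  -- With `ε = η = 1/(n+1)`, counterexamples `y n` accumulate at a point of `[A, B]`, where Fatou's
  -- lemma contradicts stability. The margin `3ε` later accommodates one `ε` for the support of the
  -- nearby measure and another for the two-point shift.
  by_contra! hcon
  have hpos : ∀ n : ℕ, 0 < 1 / ((n : ℝ) + 1) := fun n => by positivity
  choose y hy hlt using fun n : ℕ => hcon _ (hpos n) _ (hpos n)
  have hbd : ∀ n, y n ∈ Icc (A - 3) (B + 3) := fun n => by
    have h1 : 1 / ((n : ℝ) + 1) ≤ 1 := by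
      rw [div_le_one (by positivity)]
      linarith [Nat.cast_nonneg (α := ℝ) n]
    exact ⟨by linarith [(hy n).1], by linarith [(hy n).2]⟩
  obtain ⟨z, -, φ, hφ, hz⟩ := isCompact_Icc.tendsto_subseq hbd
  have h0 : Tendsto (fun n => 1 / ((φ n : ℝ) + 1)) atTop (𝓝 0) :=
    (tendsto_one_div_add_atTop_nhds_zero_nat (𝕜 := ℝ)).comp hφ.tendsto_atTop
  have hzAB : z ∈ Icc A B := by
    constructor
    · refine le_of_tendsto_of_tendsto (f := fun n => A - 3 * (1 / ((φ n : ℝ) + 1))) ?_ hz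
        (Eventually.of_forall fun n => (hy (φ n)).1)
      simpa using (h0.const_mul 3).const_sub A
    · refine le_of_tendsto_of_tendsto (g := fun n => B + 3 * (1 / ((φ n : ℝ) + 1))) hz ?_
        (Eventually.of_forall fun n => (hy (φ n)).2)
      simpa using (h0.const_mul 3).const_add B
  have hlim : ∀ v : ℝ, liminf (fun n => (ENNReal.ofReal ((v - y (φ n)) ^ 2
      + (1 / ((φ n : ℝ) + 1)) ^ 2))⁻¹) atTop = (ENNReal.ofReal ((v - z) ^ 2))⁻¹ := by
    intro v
    refine Tendsto.liminf_eq ?_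
    have h1 : Tendsto (fun n => (v - y (φ n)) ^ 2 + (1 / ((φ n : ℝ) + 1)) ^ 2) atTop
        (𝓝 ((v - z) ^ 2 + 0 ^ 2)) := ((hz.const_sub v).pow 2).add (h0.pow 2)
    rw [zero_pow two_ne_zero, add_zero] at h1
    exact (continuous_inv.tendsto _).comp ((ENNReal.continuous_ofReal.tendsto _).comp h1)
  have hfatou : ∫⁻ v, (ENNReal.ofReal ((v - z) ^ 2))⁻¹ ∂ν ≤ ENNReal.ofReal c' := by
    simp only [← hlim]
    refine (lintegral_liminf_le fun n => by fun_prop).trans ?_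
    refine (liminf_le_liminf (v := fun _ => ENNReal.ofReal c')
      (Eventually.of_forall fun n => ?_)).trans (by simp)
    have hp := hpos (φ n)
    have h1 : ∀ v, (ENNReal.ofReal ((v - y (φ n)) ^ 2 + (1 / ((φ n : ℝ) + 1)) ^ 2))⁻¹ =
        ENNReal.ofReal (((v - y (φ n)) ^ 2 + (1 / ((φ n : ℝ) + 1)) ^ 2)⁻¹) := fun v => by
      rw [ENNReal.ofReal_inv_of_pos (by positivity)]
    simp only [h1]
    rw [← ofReal_integral_eq_lintegral_ofReal (integrable_inv_sq_add_sq hp _)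
      (Eventually.of_forall fun v => by positivity)]
    exact ENNReal.ofReal_le_ofReal (hlt (φ n)).le
  have h2 := (h z hzAB).trans hfatou
  rw [ENNReal.ofReal_le_ofReal_iff'] at h2
  rcases h2 with h2 | h2 <;> linarith

/-- The measure `μ` is close to `ν`, whose support has hull `[A, B]`: its support is within `ε` of
`[A, B]`, and on a segment at height `η` the Stieltjes transforms are within `δ`. -/
structure IsCloseTo (ν : Measure ℝ) (A B ε δ η : ℝ) (μ : Measure ℝ) : Prop where
  support_subset : μ.support ⊆ Icc (A - ε) (B + ε)
  norm_le : ∀ y ∈ Icc (A - 3 * ε) (B + 3 * ε),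
    ‖stieltjes μ (y + η * Complex.I) - stieltjes ν (y + η * Complex.I)‖ ≤ δ

/-- The regularized integral is `Im m(y + iη) / η`, so a tolerance `η * δ` on the transforms costs
exactly `δ`. -/
lemma IsCloseTo.le_integral {ν μ : Measure ℝ} [IsFiniteMeasure ν] [IsFiniteMeasure μ]
    {A B ε δ η c : ℝ} (h : IsCloseTo ν A B ε (η * δ) η μ) (hη : 0 < η)
    (hc : ∀ y ∈ Icc (A - 3 * ε) (B + 3 * ε), c ≤ ∫ v, ((v - y) ^ 2 + η ^ 2)⁻¹ ∂ν) :
    ∀ y ∈ Icc (A - 3 * ε) (B + 3 * ε), c - δ ≤ ∫ v, ((v - y) ^ 2 + η ^ 2)⁻¹ ∂μ := by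
  intro y hy
  have h1 := (Complex.abs_im_le_norm _).trans (h.norm_le y hy)
  rw [Complex.sub_im, stieltjes_im_add_mul_I hη, stieltjes_im_add_mul_I hη, ← mul_sub, abs_mul,
    abs_of_pos hη] at h1
  have h2 := (abs_le.mp (le_of_mul_le_mul_left h1 hη)).1
  linarith [hc y hy]

lemma tendsto_sqrt_div {q : ℕ → ℝ} (hq : Tendsto q atTop atTop) (S : ℝ) :
    Tendsto (fun N => Real.sqrt S / q N) atTop (𝓝 0) := tendsto_const_nhds.div_atTop hq

/-- The assertions hold uniformly over all base measures close to `ν`. -/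
theorem exists_uniform_conclusion {ν : Measure ℝ} [IsProbabilityMeasure ν] {A B : ℝ}
    (hA : IsLeast ν.support A) (hB : IsGreatest ν.support B)
    {lam₀ β φ ϖ c₄ C₄ : ℝ} (hlam₀ : 0 ≤ lam₀) (hβ : 0 ≤ β) (hφ : 0 < φ) (hϖ : 0 < ϖ)
    (hc₄ : 0 < c₄) {lam q : ℕ → ℝ} (hlam : ∀ N : ℕ, lam N = lam₀ * (N : ℝ) ^ (-β))
    (hq : ∀ N : ℕ, q N = (N : ℝ) ^ φ)
    (hν_stable : ∀ᶠ N : ℕ in atTop,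
      ENNReal.ofReal ((1 + ϖ) * lam N ^ 2) ≤ invSqInf ν) :
    ∃ ε > 0, ∃ δ > 0, ∃ η > 0, ∃ (ϖ' C : ℝ) (N₀ : ℕ), 0 < ϖ' ∧ ∀ N ≥ N₀, ∀ s ∈ Icc c₄ C₄,
      ∀ μ : Measure ℝ, IsProbabilityMeasure μ → IsCloseTo ν A B ε δ η μ →
        RefinedConclusion μ (lam N) s (q N) ϖ' C (Tendsto lam atTop (𝓝 0)) := by
  have hqt : Tendsto q atTop atTop := by
    have := (tendsto_rpow_atTop hφ).comp (tendsto_natCast_atTop_atTop (R := ℝ))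
    exact this.congr fun N => (hq N).symm
  have hqpos : ∀ᶠ N in atTop, 0 < q N := hqt.eventually_gt_atTop 0
  have hl0 : ∀ N, 0 ≤ lam N := fun N => by
    rw [hlam]
    positivity
  have hdt := tendsto_sqrt_div hqt C₄
  have habs : ∀ {ε : ℝ} {μ : Measure ℝ}, μ.support ⊆ Icc (A - ε) (B + ε) →
      ∀ v ∈ μ.support, |v| ≤ max |A - ε| |B + ε| := fun h v hv =>
    abs_le_max_abs_abs (h hv).1 (h hv).2
  -- Either `λ → 0`, and the refined support eventually has length at most `1/2`; or `β = 0` and `λ`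
  -- is a positive constant, so stability of `ν` is quantitative.
  by_cases hsmall : Tendsto lam atTop (𝓝 0)
  · set K := max |A - 1| |B + 1| with hK
    have h1 : Tendsto (fun N => 2 * (lam N * K + Real.sqrt C₄ / q N)) atTop (𝓝 0) := by
      simpa using ((hsmall.mul_const K).add hdt).const_mul 2
    obtain ⟨N₀, hN₀⟩ := eventually_atTop.mp (((h1.eventually_le_const
      (show (0 : ℝ) < 1 / 64 by norm_num)).and (hsmall.eventually_le_const one_pos)).and hqpos)
    refine ⟨1, one_pos, 1, one_pos, 1, one_pos, 1, edgeConst K C₄, N₀, one_pos,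
      fun N hN s hs μ hμ hclose => ?_⟩
    obtain ⟨⟨h2, h3⟩, h4⟩ := hN₀ N hN
    have hs0 : 0 ≤ s := hc₄.le.trans hs.1
    have hd : Real.sqrt s / q N ≤ Real.sqrt C₄ / q N := by
      gcongr
      exact hs.2
    have hr : 2 * (lam N * K + Real.sqrt s / q N) ≤ 1 / 64 := by linarith
    have hbd := habs hclose.support_subset
    refine refinedConclusion (hl0 N) hs0 hs.2 h4 one_pos hclose.support_subset hbd
      ?_ fun _ => ⟨h3, hr⟩
    refine le_invSqInf_refined_of_small (A := -K) (B := K) (hl0 N) (by positivity)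
      (fun v hv => abs_le.mp (hbd v hv)) ?_
    linarith
  · have hβ0 : β = 0 := by
      by_contra hne
      refine hsmall ?_
      have hβ' : 0 < β := lt_of_le_of_ne hβ (Ne.symm hne)
      have := ((tendsto_rpow_neg_atTop hβ').comp (tendsto_natCast_atTop_atTop (R := ℝ))).const_mul lam₀
      rw [mul_zero] at this
      exact this.congr fun N => (hlam N).symm
    have hconst : ∀ N, lam N = lam₀ := fun N => by
      rw [hlam, hβ0, neg_zero, Real.rpow_zero, mul_one]
    have hpos : 0 < lam₀ := by
      refine lt_of_le_of_ne hlam₀ fun h0 => hsmall ?_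
      simp only [funext hconst, ← h0]
      exact tendsto_const_nhds
    obtain ⟨N₁, hN₁⟩ := hν_stable.exists
    rw [hconst] at hN₁
    have hl2 : 0 < lam₀ ^ 2 := by positivity
    obtain ⟨ε, hε, η, hη, hreg⟩ := exists_regularized (ν := ν) (A := A) (B := B)
      (c := (1 + ϖ) * lam₀ ^ 2) (c' := (1 + ϖ / 2) * lam₀ ^ 2) (by nlinarith) (by positivity)
      fun y hy => hN₁.trans (iInf₂_le y (by rwa [hull_eq_Icc hA hB]))
    have h1 : Tendsto (fun N => 2 * (Real.sqrt C₄ / q N)) atTop (𝓝 0) := by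
      simpa using hdt.const_mul 2
    obtain ⟨N₀, hN₀⟩ := eventually_atTop.mp ((h1.eventually_le_const
      (show 0 < ε * lam₀ by positivity)).and hqpos)
    -- Regularization reduced `ϖ` to `ϖ / 2`; closeness of the transforms takes another `ϖ / 4`.
    refine ⟨ε, hε, η * (ϖ / 4 * lam₀ ^ 2), by positivity, η, hη, ϖ / 4,
      edgeConst (max |A - ε| |B + ε|) C₄, N₀, by positivity, fun N hN s hs μ hμ hclose => ?_⟩
    obtain ⟨h2, h4⟩ := hN₀ N hN
    have hs0 : 0 ≤ s := hc₄.le.trans hs.1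
    have hd : Real.sqrt s / q N ≤ Real.sqrt C₄ / q N := by
      gcongr
      exact hs.2
    refine refinedConclusion (hl0 N) hs0 hs.2 h4 (by positivity) hclose.support_subset
      (habs hclose.support_subset) ?_ fun h => absurd h hsmall
    rw [hconst]
    refine le_invSqInf_refined (ε := ε) (η := η) hpos (by positivity) hclose.support_subset
      (by linarith) hη fun y hy => ?_
    have h5 := hclose.le_integral hη hreg y ⟨by linarith [hy.1], by linarith [hy.2]⟩
    linarith

/-! ### Empirical measures, test domains and absence of outliers -/

section Empirical

variable {N : ℕ} (v : Fin N → ℝ)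

lemma isProbabilityMeasure_empirical (hN : N ≠ 0) : IsProbabilityMeasure (empirical v) := by
  refine ⟨?_⟩
  have h : (N : ℝ≥0∞) ≠ 0 := by exact_mod_cast hN
  simp [empirical, ENNReal.inv_mul_cancel h (ENNReal.natCast_ne_top N)]

lemma integral_empirical {E : Type*} [NormedAddCommGroup E] [NormedSpace ℝ E] [CompleteSpace E]
    (f : ℝ → E) : ∫ x, f x ∂(empirical v) = (N : ℝ)⁻¹ • ∑ i, f (v i) := by
  rw [empirical, integral_smul_measure, integral_finsetSum_measure fun i _ =>
    integrable_dirac (by simp)]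
  simp

lemma support_empirical_subset {s : Set ℝ} (hs : IsClosed s) (h : ∀ i, v i ∈ s) :
    (empirical v).support ⊆ s := by
  refine Measure.support_subset_of_isClosed hs ?_
  rw [mem_ae_iff, empirical]
  simp [Measure.smul_apply, hs.measurableSet, h]

end Empirical

lemma stieltjes_sub_le {μ : Measure ℝ} [IsProbabilityMeasure μ] {η : ℝ} (hη : 0 < η) (x y : ℝ) :
    ‖stieltjes μ (x + η * Complex.I) - stieltjes μ (y + η * Complex.I)‖ ≤ |x - y| / η ^ 2 := by
  have key : ∀ x v : ℝ, ‖((v : ℂ) - (x + η * Complex.I))⁻¹‖ ≤ η⁻¹ := fun x v => by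
    rw [norm_inv]
    refine inv_anti₀ hη ?_
    simpa [abs_of_pos hη] using Complex.abs_im_le_norm ((v : ℂ) - (x + η * Complex.I))
  rw [stieltjes_sub (mem_offSupport_of_im_ne (by simp [hη.ne']))
    (mem_offSupport_of_im_ne (by simp [hη.ne'])), norm_mul, div_eq_mul_inv]
  have h1 : ‖(x : ℂ) + η * Complex.I - (y + η * Complex.I)‖ = |x - y| := by
    rw [add_sub_add_right_eq_sub, ← Complex.ofReal_sub, Complex.norm_real, Real.norm_eq_abs]
  rw [h1]
  gcongr
  refine (norm_integral_le_of_norm_le_const (C := (η ^ 2)⁻¹) (Eventually.of_forall fun v => ?_)).trans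
    (by simp)
  rw [norm_mul, pow_two, mul_inv]
  exact mul_le_mul (key x v) (key y v) (norm_nonneg _) (by positivity)

/-- Points of the closed upper half-plane at bounded distance from the real axis and away from
the support of `ν`. -/
def farDomain (ν : Measure ℝ) (K ε : ℝ) : Set ℂ :=
  (Icc (-K) K ×ℂ Icc 0 1) ∩ ⋂ x ∈ ν.support, {z : ℂ | ε ≤ ‖(x : ℂ) - z‖}

/-- A horizontal segment at height `η`. -/
def segmentDomain (a b η : ℝ) : Set ℂ := (fun y : ℝ => (y : ℂ) + η * Complex.I) '' Icc a b

lemma isTestDomain_farDomain (ν : Measure ℝ) (K : ℝ) {ε : ℝ} (hε : 0 < ε) :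
    IsTestDomain ν (farDomain ν K ε) := by
  refine ⟨?_, fun z hz => hz.1.2.1, fun x hx h => ?_⟩
  · refine (isCompact_Icc.reProdIm isCompact_Icc).inter_right ?_
    exact isClosed_biInter fun x _ => isClosed_le continuous_const (by fun_prop)
  · have := mem_iInter₂.mp h.2 x hx
    simp at this
    linarith

lemma isTestDomain_segmentDomain (ν : Measure ℝ) (a b : ℝ) {η : ℝ} (hη : 0 < η) :
    IsTestDomain ν (segmentDomain a b η) := by
  refine ⟨isCompact_Icc.image (by fun_prop), ?_, ?_⟩
  · rintro _ ⟨y, -, rfl⟩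
    simp [hη.le]
  · rintro x - ⟨y, -, h⟩
    have := congrArg Complex.im h
    simp at this
    exact hη.ne' this

/-- Potentials whose Stieltjes transform is bounded away from the support of `ν` have no
outliers. -/
lemma exists_mem_support_near {ν : Measure ℝ} [IsProbabilityMeasure ν] {N : ℕ} {v : Fin N → ℝ}
    {K ε M : ℝ} (hε : 0 < ε) (hv : ∀ i, |v i| ≤ K)
    (h : ∀ z ∈ farDomain ν K ε, ‖stieltjes (empirical v) z - stieltjes ν z‖ ≤ M) (i : Fin N) :
    ∃ x ∈ ν.support, |x - v i| < ε := by
  by_contra! hfar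
  have hN : 0 < N := i.pos
  have := isProbabilityMeasure_empirical v hN.ne'
  have hN' : (1 : ℝ) ≤ N := by exact_mod_cast hN
  -- An outlier `v i` carries mass at least `1/N`, so at height `(N M')⁻¹` above it the empirical
  -- transform has imaginary part at least `M'`. But it is bounded there by `M + ε⁻¹`; the `+ 1`
  -- makes the contradiction strict. The test domain has to reach down to the real axis for this to
  -- work for every `N`.
  set M' := |M| + ε⁻¹ + 1 with hM'
  have hM1 : 1 ≤ M' := by
    have : 0 < ε⁻¹ := inv_pos.mpr hε
    linarith [abs_nonneg M]
  set y : ℝ := (N * M')⁻¹ with hy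
  have hNM : 1 ≤ N * M' := by nlinarith
  have hy0 : 0 < y := by positivity
  have hy1 : y ≤ 1 := inv_le_one_of_one_le₀ hNM
  have hdist : ∀ x ∈ ν.support, ε ≤ ‖(x : ℂ) - (v i + y * Complex.I)‖ := fun x hx => by
    refine (hfar x hx).trans ?_
    simpa using Complex.abs_re_le_norm ((x : ℂ) - (v i + y * Complex.I))
  have hmem : (v i : ℂ) + y * Complex.I ∈ farDomain ν K ε := by
    refine ⟨?_, mem_iInter₂.mpr hdist⟩
    simp only [Complex.mem_reProdIm, Complex.add_re, Complex.ofReal_re, Complex.mul_re,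
      Complex.I_re, Complex.add_im, Complex.ofReal_im, Complex.mul_im, Complex.I_im]
    simp [abs_le.mp (hv i), hy0.le, hy1]
  have hν : ‖stieltjes ν (v i + y * Complex.I)‖ ≤ ε⁻¹ := by
    rw [stieltjes_eq]
    refine (norm_integral_le_of_norm_le_const (C := ε⁻¹) ?_).trans (by simp)
    filter_upwards [Measure.support_mem_ae] with x hx
    rw [norm_inv]
    exact inv_anti₀ hε (hdist x hx)
  have hlow : M' ≤ (stieltjes (empirical v) (v i + y * Complex.I)).im := by
    rw [stieltjes_im_add_mul_I hy0, integral_empirical, smul_eq_mul]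
    have h1 : (y ^ 2)⁻¹ ≤ ∑ j, ((v j - v i) ^ 2 + y ^ 2)⁻¹ := by
      refine le_trans (by simp) (Finset.single_le_sum (f := fun j => ((v j - v i) ^ 2 + y ^ 2)⁻¹)
        (fun j _ => by positivity) (Finset.mem_univ i))
    calc M' = y * ((N : ℝ)⁻¹ * (y ^ 2)⁻¹) := by
          rw [hy]
          field_simp
      _ ≤ _ := by gcongr
  have h2 := h _ hmem
  have h3 := (le_abs_self _).trans (Complex.abs_im_le_norm (stieltjes (empirical v)
    (v i + y * Complex.I)))
  have h4 := norm_sub_norm_le (stieltjes (empirical v) (v i + y * Complex.I))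
    (stieltjes ν (v i + y * Complex.I))
  linarith [le_abs_self M]

lemma isCloseTo_empirical {ν : Measure ℝ} [IsProbabilityMeasure ν] {A B : ℝ}
    (hA : IsLeast ν.support A) (hB : IsGreatest ν.support B) {N : ℕ} {v : Fin N → ℝ}
    {K ε δ η M : ℝ} (hε : 0 < ε) (hv : ∀ i, |v i| ≤ K)
    (h : ∀ z ∈ farDomain ν K ε, ‖stieltjes (empirical v) z - stieltjes ν z‖ ≤ M)
    (h' : ∀ z ∈ segmentDomain (A - 3 * ε) (B + 3 * ε) η,
      ‖stieltjes (empirical v) z - stieltjes ν z‖ ≤ δ) :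
    IsCloseTo ν A B ε δ η (empirical v) where
  support_subset := support_empirical_subset v isClosed_Icc fun i => by
    obtain ⟨x, hx, hxi⟩ := exists_mem_support_near hε hv h i
    have h1 := hA.2 hx
    have h2 := hB.2 hx
    rw [abs_lt] at hxi
    constructor <;> linarith
  norm_le y hy := h' _ ⟨y, hy, rfl⟩

/-! ### Decay rates and concentration for independent samples -/

lemma tendsto_const_mul_rpow_neg (b : ℝ) {a : ℝ} (ha : 0 < a) :
    Tendsto (fun N : ℕ => b * (N : ℝ) ^ (-a)) atTop (𝓝 0) := by
  simpa using ((tendsto_rpow_neg_atTop ha).comp (tendsto_natCast_atTop_atTop (R := ℝ))).const_mul b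

/-- Chebyshev's inequality for the empirical mean of a bounded function. -/
lemma pi_le_abs_mean_sub_le {ν : Measure ℝ} [IsProbabilityMeasure ν] {g : ℝ → ℝ}
    (hg : Measurable g) {M : ℝ} (hM : ∀ x, |g x| ≤ M) {c : ℝ} (hc : 0 < c) {N : ℕ} (hN : N ≠ 0) :
    Measure.pi (fun _ : Fin N => ν) {v | c ≤ |(N : ℝ)⁻¹ * ∑ i, g (v i) - ∫ x, g x ∂ν|} ≤
      ENNReal.ofReal (M ^ 2 / c ^ 2 / N) := by
  have hN' : (N : ℝ) ≠ 0 := by exact_mod_cast hN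
  have hmem : MemLp g 2 ν := MemLp.of_bound hg.aestronglyMeasurable M (Eventually.of_forall hM)
  set X : (Fin N → ℝ) → ℝ := ∑ i, fun v => g (v i) with hX
  have hmemi : ∀ i : Fin N, MemLp (fun v : Fin N → ℝ => g (v i)) 2
      (Measure.pi fun _ : Fin N => ν) := fun i =>
    hmem.comp_measurePreserving (measurePreserving_eval (fun _ : Fin N => ν) i)
  have hXm : MemLp X 2 (Measure.pi fun _ : Fin N => ν) := memLp_finsetSum' _ fun i _ => hmemi i
  have hmean : ∫ v, X v ∂(Measure.pi fun _ : Fin N => ν) = N * ∫ x, g x ∂ν := by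
    have h1 : ∀ i : Fin N, ∫ v : Fin N → ℝ, g (v i) ∂(Measure.pi fun _ : Fin N => ν) =
        ∫ x, g x ∂ν := fun i =>
      integral_comp_eval (μ := fun _ : Fin N => ν) (i := i) (f := g) hg.aestronglyMeasurable
    simp only [hX, Finset.sum_apply]
    rw [integral_finsetSum _ fun i _ => (hmemi i).integrable (by norm_num)]
    simp [h1]
  have hvar : variance X (Measure.pi fun _ : Fin N => ν) ≤ N * M ^ 2 := by
    rw [hX, variance_sum_pi (X := fun _ => g) fun _ => hmem]
    have h2 : variance g ν ≤ M ^ 2 := by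
      refine (variance_le_expectation_sq hg.aestronglyMeasurable).trans ?_
      refine (integral_mono_of_nonneg (Eventually.of_forall fun x => sq_nonneg _)
        (integrable_const (M ^ 2)) (Eventually.of_forall fun x => ?_)).trans (by simp)
      exact sq_le_sq' (abs_le.mp (hM x)).1 (abs_le.mp (hM x)).2
    simpa using mul_le_mul_of_nonneg_left h2 (Nat.cast_nonneg N)
  have hcheb := meas_ge_le_variance_div_sq hXm (c := N * c) (by positivity)
  refine (measure_mono fun v hv => ?_).trans (hcheb.trans (ENNReal.ofReal_le_ofReal ?_))
  · simp only [mem_ofPred_eq] at hv ⊢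
    rw [hmean]
    have h3 : X v - N * ∫ x, g x ∂ν = N * ((N : ℝ)⁻¹ * ∑ i, g (v i) - ∫ x, g x ∂ν) := by
      simp only [hX, Finset.sum_apply]
      field_simp
    rw [h3, abs_mul, Nat.abs_cast]
    gcongr
  · calc variance X (Measure.pi fun _ : Fin N => ν) / (N * c) ^ 2 ≤ N * M ^ 2 / (N * c) ^ 2 := by
          gcongr
      _ = M ^ 2 / c ^ 2 / N := by field_simp

lemma pi_lt_norm_stieltjes_sub_le {ν : Measure ℝ} [IsProbabilityMeasure ν] {η c : ℝ} (hη : 0 < η)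
    (hc : 0 < c) {N : ℕ} (hN : N ≠ 0) (y : ℝ) :
    Measure.pi (fun _ : Fin N => ν) {v | 2 * c < ‖stieltjes (empirical v) (y + η * Complex.I) -
      stieltjes ν (y + η * Complex.I)‖} ≤ ENNReal.ofReal (2 * (η⁻¹ ^ 2 / c ^ 2) / N) := by
  set g : ℝ → ℂ := fun x => ((x : ℂ) - (y + η * Complex.I))⁻¹ with hg
  have hgm : Measurable g := by fun_prop
  have hgb : ∀ x, ‖g x‖ ≤ η⁻¹ := fun x => by
    rw [hg, norm_inv]
    refine inv_anti₀ hη ?_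
    simpa [abs_of_pos hη] using Complex.abs_im_le_norm ((x : ℂ) - (y + η * Complex.I))
  have hgi : Integrable g ν :=
    Integrable.of_bound hgm.aestronglyMeasurable η⁻¹ (Eventually.of_forall hgb)
  have hre : (stieltjes ν (y + η * Complex.I)).re = ∫ x, (g x).re ∂ν := by
    rw [stieltjes_eq]
    exact (integral_re hgi).symm
  have him : (stieltjes ν (y + η * Complex.I)).im = ∫ x, (g x).im ∂ν := by
    rw [stieltjes_eq]
    exact (integral_im hgi).symm
  have hemp : ∀ v : Fin N → ℝ, stieltjes (empirical v) (y + η * Complex.I) =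
      (N : ℝ)⁻¹ • ∑ i, g (v i) := fun v => by rw [stieltjes_eq, integral_empirical]
  have h1 := pi_le_abs_mean_sub_le (ν := ν) (g := fun x => (g x).re)
    (Complex.measurable_re.comp hgm) (fun x => (Complex.abs_re_le_norm _).trans (hgb x)) hc hN
  have h2 := pi_le_abs_mean_sub_le (ν := ν) (g := fun x => (g x).im)
    (Complex.measurable_im.comp hgm) (fun x => (Complex.abs_im_le_norm _).trans (hgb x)) hc hN
  calc _ ≤ Measure.pi (fun _ : Fin N => ν)
        ({v | c ≤ |(N : ℝ)⁻¹ * ∑ i, (g (v i)).re - ∫ x, (g x).re ∂ν|} ∪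
          {v | c ≤ |(N : ℝ)⁻¹ * ∑ i, (g (v i)).im - ∫ x, (g x).im ∂ν|}) := by
        refine measure_mono fun v hv => ?_
        by_contra hcon
        simp only [mem_union, mem_ofPred_eq, not_or, not_le] at hcon
        have h3 := Complex.norm_le_abs_re_add_abs_im (stieltjes (empirical v) (y + η * Complex.I) -
          stieltjes ν (y + η * Complex.I))
        rw [Complex.sub_re, Complex.sub_im, hre, him, hemp, Complex.smul_re, Complex.smul_im,
          Complex.re_sum, Complex.im_sum, smul_eq_mul, smul_eq_mul, ← hemp] at h3
        rw [mem_ofPred_eq] at hv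
        linarith [hcon.1, hcon.2]
    _ ≤ _ := (measure_union_le _ _).trans (add_le_add h1 h2)
    _ = _ := by
        rw [← ENNReal.ofReal_add (by positivity) (by positivity)]
        congr 1
        ring

/-- With probability `1 - O(1 / N)` the empirical measure of independent samples is close to their
law. -/
lemma exists_pi_not_isCloseTo_le {ν : Measure ℝ} [IsProbabilityMeasure ν] {A B ε δ η : ℝ}
    (hA : IsLeast ν.support A) (hB : IsGreatest ν.support B) (hε : 0 < ε) (hδ : 0 < δ)
    (hη : 0 < η) :
    ∃ C : ℝ, ∀ N : ℕ, N ≠ 0 → Measure.pi (fun _ : Fin N => ν)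
      {v | ¬ IsCloseTo ν A B ε δ η (empirical v)} ≤ ENNReal.ofReal (C / N) := by
  -- A finite net suffices: transforms at height `η` are Lipschitz with constant `η⁻²`, so the
  -- errors add up to `δ/4 + δ/2 + δ/4`.
  obtain ⟨t, -, htf, ht⟩ := (isCompact_Icc (a := A - 3 * ε) (b := B + 3 * ε)).finite_cover_balls
    (show 0 < δ / 4 * η ^ 2 by positivity)
  set T := htf.toFinset with hT
  refine ⟨T.card * (2 * (η⁻¹ ^ 2 / (δ / 4) ^ 2)), fun N hN => ?_⟩
  set P := Measure.pi (fun _ : Fin N => ν) with hP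
  -- Samples almost surely lie in the support of `ν`, so there are no outliers to exclude.
  have hsupp : P {v | ¬ ∀ i, v i ∈ ν.support} = 0 := by
    rw [← ae_iff, ae_all_iff]
    intro i
    exact (measurePreserving_eval (fun _ : Fin N => ν) i).quasiMeasurePreserving.ae
      Measure.support_mem_ae
  have hsub : {v | ¬ IsCloseTo ν A B ε δ η (empirical v)} ⊆ {v | ¬ ∀ i, v i ∈ ν.support} ∪
      ⋃ y ∈ T, {v : Fin N → ℝ | 2 * (δ / 4) < ‖stieltjes (empirical v) (y + η * Complex.I) -
        stieltjes ν (y + η * Complex.I)‖} := by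
    intro v hv
    by_contra hcon
    simp only [mem_union, mem_iUnion, mem_ofPred_eq, not_or, not_not, not_exists, not_lt] at hcon
    obtain ⟨h1, h2⟩ := hcon
    have := isProbabilityMeasure_empirical v hN
    refine hv ⟨support_empirical_subset v isClosed_Icc fun i => ?_, fun y hy => ?_⟩
    · have h3 := hA.2 (h1 i)
      have h4 := hB.2 (h1 i)
      constructor <;> linarith
    · obtain ⟨x, hx, hxy⟩ := mem_iUnion₂.mp (ht hy)
      rw [Metric.mem_ball, Real.dist_eq] at hxy
      have h5 : |y - x| / η ^ 2 ≤ δ / 4 := by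
        rw [div_le_iff₀ (by positivity)]
        exact hxy.le
      have h6 := (stieltjes_sub_le (μ := empirical v) hη y x).trans h5
      have h7 := (stieltjes_sub_le (μ := ν) hη y x).trans h5
      have h8 := h2 x (htf.mem_toFinset.mpr hx)
      rw [norm_sub_rev] at h7
      have h9 := norm_add₃_le (a := stieltjes (empirical v) (y + η * Complex.I) -
          stieltjes (empirical v) (x + η * Complex.I))
        (b := stieltjes (empirical v) (x + η * Complex.I) - stieltjes ν (x + η * Complex.I))
        (c := stieltjes ν (x + η * Complex.I) - stieltjes ν (y + η * Complex.I))
      rw [sub_add_sub_cancel, sub_add_sub_cancel] at h9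
      linarith
  refine (measure_mono hsub).trans ((measure_union_le _ _).trans ?_)
  rw [hsupp, zero_add]
  refine (measure_biUnion_finset_le _ _).trans ?_
  refine (Finset.sum_le_sum fun y _ =>
    pi_lt_norm_stieltjes_sub_le hη (by positivity : 0 < δ / 4) hN y).trans ?_
  rw [Finset.sum_const, nsmul_eq_mul, ← ENNReal.ofReal_natCast,
    ← ENNReal.ofReal_mul (by positivity)]
  refine ENNReal.ofReal_le_ofReal (le_of_eq ?_)
  ring

end RefinedSC

end

/-! ### The four cases -/

theorem proposition2p5
    (ν : Measure ℝ) [IsProbabilityMeasure ν]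
    (hν_compact : IsCompact ν.support) (hν_centered : moment id 1 ν = 0)
    (lam₀ β φ ϖ c₄ C₄ : ℝ) (hlam₀ : 0 ≤ lam₀) (hβ : 0 ≤ β) (hφ : 0 < φ) (hφ' : φ ≤ 1 / 2)
    (hϖ : 0 < ϖ) (hc₄ : 0 < c₄)
    (lam q : ℕ → ℝ) (hlam : ∀ N : ℕ, lam N = lam₀ * (N : ℝ) ^ (-β))
    (hq : ∀ N : ℕ, q N = (N : ℝ) ^ φ)
    (hν_stable : ∀ᶠ N : ℕ in atTop,
      ENNReal.ofReal ((1 + ϖ) * lam N ^ 2) ≤ RefinedSC.invSqInf ν) :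
    -- on the typical event, for deterministic and random potentials alike
    (∀ (a K : ℝ) (B : Set ℂ → ℝ) (n₀ : Set ℂ → ℕ), 0 < a →
      ∃ (ϖ' C : ℝ) (N₀ : ℕ), 0 < ϖ' ∧ ∀ N ≥ N₀, ∀ s ∈ Icc c₄ C₄,
        ∀ v ∈ RefinedSC.typicalEvent ν (lam N) ϖ a K B n₀ N,
          RefinedSC.RefinedConclusion (RefinedSC.empirical v) (lam N) s (q N) ϖ' C
            (Tendsto lam atTop (𝓝 0))) ∧
    -- deterministic potentials
    (∀ V : (N : ℕ) → Fin N → ℝ, RefinedSC.IsDeterministicPotential ν V →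
      (∀ᶠ N : ℕ in atTop, ENNReal.ofReal ((1 + ϖ) * lam N ^ 2) ≤
        RefinedSC.invSqInf (RefinedSC.empirical (V N))) →
      ∃ (ϖ' C : ℝ) (N₀ : ℕ), 0 < ϖ' ∧ ∀ N ≥ N₀, ∀ s ∈ Icc c₄ C₄,
        RefinedSC.RefinedConclusion (RefinedSC.empirical (V N)) (lam N) s (q N) ϖ' C
          (Tendsto lam atTop (𝓝 0))) ∧
    -- random potentials with independent entries of law `ν`
    (∀ t : ℝ, 0 < t →
      (∀ᶠ N : ℕ in atTop, ENNReal.ofReal (1 - (N : ℝ) ^ (-t)) ≤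
        Measure.pi (fun _ : Fin N => ν)
          {v | ENNReal.ofReal ((1 + ϖ) * lam N ^ 2) ≤
            RefinedSC.invSqInf (RefinedSC.empirical v)}) →
      ∃ (ϖ' C t' : ℝ) (N₀ : ℕ), 0 < ϖ' ∧ 0 < t' ∧ ∀ N ≥ N₀,
        ENNReal.ofReal (1 - (N : ℝ) ^ (-t')) ≤
          Measure.pi (fun _ : Fin N => ν)
            {v | ∀ s ∈ Icc c₄ C₄,
              RefinedSC.RefinedConclusion (RefinedSC.empirical v) (lam N) s (q N) ϖ' C
                (Tendsto lam atTop (𝓝 0))}) ∧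
    -- the deterministic limit measure `ν`
    (∃ (ϖ' C : ℝ) (N₀ : ℕ), 0 < ϖ' ∧ ∀ N ≥ N₀, ∀ s ∈ Icc c₄ C₄,
      RefinedSC.RefinedConclusion ν (lam N) s (q N) ϖ' C (Tendsto lam atTop (𝓝 0))) := by
  obtain ⟨A, hA⟩ := hν_compact.exists_isLeast
    (Measure.nonempty_support (IsProbabilityMeasure.ne_zero ν))
  obtain ⟨B, hB⟩ := hν_compact.exists_isGreatest
    (Measure.nonempty_support (IsProbabilityMeasure.ne_zero ν))
  obtain ⟨ε, hε, δ, hδ, η, hη, ϖ', C, N₀, hϖ', hconc⟩ :=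
    RefinedSC.exists_uniform_conclusion hA hB (C₄ := C₄) hlam₀ hβ hφ hϖ hc₄ hlam hq hν_stable
  have hfar := fun K => RefinedSC.isTestDomain_farDomain ν K hε
  have hseg := RefinedSC.isTestDomain_segmentDomain ν (A - 3 * ε) (B + 3 * ε) hη
  refine ⟨fun a K b n₀ ha => ?_, fun V hV _ => ?_, fun t _ _ => ?_, ϖ', C, N₀, hϖ',
    fun N hN s hs => hconc N hN s hs ν inferInstance ⟨?_, fun y _ => ?_⟩⟩
  · set D := RefinedSC.farDomain ν K ε with hD
    set S := RefinedSC.segmentDomain (A - 3 * ε) (B + 3 * ε) η with hS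
    obtain ⟨N₁, hN₁⟩ := eventually_atTop.mp
      (((RefinedSC.tendsto_const_mul_rpow_neg (b D) ha).eventually_le_const one_pos).and
        ((RefinedSC.tendsto_const_mul_rpow_neg (b S) ha).eventually_le_const hδ))
    -- Only the two test domains `D` and `S` are consulted, so finitely many thresholds enter; the
    -- `+ 1` excludes the empty configuration.
    refine ⟨ϖ', C, N₀ + N₁ + n₀ D + n₀ S + 1, hϖ', fun N hN s hs v hv => ?_⟩
    obtain ⟨h1, h2⟩ := hN₁ N (by omega)
    refine hconc N (by omega) s hs _
      (RefinedSC.isProbabilityMeasure_empirical v (by omega)) ?_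
    exact RefinedSC.isCloseTo_empirical hA hB hε hv.1
      (fun z hz => (hv.2.2 D (hfar K) (by omega) z hz).trans h1)
      fun z hz => (hv.2.2 S hseg (by omega) z hz).trans h2
  · obtain ⟨⟨K, hK⟩, a, ha, hclose⟩ := hV
    obtain ⟨b₁, hb₁⟩ := hclose _ (hfar K)
    obtain ⟨b₂, hb₂⟩ := hclose _ hseg
    obtain ⟨N₁, hN₁⟩ := eventually_atTop.mp ((hb₁.and hb₂).and
      (((RefinedSC.tendsto_const_mul_rpow_neg b₁ ha).eventually_le_const one_pos).and
        ((RefinedSC.tendsto_const_mul_rpow_neg b₂ ha).eventually_le_const hδ)))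
    refine ⟨ϖ', C, N₀ + N₁ + 1, hϖ', fun N hN s hs => ?_⟩
    obtain ⟨⟨h1, h2⟩, h3, h4⟩ := hN₁ N (by omega)
    refine hconc N (by omega) s hs _
      (RefinedSC.isProbabilityMeasure_empirical (V N) (by omega)) ?_
    exact RefinedSC.isCloseTo_empirical hA hB hε (hK N) (fun z hz => (h1 z hz).trans h3)
      fun z hz => (h2 z hz).trans h4
  · obtain ⟨c, hc⟩ := RefinedSC.exists_pi_not_isCloseTo_le (ε := ε) hA hB hε hδ hη
    obtain ⟨N₁, hN₁⟩ := eventually_atTop.mp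
      ((RefinedSC.tendsto_const_mul_rpow_neg c (half_pos one_pos)).eventually_le_const one_pos)
    refine ⟨ϖ', C, 1 / 2, N₀ + N₁ + 1, hϖ', half_pos one_pos, fun N hN => ?_⟩
    have hN' : (0 : ℝ) < N := by exact_mod_cast (by omega : 0 < N)
    -- Half of the power `N⁻¹` is spent on absorbing the constant `c`, which is why `1/2` is chosen
    -- as the exponent.
    have hfail : c / N ≤ (N : ℝ) ^ (-(1 / 2) : ℝ) := by
      have h1 : c / N = c * (N : ℝ) ^ (-(1 / 2) : ℝ) * (N : ℝ) ^ (-(1 / 2) : ℝ) := by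
        rw [mul_assoc, ← Real.rpow_add hN', div_eq_mul_inv, ← Real.rpow_neg_one]
        norm_num
      rw [h1]
      exact mul_le_of_le_one_left (by positivity) (hN₁ N (by omega))
    set P := Measure.pi fun _ : Fin N => ν
    set good : Set (Fin N → ℝ) := {v | RefinedSC.IsCloseTo ν A B ε δ η (RefinedSC.empirical v)}
    have h1 : 1 ≤ P good + ENNReal.ofReal ((N : ℝ) ^ (-(1 / 2) : ℝ)) := by
      calc 1 = P univ := measure_univ.symm
        _ ≤ P good + P goodᶜ := measure_univ_le_add_compl _
        _ ≤ _ := by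
          gcongr
          exact (hc N (by omega)).trans (ENNReal.ofReal_le_ofReal hfail)
    calc ENNReal.ofReal (1 - (N : ℝ) ^ (-(1 / 2) : ℝ)) ≤ P good := by
          rw [ENNReal.ofReal_sub _ (by positivity), ENNReal.ofReal_one]
          exact tsub_le_iff_right.mpr h1
      _ ≤ _ := measure_mono fun v hv s hs => hconc N (by omega) s hs _
          (RefinedSC.isProbabilityMeasure_empirical v (by omega)) hv
  · exact fun x hx => ⟨by linarith [hA.2 hx], by linarith [hB.2 hx]⟩
  · simpa using hδ.le
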